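/- \textbf{Conventions.} A norm $\|\cdot\|_{E}$ on $\mathbb{R}^n$ is \emph{symmetric} if $\|(\varepsilon_1x_{\pi(1)},\ldots,\varepsilon_nx_{\pi(n)})\|_{E}=\|x\|_{E}$ for every $x\in\mathbb{R}^n$, every permutation $\pi$ of $\{1,\ldots,n\}$ and all signs $\varepsilon_1,\ldots,\varepsilon_n\in\{-1,1\}$; its unit ball is $B_E=\{x\in\mathbb{R}^n:\|x\|_E\le 1\}$. A \emph{weak membership oracle} for $B_E$ answers each question $(y,\varepsilon)$, where $y\in\mathbb{Q}^n$ and $0<\varepsilon\in\mathbb{Q}$, either by a correct assertion that the Euclidean distance from $y$ to $B_E$ is at most $\varepsilon$, or by a correct assertion that the Euclidean ball of radius $\varepsilon$ centered at $y$ is not contained in $B_E$. A real number $x$ is given to an algorithm by an oracle that, when asked for precision $k\in\{0,1,2,\ldots\}$ (in unary), returns the binary representation of an integer $m$ with $|x-m/2^k|\le 1/2^k$. An algorithm is a deterministic Turing machine with access to oracles. Its \emph{oracle time} is its number of steps, where a call to an oracle costs only the time that is needed to write the question and to read the answer; rational numbers are written in binary. \textbf{Theorem.} There are a universal constant $\kappa>0$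 and a function $(D,\delta)\mapsto d(D,\delta)\in\mathbb{N}$ satisfying $$d(D,\delta)\le \kappa\left(D+\frac{\log(1/\delta)}{\delta}\right)\qquad\text{for all } D\ge 1 \text{ and } 0<\delta\le\tfrac12,$$ such that for every $1\le p\le\infty$ there is a deterministic oracle algorithm $\mathrm{Alg}_p$ with the following property. Let $n\ge 2$ be an integer, let $D\ge 1$ and $0<\delta\le\frac12$ be real numbers, and let $\|\cdot\|_E$ be a symmetric norm on $\mathbb{R}^n$ such that $$e^{-n^{D}}\le\|e_1\|_E=\cdots=\|e_n\|_E\le e^{n^{D}},$$ where $e_1,\ldots,e_n$ is the standard basis of $\mathbb{R}^n$. Suppose that $\mathrm{Alg}_p$ receives as input $n$ in binary, the real numbers $D$ and $\delta$, and $E$ through any weak membership oracle for $B_E$; if $1/p$ is irrational (where $1/\infty=0$), then it also has access to the real number $1/p$. Then $\mathrm{Alg}_p$ halts in oracle time at most $n^{d(D,\delta)}$, and it outputs a rational number $r$ that satisfies $$(1-\delta)\,\mathrm{diam}_{\ell_p^n}(B_E)\le r\le(1+\delta)\,\mathrm{diam}_{\ell_p^n}(B_E),$$ where $\mathrm{diam}_{\ell_p^n}(B_E)$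 denotes the diameter of $B_E$ with respect to the $\ell_p^n$ norm. -/

import Mathlib

/-! ### Strings and encodings of numbers -/

/-- The finite alphabet of the machines: two binary digits and three punctuation marks. -/
inductive TapeSymbol : Type
  | digit (b : Bool)
  | minus
  | slash
  | comma
  deriving DecidableEq, Fintype

/-- The binary digits of a natural number, least significant digit first. -/
def natCode (m : ℕ) : List TapeSymbol :=
  (Nat.bits m).map TapeSymbol.digit

/-- Binary representation of an integer, with a minus sign in front of negative integers. -/
def intCode (m : ℤ) : List TapeSymbol :=
  (if m < 0 then [TapeSymbol.minus] else []) ++ natCode m.natAbs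

/-- Binary representation `numerator / denominator` of a rational number in lowest terms. -/
def ratCode (r : ℚ) : List TapeSymbol :=
  intCode r.num ++ TapeSymbol.slash :: natCode r.den

/-- The string `y₁,y₂,…,yₙ,ε` by which one asks about the rational point `y` with tolerance `ε`. -/
def queryCode {n : ℕ} (y : Fin n → ℚ) (ε : ℚ) : List TapeSymbol :=
  (List.ofFn fun i => ratCode (y i) ++ [TapeSymbol.comma]).flatten ++ ratCode ε

/-- The natural number `k` in unary. -/
def unaryCode (k : ℕ) : List TapeSymbol :=
  List.replicate k (TapeSymbol.digit true)

/-! ### Deterministic oracle Turing machines -/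

/-- The oracles to which a machine has access. -/
inductive OraclePort : Type
  /-- membership in the convex body -/
  | body
  /-- the real parameter `D` -/
  | degree
  /-- the real parameter `δ` -/
  | accuracy
  /-- the real parameter `1 / p` -/
  | exponent
  deriving DecidableEq

/-- A deterministic oracle Turing machine: a finite multi-stack Turing machine (Mathlib's model
`Turing.TM2`, in which a tape is a pair of stacks) over the alphabet `TapeSymbol`. At each of its
finitely many labels, the program either runs a `Turing.TM2` statement, or calls one of the
oracles and moves on to the given label. -/
structure OracleTM where
  /-- index type of the stacks -/
  K : Type
  [decEqK : DecidableEq K]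
  [fintypeK : Fintype K]
  /-- the stack that holds the input at the start -/
  input : K
  /-- the stack that holds the output at the end -/
  output : K
  /-- the stack on which the questions to the oracles are written -/
  question : K
  /-- the stack on which the oracles write their answers -/
  answer : K
  /-- the labels of the program -/
  Λ : Type
  [fintypeΛ : Fintype Λ]
  /-- the label at which the program starts -/
  main : Λ
  /-- the states of the finite internal memory -/
  σ : Type
  [fintypeσ : Fintype σ]
  /-- the initial state of the internal memory -/
  initialState : σ
  /-- the program -/
  prog : Λ → Turing.TM2.Stmt (fun _ : K => TapeSymbol) Λ σ ⊕ (OraclePort × Λ)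

namespace OracleTM

attribute [instance] OracleTM.decEqK OracleTM.fintypeK OracleTM.fintypeΛ OracleTM.fintypeσ

/-- Configurations: the current label (`none` if the machine has halted), the state of the
internal memory and the contents of the stacks. -/
abbrev Cfg (M : OracleTM) : Type :=
  Turing.TM2.Cfg (fun _ : M.K => TapeSymbol) M.Λ M.σ

/-- At the start, the input stack holds the input (first symbol on top), and every other stack is
empty. -/
def init (M : OracleTM) (w : List TapeSymbol) : M.Cfg :=
  ⟨some M.main, M.initialState, Function.update (fun _ => []) M.input w⟩

/-- One step of the machine with oracles `Ω`; a machine that has halted stays where it is. A call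
to an oracle is a single step: it erases the question, and replaces the contents of the answer
stack by the answer. So the cost of a call is the time that the machine takes in order to write
the question and to read the answer. -/
def step (M : OracleTM) (Ω : OraclePort → List TapeSymbol → List TapeSymbol) (c : M.Cfg) : M.Cfg :=
  match c.l with
  | none => c
  | some l =>
    match M.prog l with
    | Sum.inl s => Turing.TM2.stepAux s c.var c.stk
    | Sum.inr (i, l') =>
      ⟨some l', c.var,
        Function.update (Function.update c.stk M.question []) M.answer (Ω i (c.stk M.question))⟩

/-- With oracles `Ω` and input `w`, the machine halts after at most `T` steps, and then its output
stack holds exactly `out`. -/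
def OutputsWithin (M : OracleTM) (Ω : OraclePort → List TapeSymbol → List TapeSymbol)
    (w : List TapeSymbol) (T : ℕ) (out : List TapeSymbol) : Prop :=
  ((M.step Ω)^[T] (M.init w)).l = none ∧ ((M.step Ω)^[T] (M.init w)).stk M.output = out

end OracleTM

/-! ### Oracles for real numbers and for sets -/

/-- `O` represents the real number `x`: asked for precision `k` (in unary), it answers with an
integer `m` such that `m / 2 ^ k` approximates `x` within `1 / 2 ^ k`. -/
def IsRealOracle (x : ℝ) (O : List TapeSymbol → List TapeSymbol) : Prop :=
  ∀ k : ℕ, ∃ m : ℤ, O (unaryCode k) = intCode m ∧ |x - m / 2 ^ k| ≤ 1 / 2 ^ k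

/-- `O` is a weak membership oracle for `S`: asked about a rational point `y` and a rational
tolerance `ε > 0`, it either asserts that `y` is at Euclidean distance at most `ε` from `S`, or it
asserts that the Euclidean ball of radius `ε` around `y` is not contained in `S`. -/
def IsWeakMembershipOracle {n : ℕ} (S : Set (EuclideanSpace ℝ (Fin n)))
    (O : List TapeSymbol → List TapeSymbol) : Prop :=
  ∀ (y : Fin n → ℚ) (ε : ℚ), 0 < ε →
    (O (queryCode y ε) = [TapeSymbol.digit true] ∧
        WithLp.toLp 2 (fun i => (y i : ℝ)) ∈ Metric.cthickening (ε : ℝ) S) ∨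
      (O (queryCode y ε) = [TapeSymbol.digit false] ∧
        ¬ Metric.closedBall (WithLp.toLp 2 fun i => (y i : ℝ)) (ε : ℝ) ⊆ S)

/-! ### Symmetric norms -/

/-- `N` is a norm on `ℝⁿ` that is invariant under permutations and changes of signs of the
coordinates. -/
structure IsSymmetricNorm {n : ℕ} (N : Seminorm ℝ (Fin n → ℝ)) : Prop where
  eq_zero_of_apply_eq_zero : ∀ x, N x = 0 → x = 0
  apply_signed_perm : ∀ (x : Fin n → ℝ) (π : Equiv.Perm (Fin n)) (s : Fin n → ℝ),
    (∀ i, s i = 1 ∨ s i = -1) → N (fun i => s i * x (π i)) = N x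

/-- The unit ball of `N`, as a subset of `ℓ_pⁿ`. -/
def unitBallIn (p : ENNReal) {n : ℕ} (N : Seminorm ℝ (Fin n → ℝ)) :
    Set (PiLp p fun _ : Fin n => ℝ) :=
  {x | N (WithLp.ofLp x) ≤ 1}

/-! The unit ball is convex and centrally symmetric, so its diameter is twice the supremum of the
`ℓ_p` norm on it. A vector `z` of norm `ρ > 0` has weights `w i` of sum 1 with `|z i| ≥ ρ * w i ^
(1/p)` (`PiLp.exists_weights`). Conversely, `|y i| ≥ λ * w i ^ (1/p)` for weights of sum close to 1
forces `‖y‖` to be almost `λ` or more (`PiLp.le_norm_of_weights`). Both facts include `p = ∞`, with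
`1/p = 0`. So one may search over scales `λ` and weights `w`, asking the oracle about the point with
coordinates `λ * w i ^ (1/p)`.

Symmetry leaves few weights to try. By permutations `w` may be taken decreasing, and as the norm is
monotone in the absolute values (`IsSymmetricNorm.mono`), weights may be rounded down. Let `M` be of
order `1/δ`, let `q` be about `1 - 1/M`, and let `2 ^ G` be about `n * M`. After rounding to powers
of `q`, the weights are given by the numbers of those that are at least `q ^ j`, for `j ≤ M * G`;
the lighter weights sum to at most `1/M`. These counts matter only up to a factor `1 + 1/M`, so they
are replaced by a staircase below them: each bit of a code either passes to the next level or, when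
`a` coordinates have been written, writes `⌊a/M⌋ + 1` more. Blocks grow geometrically, hence there
are at most `M * G` of them, and at most `(2 n M) ^ (4 M) = n ^ O(log(1/δ)/δ)` codes suffice. The
staircase keeps a total weight of at least `1 - 3/M` (`exists_path`, `exists_code`).

All numbers are built from powers of `b = 1 + 1/R`: the scales are `b ^ T / 2 ^ P`, `q = b ^ (-B)`,
and a coordinate at level `l` is `b ^ (T - m l) / 2 ^ P`, where `m` lies below `B/p` by at most 3.
Too small an `m` enlarges coordinates, which does no harm to soundness (`Good.le_diam`) and costs a
factor of at most `b ^ (3 M G) ≤ exp (3/M)` in completeness (`exists_good`). As `R` is even, the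
fractions are in lowest terms as they stand. The largest accepted scale, doubled, is the output
(`search_accuracy`).

The algorithm is a program with bounded loops on registers (`LoopProg`), whose effect and number of
operations are computed by recursion. Registers lengthen by no more than the cost, so a program of
cost `C` on registers of length `L` takes time at most `400 * C * (L + C + 1)` on stacks
(`implements_compile`), and stack programs become oracle machines step for step (`Exec.steps`). Only
the search for a sufficient number of digits of `δ` is an unbounded loop (`runs_search`). The time
bound follows from `steps_le` and `steps_le_pow`. -/

/-! ### A structured language for stack machines -/

/-- Structured programs over stacks indexed by `K` with finite memory `σ`. -/
inductive StackCmd (K σ : Type) : Type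
  | load (f : σ → σ)
  | push (k : K) (f : σ → TapeSymbol)
  | pop (k : K) (f : σ → Option TapeSymbol → σ)
  | ask (i : OraclePort)
  | seq (a b : StackCmd K σ)
  | ite (c : σ → Bool) (a b : StackCmd K σ)
  | whileDo (c : σ → Bool) (a : StackCmd K σ)

namespace StackCmd

variable {K σ : Type} [DecidableEq K]

/-- `Exec Ω Q A c s s' t`: the program `c` leads from `s` to `s'` in exactly `t` steps, where `Q`
and `A` are the question and the answer stack. -/
inductive Exec (Ω : OraclePort → List TapeSymbol → List TapeSymbol) (Q A : K) :
    StackCmd K σ → σ × (K → List TapeSymbol) → σ × (K → List TapeSymbol) → ℕ → Prop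
  | load (f v S) : Exec Ω Q A (.load f) (v, S) (f v, S) 1
  | push (k f v S) : Exec Ω Q A (.push k f) (v, S) (v, Function.update S k (f v :: S k)) 1
  | pop (k f v S) : Exec Ω Q A (.pop k f) (v, S)
      (f v (S k).head?, Function.update S k (S k).tail) 1
  | ask (i v S) : Exec Ω Q A (.ask i) (v, S)
      (v, Function.update (Function.update S Q []) A (Ω i (S Q))) 1
  | seq {a b s s₁ s₂ t₁ t₂} : Exec Ω Q A a s s₁ t₁ → Exec Ω Q A b s₁ s₂ t₂ →
      Exec Ω Q A (.seq a b) s s₂ (t₁ + t₂)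
  | ite_true {c a b s s₁ t} : c s.1 = true → Exec Ω Q A a s s₁ t →
      Exec Ω Q A (.ite c a b) s s₁ (1 + t)
  | ite_false {c a b s s₁ t} : c s.1 = false → Exec Ω Q A b s s₁ t →
      Exec Ω Q A (.ite c a b) s s₁ (1 + t)
  | while_false {c a s} : c s.1 = false → Exec Ω Q A (.whileDo c a) s s 1
  | while_true {c a s s₁ s₂ t₁ t₂} : c s.1 = true → Exec Ω Q A a s s₁ t₁ →
      Exec Ω Q A (.whileDo c a) s₁ s₂ t₂ → Exec Ω Q A (.whileDo c a) s s₂ (1 + (t₁ + t₂))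

/-- The labels of the compiled program. -/
def Lab : StackCmd K σ → Type
  | .load _ => Unit
  | .push _ _ => Unit
  | .pop _ _ => Unit
  | .ask _ => Unit
  | .seq a b => Lab a ⊕ Lab b
  | .ite _ a b => Unit ⊕ (Lab a ⊕ Lab b)
  | .whileDo _ a => Unit ⊕ Lab a

/-- There are finitely many labels. -/
@[reducible]
def fintypeLab : (c : StackCmd K σ) → Fintype (Lab c)
  | .load _ => inferInstanceAs (Fintype Unit)
  | .push _ _ => inferInstanceAs (Fintype Unit)
  | .pop _ _ => inferInstanceAs (Fintype Unit)
  | .ask _ => inferInstanceAs (Fintype Unit)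
  | .seq a b =>
    letI := fintypeLab a
    letI := fintypeLab b
    inferInstanceAs (Fintype (Lab a ⊕ Lab b))
  | .ite _ a b =>
    letI := fintypeLab a
    letI := fintypeLab b
    inferInstanceAs (Fintype (Unit ⊕ (Lab a ⊕ Lab b)))
  | .whileDo _ a =>
    letI := fintypeLab a
    inferInstanceAs (Fintype (Unit ⊕ Lab a))

/-- The label at which a compiled program starts. -/
def entry : (c : StackCmd K σ) → Lab c
  | .load _ => ()
  | .push _ _ => ()
  | .pop _ _ => ()
  | .ask _ => ()
  | .seq a _ => Sum.inl (entry a)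
  | .ite _ _ _ => Sum.inl ()
  | .whileDo _ _ => Sum.inl ()

/-- The instruction at a label, for a program whose labels are embedded by `emb` into a larger
program and which continues at `exit`. -/
def instr {L : Type} : (c : StackCmd K σ) → (emb : Lab c → L) → (exit : L) → Lab c →
    Turing.TM2.Stmt (fun _ : K => TapeSymbol) L σ ⊕ (OraclePort × L)
  | .load f, _, exit, _ => .inl (.load f (.goto fun _ => exit))
  | .push k f, _, exit, _ => .inl (.push k f (.goto fun _ => exit))
  | .pop k f, _, exit, _ => .inl (.pop k f (.goto fun _ => exit))
  | .ask i, _, exit, _ => .inr (i, exit)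
  | .seq a b, emb, _, .inl l => instr a (fun x => emb (.inl x)) (emb (.inr (entry b))) l
  | .seq _ b, emb, exit, .inr l => instr b (fun x => emb (.inr x)) exit l
  | .ite c a b, emb, _, .inl _ =>
    .inl (.branch c (.goto fun _ => emb (.inr (.inl (entry a))))
      (.goto fun _ => emb (.inr (.inr (entry b)))))
  | .ite _ a _, emb, exit, .inr (.inl l) => instr a (fun x => emb (.inr (.inl x))) exit l
  | .ite _ _ b, emb, exit, .inr (.inr l) => instr b (fun x => emb (.inr (.inr x))) exit l
  | .whileDo c a, emb, exit, .inl _ =>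
    .inl (.branch c (.goto fun _ => emb (.inr (entry a))) (.goto fun _ => exit))
  | .whileDo _ a, emb, _, .inr l => instr a (fun x => emb (.inr x)) (emb (.inl ())) l

/-- The oracle machine that runs a structured program. -/
def machine [Fintype K] [Fintype σ] (c : StackCmd K σ) (input output question answer : K)
    (v : σ) : OracleTM where
  K := K
  input := input
  output := output
  question := question
  answer := answer
  Λ := Option (Lab c)
  fintypeΛ := letI := fintypeLab c; inferInstance
  main := some (entry c)
  σ := σ
  initialState := v
  prog := fun l => match l with
    | none => .inl .halt
    | some l => instr c some none l

theorem step_of_stmt (M : OracleTM) (Ω : OraclePort → List TapeSymbol → List TapeSymbol)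
    {l : M.Λ} {s : Turing.TM2.Stmt (fun _ : M.K => TapeSymbol) M.Λ M.σ} (h : M.prog l = .inl s)
    (v : M.σ) (S : M.K → List TapeSymbol) :
    M.step Ω ⟨some l, v, S⟩ = Turing.TM2.stepAux s v S := by
  simp [OracleTM.step, h]

theorem step_of_oracle (M : OracleTM) (Ω : OraclePort → List TapeSymbol → List TapeSymbol)
    {l l' : M.Λ} {i : OraclePort} (h : M.prog l = .inr (i, l'))
    (v : M.σ) (S : M.K → List TapeSymbol) :
    M.step Ω ⟨some l, v, S⟩ = ⟨some l', v, Function.update (Function.update S M.question [])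
      M.answer (Ω i (S M.question))⟩ := by
  simp [OracleTM.step, h]

/-- The compiled program simulates the structured one step for step. -/
theorem Exec.steps {Ω : OraclePort → List TapeSymbol → List TapeSymbol} (M : OracleTM)
    {c : StackCmd M.K M.σ} {s s' : M.σ × (M.K → List TapeSymbol)} {t : ℕ}
    (h : Exec Ω M.question M.answer c s s' t) :
    ∀ (emb : Lab c → M.Λ) (exit : M.Λ), (∀ l, M.prog (emb l) = instr c emb exit l) →
      (M.step Ω)^[t] ⟨some (emb (entry c)), s.1, s.2⟩ = ⟨some exit, s'.1, s'.2⟩ := by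
  induction h with
  | load f v S =>
    intro emb exit hp
    exact step_of_stmt M Ω (hp _) v S
  | push k f v S =>
    intro emb exit hp
    exact step_of_stmt M Ω (hp _) v S
  | pop k f v S =>
    intro emb exit hp
    exact step_of_stmt M Ω (hp _) v S
  | ask i v S =>
    intro emb exit hp
    exact step_of_oracle M Ω (hp _) v S
  | @seq a b s s₁ s₂ t₁ t₂ _ _ iha ihb =>
    intro emb exit hp
    rw [Nat.add_comm, Function.iterate_add_apply]
    have h1 := iha (fun x => emb (Sum.inl x)) (emb (Sum.inr (entry b))) (fun l => hp (Sum.inl l))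
    have h2 := ihb (fun x => emb (Sum.inr x)) exit (fun l => hp (Sum.inr l))
    exact (congrArg _ h1).trans h2
  | @ite_true c a b s s₁ t hc _ ih =>
    intro emb exit hp
    rw [Nat.add_comm, Function.iterate_add_apply]
    have h1 := ih (fun x => emb (Sum.inr (Sum.inl x))) exit (fun l => hp (Sum.inr (Sum.inl l)))
    refine (congrArg _ ((step_of_stmt M Ω (hp _) s.1 s.2).trans ?_)).trans h1
    simp [Turing.TM2.stepAux, hc]
  | @ite_false c a b s s₁ t hc _ ih =>
    intro emb exit hp
    rw [Nat.add_comm, Function.iterate_add_apply]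
    have h1 := ih (fun x => emb (Sum.inr (Sum.inr x))) exit (fun l => hp (Sum.inr (Sum.inr l)))
    refine (congrArg _ ((step_of_stmt M Ω (hp _) s.1 s.2).trans ?_)).trans h1
    simp [Turing.TM2.stepAux, hc]
  | @while_false c a s hc =>
    intro emb exit hp
    refine (step_of_stmt M Ω (hp _) s.1 s.2).trans ?_
    simp [Turing.TM2.stepAux, hc]
  | @while_true c a s s₁ s₂ t₁ t₂ hc _ _ iha ihb =>
    intro emb exit hp
    have h1 := iha (fun x => emb (Sum.inr x)) (emb (Sum.inl ())) (fun l => hp (Sum.inr l))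
    have h2 := ihb emb exit hp
    rw [Nat.add_comm, Function.iterate_add_apply, Nat.add_comm t₁, Function.iterate_add_apply]
    have h3 : (M.step Ω)^[1] ⟨some (emb (entry (.whileDo c a))), s.1, s.2⟩ =
        ⟨some (emb (Sum.inr (entry a))), s.1, s.2⟩ := by
      refine (step_of_stmt M Ω (hp _) s.1 s.2).trans ?_
      simp [Turing.TM2.stepAux, hc]
    exact (congrArg _ ((congrArg _ h3).trans h1)).trans h2

/-- A terminating execution gives an output of the compiled machine. -/
theorem Exec.outputsWithin [Fintype K] [Fintype σ]
    {Ω : OraclePort → List TapeSymbol → List TapeSymbol}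
    {c : StackCmd K σ} {input output question answer : K} {v v' : σ} {w : List TapeSymbol}
    {S' : K → List TapeSymbol} {t T : ℕ}
    (h : Exec Ω question answer c (v, Function.update (fun _ => []) input w) (v', S') t)
    (hT : t + 1 ≤ T) :
    (machine c input output question answer v).OutputsWithin Ω w T (S' output) := by
  set M := machine c input output question answer v with hM
  have h1 := Exec.steps (Ω := Ω) M (c := c) h some none (fun l => rfl)
  -- The additional step is the halt instruction at the exit label `none`.
  have h2 : (M.step Ω)^[t + 1] (M.init w) = ⟨none, v', S'⟩ := by
    rw [Nat.add_comm, Function.iterate_add_apply]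
    exact (congrArg _ h1).trans rfl
  have h3 : ∀ k, (M.step Ω)^[k] ⟨none, v', S'⟩ = ⟨none, v', S'⟩ := by
    intro k
    exact Function.iterate_fixed rfl k
  obtain ⟨k, rfl⟩ := Nat.exists_eq_add_of_le hT
  have h4 : (M.step Ω)^[t + 1 + k] (M.init w) = ⟨none, v', S'⟩ := by
    rw [Nat.add_comm, Function.iterate_add_apply, h2, h3]
  unfold OracleTM.OutputsWithin
  rw [h4]
  exact ⟨rfl, rfl⟩

end StackCmd

/-! ### Gadgets on stacks of binary digits -/

/-- The registers of the algorithm. -/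
inductive Reg : Type
  | n | mu | flag | M | D | H | nM | B | R | R1 | m | P | P2 | eps | Z | L | Tm
  | T | best | code | cd | half | bit | nbit | S | W | V | a | e | num | den | q | rest
  | one | t | u | ans
  deriving DecidableEq

instance : Fintype Reg where
  elems := {.n, .mu, .flag, .M, .D, .H, .nM, .B, .R, .R1, .m, .P, .P2, .eps, .Z, .L, .Tm, .T, .best,
    .code, .cd, .half, .bit, .nbit, .S, .W, .V, .a, .e, .num, .den, .q, .rest, .one, .t, .u, .ans}
  complete := by intro x; cases x <;> decide

/-- The stacks of the machine: one for each register, loop counters, and work space. -/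
inductive Stk : Type
  | reg (r : Reg)
  | ctr (i : Fin 8)
  | opA | opB | tmp | question | answer
  deriving DecidableEq, Fintype

/-- The finite memory: two symbols, a carry bit and a remainder modulo `N + 1`. -/
structure Mem (N : ℕ) : Type where
  x : Option TapeSymbol
  y : Option TapeSymbol
  c : Bool
  r : Fin (N + 1)
  deriving Fintype

/-- The binary digit that a symbol stands for. -/
def symBit : TapeSymbol → Bool
  | .digit b => b
  | _ => false

@[simp]
theorem symBit_digit (b : Bool) : symBit (.digit b) = b := rfl

/-! ### Addition and subtraction of digit strings -/

/-- The number that is represented by a string, least significant digit first. -/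
def strVal : List TapeSymbol → ℕ
  | [] => 0
  | s :: l => (symBit s).toNat + 2 * strVal l

theorem strVal_natCode (m : ℕ) : strVal (natCode m) = m := by
  unfold natCode
  induction m using Nat.binaryRec' with
  | zero => simp [strVal]
  | bit b n h ih =>
    rw [Nat.bits_append_bit n b h]
    simp only [List.map_cons, strVal, symBit, ih, Nat.bit_val]
    omega

/-- Pointwise carry automaton on pairs of digit strings. -/
def zipBits (f : Bool → Bool → Bool → Bool × Bool) : Bool → List TapeSymbol → List TapeSymbol →
    Bool × List Bool
  | c, [], [] => (c, [])
  | c, [], b :: B =>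
    ((zipBits f (f c false (symBit b)).1 [] B).1,
      (f c false (symBit b)).2 :: (zipBits f (f c false (symBit b)).1 [] B).2)
  | c, a :: A, [] =>
    ((zipBits f (f c (symBit a) false).1 A []).1,
      (f c (symBit a) false).2 :: (zipBits f (f c (symBit a) false).1 A []).2)
  | c, a :: A, b :: B =>
    ((zipBits f (f c (symBit a) (symBit b)).1 A B).1,
      (f c (symBit a) (symBit b)).2 :: (zipBits f (f c (symBit a) (symBit b)).1 A B).2)

theorem length_zipBits (f : Bool → Bool → Bool → Bool × Bool) (c : Bool)
    (A B : List TapeSymbol) : (zipBits f c A B).2.length = max A.length B.length := by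
  induction c, A, B using zipBits.induct f with
  | case1 c => simp [zipBits]
  | case2 c b B ih => simp [zipBits, ih]
  | case3 c a A ih => simp [zipBits, ih]
  | case4 c a A b B ih => simp [zipBits, ih]

/-- Full adder. -/
def adder (c a b : Bool) : Bool × Bool := ((a && b) || (c && (a || b)), xor c (xor a b))

/-- Full subtractor. -/
def subtractor (c a b : Bool) : Bool × Bool := ((!a && (b || c)) || (b && c), xor c (xor a b))

/-- The last carry is the digit missing at the top, so it counts with weight `2 ^ length`; in this
form each position is a finite check on bits. -/
theorem strVal_adder (c : Bool) (A B : List TapeSymbol) :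
    strVal ((zipBits adder c A B).2.map .digit) +
      2 ^ (zipBits adder c A B).2.length * (zipBits adder c A B).1.toNat =
      strVal A + strVal B + c.toNat := by
  induction c, A, B using zipBits.induct adder with
  | case1 c => simp [zipBits, strVal]
  | case2 c b B ih =>
    simp only [zipBits, List.map_cons, strVal, List.length_cons, pow_succ] at ih ⊢
    rcases c <;> rcases h : symBit b <;> simp [adder, h] at ih ⊢ <;> linarith
  | case3 c a A ih =>
    simp only [zipBits, List.map_cons, strVal, List.length_cons, pow_succ] at ih ⊢
    rcases c <;> rcases h : symBit a <;> simp [adder, h] at ih ⊢ <;> linarith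
  | case4 c a A b B ih =>
    simp only [zipBits, List.map_cons, strVal, List.length_cons, pow_succ] at ih ⊢
    rcases c <;> rcases h : symBit a <;> rcases h' : symBit b <;>
      simp [adder, h, h'] at ih ⊢ <;> linarith

/-- Borrows stand on the side of the minuend, which keeps truncated subtraction out of the identity.
-/
theorem strVal_subtractor (c : Bool) (A B : List TapeSymbol) :
    strVal ((zipBits subtractor c A B).2.map .digit) + strVal B + c.toNat = strVal A +
      2 ^ (zipBits subtractor c A B).2.length * (zipBits subtractor c A B).1.toNat := by
  induction c, A, B using zipBits.induct subtractor with
  | case1 c => simp [zipBits, strVal]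
  | case2 c b B ih =>
    simp only [zipBits, List.map_cons, strVal, List.length_cons, pow_succ] at ih ⊢
    rcases c <;> rcases h : symBit b <;> simp [subtractor, h] at ih ⊢ <;> linarith
  | case3 c a A ih =>
    simp only [zipBits, List.map_cons, strVal, List.length_cons, pow_succ] at ih ⊢
    rcases c <;> rcases h : symBit a <;> simp [subtractor, h] at ih ⊢ <;> linarith
  | case4 c a A b B ih =>
    simp only [zipBits, List.map_cons, strVal, List.length_cons, pow_succ] at ih ⊢
    rcases c <;> rcases h : symBit a <;> rcases h' : symBit b <;>
      simp [subtractor, h, h'] at ih ⊢ <;> linarith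

theorem strVal_lt (l : List TapeSymbol) : strVal l < 2 ^ l.length := by
  induction l with
  | nil => simp [strVal]
  | cons s l ih =>
    simp only [strVal, List.length_cons, pow_succ]
    have := Bool.toNat_le (symBit s)
    omega

theorem strVal_replicate_false (k : ℕ) : strVal (List.replicate k (.digit false)) = 0 := by
  induction k with
  | zero => rfl
  | succ k ih => simp [List.replicate_succ, strVal, ih, symBit]

/-! ### Loops over the symbols of a stack -/

namespace StackCmd

variable {N : ℕ} {Ω : OraclePort → List TapeSymbol → List TapeSymbol}

/-- Execution with the standard question and answer stacks. -/
abbrev Runs (Ω : OraclePort → List TapeSymbol → List TapeSymbol) (c : StackCmd Stk (Mem N))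
    (start final : Mem N × (Stk → List TapeSymbol)) (t : ℕ) : Prop :=
  Exec Ω Stk.question Stk.answer c start final t

/-- Pop a symbol into the first memory cell. -/
def popX (k : Stk) : StackCmd Stk (Mem N) := .pop k fun v s => { v with x := s }

/-- Empty the stack `k`, running `body` on each symbol. -/
def each (k : Stk) (body : StackCmd Stk (Mem N)) : StackCmd Stk (Mem N) :=
  .seq (popX k) (.whileDo (fun v => v.x.isSome) (.seq body (popX k)))

/-- A loop rule: the invariant `I l` holds before a symbol is popped, with `l` the contents that
remain. Each symbol costs one test, one run of the body and one pop. -/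
theorem runs_each (k : Stk) (body : StackCmd Stk (Mem N)) (c : ℕ)
    (I : List TapeSymbol → Mem N → (Stk → List TapeSymbol) → Prop)
    (hk : ∀ l v S, I l v S → S k = l)
    (hb : ∀ s l v S, I (s :: l) v S → ∃ v' S' t,
      Runs Ω body ({ v with x := some s }, Function.update S k l) (v', S') t ∧ t ≤ c ∧ I l v' S')
    (l : List TapeSymbol) (v : Mem N) (S : Stk → List TapeSymbol) (h : I l v S) :
    ∃ v' S' t, Runs Ω (each k body) (v, S) ({ v' with x := none }, S') t ∧
      t ≤ (c + 2) * (l.length + 1) ∧ I [] v' S' := by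
  have key : ∀ l v S, I l v S → ∃ v' S' t,
      Runs Ω (.whileDo (fun v => v.x.isSome) (.seq body (popX k)))
        ({ v with x := l.head? }, Function.update S k l.tail) ({ v' with x := none }, S') t ∧
      t ≤ (c + 2) * l.length + 1 ∧ I [] v' S' := by
    intro l
    induction l with
    | nil =>
      intro v S h
      refine ⟨v, S, 1, ?_, by simp, h⟩
      have : Function.update S k [] = S := by rw [← hk _ _ _ h, Function.update_eq_self]
      simp only [List.head?_nil, List.tail_nil, this]
      exact Exec.while_false rfl
    | cons s l ih =>
      intro v S h
      obtain ⟨v₁, S₁, t₁, hr, ht, hI⟩ := hb s l v S h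
      obtain ⟨v₂, S₂, t₂, hr₂, ht₂, hI₂⟩ := ih v₁ S₁ hI
      refine ⟨v₂, S₂, 1 + (t₁ + 1 + t₂),
        Exec.while_true rfl (Exec.seq hr (Exec.pop k _ _ _)) ?_, ?_, hI₂⟩
      · simp only [hk _ _ _ hI]
        exact hr₂
      · simp only [List.length_cons]
        linarith
  obtain ⟨v', S', t, hr, ht, hI⟩ := key l v S h
  refine ⟨v', S', 1 + t, Exec.seq (Exec.pop k _ _ _) ?_, by linarith, hI⟩
  simp only [hk _ _ _ h]
  exact hr

/-- Remove all symbols from a stack. -/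
def clear (k : Stk) : StackCmd Stk (Mem N) := each k (.load id)

/-- The carry bit has to survive, because `store` clears its target before it consults that bit. -/
theorem runs_clear (k : Stk) (v : Mem N) (S : Stk → List TapeSymbol) :
    ∃ v' t, Runs Ω (clear k) (v, S) (v', Function.update S k []) t ∧
      t ≤ 3 * ((S k).length + 1) ∧ v'.c = v.c := by
  obtain ⟨v', S', t, h, ht, hI⟩ := runs_each (Ω := Ω) k (.load id) 1
    (fun l v' S' => S' = Function.update S k l ∧ v'.c = v.c)
    (by rintro l v' S' ⟨rfl, -⟩; simp)
    (by
      rintro s l v' S' ⟨rfl, hc⟩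
      exact ⟨_, _, _, Exec.load _ _ _, le_rfl, by simp, hc⟩)
    (S k) v S ⟨by simp, rfl⟩
  obtain ⟨rfl, hc⟩ := hI
  exact ⟨_, t, h, by linarith, hc⟩

/-- Move the contents of `k` to `k'`, in reverse order, applying `f` to the symbols. -/
def drain (k k' : Stk) (f : Bool → TapeSymbol → TapeSymbol) : StackCmd Stk (Mem N) :=
  each k (.push k' fun v => f v.c (v.x.getD .comma))

theorem runs_drain {k k' : Stk} (hkk : k ≠ k') (f : Bool → TapeSymbol → TapeSymbol) (v : Mem N)
    (S : Stk → List TapeSymbol) :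
    ∃ v' t, Runs Ω (drain k k' f) (v, S) (v', Function.update (Function.update S k []) k'
      (((S k).map (f v.c)).reverse ++ S k')) t ∧ t ≤ 3 * ((S k).length + 1) ∧ v'.c = v.c := by
  obtain ⟨v', S', t, h, ht, hI⟩ :=
    runs_each (Ω := Ω) k (.push k' fun v => f v.c (v.x.getD .comma)) 1
    (fun l v' S' => v'.c = v.c ∧ ∃ d, S k = d ++ l ∧ S' = Function.update (Function.update S k l) k'
      ((d.map (f v.c)).reverse ++ S k'))
    (by rintro l v' S' ⟨-, d, -, rfl⟩; simp [Function.update_of_ne hkk])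
    (by
      rintro s l v' S' ⟨hc, d, hd, rfl⟩
      refine ⟨_, _, _, Exec.push _ _ _ _, le_rfl, hc, d ++ [s], by simp [hd], ?_⟩
      funext j
      by_cases h1 : j = k' <;> by_cases h2 : j = k <;>
        simp_all [Function.update_apply])
    (S k) v S ⟨rfl, [], by simp, by simp⟩
  obtain ⟨hc, d, hd, rfl⟩ := hI
  simp only [List.append_nil] at hd
  subst hd
  exact ⟨_, t, h, by linarith, hc⟩

/-- Move the contents of `k` to both `k₁` and `k₂`, in reverse order. -/
def drainTwo (k k₁ k₂ : Stk) : StackCmd Stk (Mem N) :=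
  each k (.seq (.push k₁ fun v => v.x.getD .comma) (.push k₂ fun v => v.x.getD .comma))

theorem runs_drainTwo {k k₁ k₂ : Stk} (h₁ : k ≠ k₁) (h₂ : k ≠ k₂) (h₁₂ : k₁ ≠ k₂) (v : Mem N)
    (S : Stk → List TapeSymbol) :
    ∃ v' t, Runs Ω (drainTwo k k₁ k₂) (v, S) (v', Function.update (Function.update
      (Function.update S k []) k₁ ((S k).reverse ++ S k₁)) k₂ ((S k).reverse ++ S k₂)) t ∧
      t ≤ 4 * ((S k).length + 1) ∧ v'.c = v.c := by
  obtain ⟨v', S', t, h, ht, hI⟩ := runs_each (Ω := Ω) k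
    (.seq (.push k₁ fun v => v.x.getD .comma) (.push k₂ fun v => v.x.getD .comma)) 2
    (fun l v' S' => v'.c = v.c ∧ ∃ d, S k = d ++ l ∧ S' = Function.update (Function.update
      (Function.update S k l) k₁ (d.reverse ++ S k₁)) k₂ (d.reverse ++ S k₂))
    (by
      rintro l v' S' ⟨-, d, -, rfl⟩
      simp [Function.update_of_ne h₁, Function.update_of_ne h₂])
    (by
      rintro s l v' S' ⟨hc, d, hd, rfl⟩
      refine ⟨_, _, _, Exec.seq (Exec.push _ _ _ _) (Exec.push _ _ _ _), le_rfl, hc, d ++ [s],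
        by simp [hd], ?_⟩
      funext j
      by_cases e1 : j = k₁ <;> by_cases e2 : j = k₂ <;> by_cases e3 : j = k <;>
        simp_all [Function.update_apply, eq_comm])
    (S k) v S ⟨rfl, [], by simp, by simp⟩
  obtain ⟨hc, d, hd, rfl⟩ := hI
  simp only [List.append_nil] at hd
  subst hd
  exact ⟨_, t, h, by linarith, hc⟩

end StackCmd

/-! ### Arithmetic on registers -/

namespace StackCmd

variable {N : ℕ} {Ω : OraclePort → List TapeSymbol → List TapeSymbol}

theorem Exec.congr_right {K σ : Type} [DecidableEq K] {Q A : K} {c : StackCmd K σ}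
    {s : σ × (K → List TapeSymbol)} {v : σ} {S S' : K → List TapeSymbol} {t : ℕ}
    (h : Exec Ω Q A c s (v, S) t) (hS : S' = S) : Exec Ω Q A c s (v, S') t := hS ▸ h

/-- Copy the contents of `k` to the operand stack `k'`. -/
def copyTo (k k' : Stk) : StackCmd Stk (Mem N) :=
  .seq (drain k .tmp fun _ s => s) (drainTwo .tmp k k')

/-- Each of the two passes reverses the order, so both copies come out in the original order. -/
theorem runs_copyTo {k k' : Stk} (h : k ≠ .tmp) (h' : k' ≠ .tmp) (hkk : k ≠ k') (v : Mem N)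
    (S : Stk → List TapeSymbol) (hS : S .tmp = []) (hS' : S k' = []) :
    ∃ v' t, Runs Ω (copyTo k k') (v, S) (v', Function.update S k' (S k)) t ∧
      t ≤ 7 * ((S k).length + 1) := by
  obtain ⟨v₁, t₁, r₁, ht₁, -⟩ := runs_drain (Ω := Ω) h (fun _ s => s) v S
  obtain ⟨v₂, t₂, r₂, ht₂, -⟩ := runs_drainTwo (Ω := Ω) h.symm h'.symm hkk v₁
    (Function.update (Function.update S k []) .tmp (((S k).map fun s => s).reverse ++ S .tmp))
  refine ⟨v₂, t₁ + t₂, ?_, ?_⟩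
  · have := Exec.seq r₁ r₂
    refine this.congr_right ?_
    funext j
    by_cases e1 : j = k <;> by_cases e2 : j = k' <;> by_cases e3 : j = .tmp <;>
      simp_all [Function.update_apply, eq_comm]
  · simp [hS] at ht₂
    linarith

/-- The stacks that are not used as work space. -/
def IsData : Stk → Prop
  | .reg _ => True
  | .ctr _ => True
  | _ => False

theorem IsData.ne {k : Stk} (h : IsData k) :
    k ≠ .tmp ∧ k ≠ .opA ∧ k ≠ .opB ∧ k ≠ .answer ∧ k ≠ .question := by
  cases k <;> simp_all [IsData]

/-- The work space is empty. -/
def Clean (S : Stk → List TapeSymbol) : Prop :=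
  S .opA = [] ∧ S .opB = [] ∧ S .tmp = [] ∧ S .answer = []

theorem Clean.update {S : Stk → List TapeSymbol} (h : Clean S) {k : Stk} (hk : IsData k)
    (w : List TapeSymbol) : Clean (Function.update S k w) := by
  obtain ⟨h1, h2, h3, h4, -⟩ := hk.ne
  simp only [Clean, Function.update_of_ne h1.symm, Function.update_of_ne h2.symm,
    Function.update_of_ne h3.symm, Function.update_of_ne h4.symm]
  exact h

/-- One step of a carry automaton on the two symbols in memory. -/
def zipStep (f : Bool → Bool → Bool → Bool × Bool) : StackCmd Stk (Mem N) :=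
  .seq (.push .tmp fun v => .digit
      (f v.c ((v.x.map symBit).getD false) ((v.y.map symBit).getD false)).2)
    (.load fun v => { v with
      c := (f v.c ((v.x.map symBit).getD false) ((v.y.map symBit).getD false)).1 })

/-- Run a carry automaton on the operand stacks. -/
def zip (f : Bool → Bool → Bool → Bool × Bool) : StackCmd Stk (Mem N) :=
  .seq (.load fun v => { v with c := false })
    (.seq (each .opA (.seq (.pop .opB fun v s => { v with y := s }) (zipStep f)))
      (each .opB (.seq (.load fun v => { v with x := none, y := v.x }) (zipStep f))))

/-- The first loop consumes `opA` along with what there is of `opB`, and the second pairs the rest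
of `opB` with zeros. The invariant: the bits written so far, followed by those that the automaton
would still produce, form the whole result. -/
theorem runs_zip (f : Bool → Bool → Bool → Bool × Bool) (v : Mem N)
    (S : Stk → List TapeSymbol) (hS : S .tmp = []) :
    ∃ v' t, Runs Ω (zip f) (v, S) (v', Function.update (Function.update (Function.update S .opA [])
        .opB []) .tmp ((zipBits f false (S .opA) (S .opB)).2.map .digit).reverse) t ∧
      t ≤ 6 * ((S .opA).length + (S .opB).length + 3) ∧
      v'.c = (zipBits f false (S .opA) (S .opB)).1 := by
  obtain ⟨v₁, S₁, t₁, r₁, ht₁, B₁, d₁, hz₁, hS₁, hB₁⟩ := runs_each (Ω := Ω) .opA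
    (.seq (.pop .opB fun v s => { v with y := s }) (zipStep f)) 3
    (fun l v' S' => ∃ B d,
      zipBits f false (S .opA) (S .opB) = ((zipBits f v'.c l B).1, d ++ (zipBits f v'.c l B).2) ∧
      S' = Function.update (Function.update (Function.update S .opA l) .opB B) .tmp
        (d.map .digit).reverse ∧ B.length ≤ (S .opB).length)
    (by rintro l v' S' ⟨B, d, -, rfl, -⟩; simp)
    (by
      rintro s l v' S' ⟨B, d, hz, rfl, hB⟩
      refine ⟨_, _, _, Exec.seq (Exec.pop _ _ _ _) (Exec.seq (Exec.push _ _ _ _)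
        (Exec.load _ _ _)), le_rfl, B.tail, d ++ [(f v'.c (symBit s)
          ((B.head?.map symBit).getD false)).2], ?_, ?_, ?_⟩
      · rw [hz]
        cases B <;> simp [zipBits]
      · funext j
        by_cases e1 : j = .opA <;> by_cases e2 : j = .opB <;> by_cases e3 : j = .tmp <;>
          simp_all
      · exact le_trans (by simp) hB)
    (S .opA) { v with c := false } S ⟨S .opB, [], by simp, by
        funext j
        by_cases e3 : j = .tmp <;> simp_all [Function.update_apply], le_rfl⟩
  have hB : S₁ .opB = B₁ := by simp [hS₁]
  obtain ⟨v₂, S₂, t₂, r₂, ht₂, d₂, hz₂, hS₂⟩ := runs_each (Ω := Ω) .opB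
    (.seq (.load fun v => { v with x := none, y := v.x }) (zipStep f)) 3
    (fun l v' S' => ∃ d,
      zipBits f false (S .opA) (S .opB) = ((zipBits f v'.c [] l).1, d ++ (zipBits f v'.c [] l).2) ∧
      S' = Function.update (Function.update (Function.update S .opA []) .opB l) .tmp
        (d.map .digit).reverse)
    (by rintro l v' S' ⟨d, -, rfl⟩; simp)
    (by
      rintro s l v' S' ⟨d, hz, rfl⟩
      refine ⟨_, _, _, Exec.seq (Exec.load _ _ _) (Exec.seq (Exec.push _ _ _ _)
        (Exec.load _ _ _)), le_rfl, d ++ [(f v'.c false (symBit s)).2], ?_, ?_⟩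
      · rw [hz]
        simp [zipBits]
      · funext j
        by_cases e1 : j = .opA <;> by_cases e2 : j = .opB <;> by_cases e3 : j = .tmp <;>
          simp_all)
    B₁ { v₁ with x := none } S₁ ⟨d₁, hz₁, hS₁⟩
  simp only [zipBits, List.append_nil] at hz₂
  refine ⟨_, _, Exec.seq (Exec.load _ _ _) (Exec.seq r₁ (r₂.congr_right ?_)), ?_, ?_⟩
  · rw [hz₂, ← hS₂]
  · linarith
  · rw [hz₂]

theorem runs_zip_of_clean (f : Bool → Bool → Bool → Bool × Bool) (v : Mem N)
    (S : Stk → List TapeSymbol) (hS : Clean S) (X Y : List TapeSymbol) :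
    ∃ v' t, Runs Ω (zip f) (v, Function.update (Function.update S .opA X) .opB Y)
        (v', Function.update S .tmp ((zipBits f false X Y).2.map .digit).reverse) t ∧
      t ≤ 6 * (X.length + Y.length + 3) ∧ v'.c = (zipBits f false X Y).1 := by
  obtain ⟨h1, h2, h3, -⟩ := hS
  obtain ⟨v', t, r, ht, hc⟩ := runs_zip (Ω := Ω) f v
    (Function.update (Function.update S .opA X) .opB Y) (by simpa using h3)
  simp only [Function.update_self, ne_eq, reduceCtorEq, not_false_eq_true,
    Function.update_of_ne] at r ht hc
  refine ⟨v', t, r.congr_right ?_, ht, hc⟩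
  funext j
  by_cases e1 : j = .opA <;> by_cases e2 : j = .opB <;> by_cases e3 : j = .tmp <;>
    simp_all

/-- Store the result of an operation in `z`; a set carry bit means that the result is zero. -/
def store (z : Stk) : StackCmd Stk (Mem N) :=
  .seq (clear z) (drain .tmp z fun c s => if c then .digit false else s)

/-- A set carry comes from a subtraction with negative result. Zeroing the digits then yields
truncated subtraction. -/
theorem runs_store {z : Stk} (hz : IsData z) (v : Mem N) (S : Stk → List TapeSymbol)
    (hS : Clean S) (w : List TapeSymbol) :
    ∃ v' t, Runs Ω (store z) (v, Function.update S .tmp w) (v', Function.update S z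
      (if v.c then List.replicate w.length (.digit false) else w.reverse)) t ∧
      t ≤ 3 * ((S z).length + w.length + 2) ∧ v'.c = v.c := by
  have hz1 := hz.ne.1
  have hz2 := hz1.symm
  have h3 : S .tmp = [] := hS.2.2.1
  obtain ⟨v₁, t₁, r₁, ht₁, hc₁⟩ := runs_clear (Ω := Ω) z v (Function.update S .tmp w)
  obtain ⟨v₂, t₂, r₂, ht₂, hc₂⟩ := runs_drain (Ω := Ω) hz1.symm
    (fun c s => if c then .digit false else s) v₁
    (Function.update (Function.update S .tmp w) z [])
  refine ⟨v₂, t₁ + t₂, ?_, ?_, hc₂.trans hc₁⟩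
  · refine (Exec.seq r₁ r₂).congr_right ?_
    funext j
    rw [hc₁]
    rcases hv : v.c <;> by_cases e1 : j = z <;> by_cases e3 : j = .tmp <;>
      simp [e1, e3, hz2, h3]
  · simp [hz1, hz2] at ht₁ ht₂
    linarith

/-- `z := x`. -/
def copy (z x : Stk) : StackCmd Stk (Mem N) :=
  .seq (copyTo x .opA) (.seq (drain .opA .tmp fun _ s => s)
    (.seq (.load fun v => { v with c := false }) (store z)))

theorem runs_copy {z x : Stk} (hz : IsData z) (hx : IsData x) (v : Mem N)
    (S : Stk → List TapeSymbol) (hS : Clean S) :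
    ∃ v' t, Runs Ω (copy z x) (v, S) (v', Function.update S z (S x)) t ∧
      t ≤ 20 * ((S x).length + (S z).length + 1) := by
  obtain ⟨hx1, hx2, -, -, -⟩ := hx.ne
  obtain ⟨hz1, hz2, -, -, -⟩ := hz.ne
  obtain ⟨h1, h2, h3, h4⟩ := hS
  obtain ⟨v₁, t₁, r₁, ht₁⟩ := runs_copyTo (Ω := Ω) hx1 (k' := .opA) (by simp) hx2 v S h3 h1
  obtain ⟨v₂, t₂, r₂, ht₂, -⟩ := runs_drain (Ω := Ω) (k := .opA) (k' := .tmp) (by simp)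
    (fun _ s => s) v₁ (Function.update S .opA (S x))
  obtain ⟨v₃, t₃, r₃, ht₃, -⟩ := runs_store (Ω := Ω) hz { v₂ with c := false } S
    ⟨h1, h2, h3, h4⟩ (S x).reverse
  refine ⟨v₃, t₁ + (t₂ + (1 + t₃)), ?_, ?_⟩
  · rw [List.reverse_reverse] at r₃
    refine Exec.seq r₁ (Exec.seq (r₂.congr_right ?_) (Exec.seq (Exec.load _ _ _) r₃))
    funext j
    by_cases e2 : j = .opA <;> by_cases e3 : j = .tmp <;>
      simp_all
  · simp at ht₂ ht₃
    linarith

/-- `z := x + y`. -/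
def add (z x y : Stk) : StackCmd Stk (Mem N) :=
  .seq (copyTo x .opA) (.seq (copyTo y .opB) (.seq (zip adder)
    (.seq (.push .tmp fun v => .digit v.c)
      (.seq (.load fun v => { v with c := false }) (store z)))))

theorem runs_add {z x y : Stk} (hz : IsData z) (hx : IsData x) (hy : IsData y) (v : Mem N)
    (S : Stk → List TapeSymbol) (hS : Clean S) :
    ∃ v' w t, Runs Ω (add z x y) (v, S) (v', Function.update S z w) t ∧
      strVal w = strVal (S x) + strVal (S y) ∧ w.length ≤ max (S x).length (S y).length + 1 ∧
      t ≤ 60 * ((S x).length + (S y).length + (S z).length + 1) := by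
  obtain ⟨hx1, hx2, hx3, -, -⟩ := hx.ne
  obtain ⟨hy1, hy2, hy3, -, -⟩ := hy.ne
  obtain ⟨hz1, hz2, hz3, -, -⟩ := hz.ne
  obtain ⟨h1, h2, h3, h4⟩ := hS
  obtain ⟨v₁, t₁, r₁, ht₁⟩ := runs_copyTo (Ω := Ω) hx1 (k' := .opA) (by simp) hx2 v S h3 h1
  obtain ⟨v₂, t₂, r₂, ht₂⟩ := runs_copyTo (Ω := Ω) hy1 (k' := .opB) (by simp) hy3 v₁
    (Function.update S .opA (S x)) (by simpa using h3) (by simpa using h2)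
  rw [Function.update_of_ne hy2] at r₂ ht₂
  obtain ⟨v₃, t₃, r₃, ht₃, hc₃⟩ := runs_zip_of_clean (Ω := Ω) adder v₂ S ⟨h1, h2, h3, h4⟩
    (S x) (S y)
  have hlen := length_zipBits adder false (S x) (S y)
  have hval := strVal_adder false (S x) (S y)
  set o := zipBits adder false (S x) (S y) with ho
  obtain ⟨v₄, t₄, r₄, ht₄, -⟩ := runs_store (Ω := Ω) hz { v₃ with c := false } S
    ⟨h1, h2, h3, h4⟩ (.digit o.1 :: (o.2.map .digit).reverse)
  refine ⟨v₄, (o.2.map .digit) ++ [.digit o.1], t₁ + (t₂ + (t₃ + (1 + (1 + t₄)))), ?_, ?_, ?_, ?_⟩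
  · refine Exec.seq r₁ (Exec.seq r₂ (Exec.seq r₃ (Exec.seq ((Exec.push _ _ _ _).congr_right ?_)
      (Exec.seq (Exec.load _ _ _) (r₄.congr_right ?_)))))
    · simp [hc₃]
    · simp
  · rw [Bool.toNat_false, add_zero] at hval
    rw [← hval]
    clear_value o
    obtain ⟨c, l⟩ := o
    simp only
    clear hval hlen ho hc₃ r₃ r₄ ht₄
    induction l with
    | nil => cases c <;> simp [strVal]
    | cons b l ih =>
      simp only [List.map_cons, List.cons_append, strVal, ih, List.length_cons, pow_succ]
      ring
  · simp [hlen]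
  · simp [hlen] at ht₄
    have h5 : max (S x).length (S y).length ≤ (S x).length + (S y).length := by omega
    linarith

/-- `z := x - y`, where `y` has been copied to the second operand stack; afterwards the carry bit
tells whether `x < y`. -/
def subOp (z x : Stk) : StackCmd Stk (Mem N) :=
  .seq (copyTo x .opA) (.seq (zip subtractor) (store z))

theorem runs_subOp {z x : Stk} (hz : IsData z) (hx : IsData x) (v : Mem N)
    (S : Stk → List TapeSymbol) (Y : List TapeSymbol) (hS : Clean S) :
    ∃ v' w t, Runs Ω (subOp z x) (v, Function.update S .opB Y) (v', Function.update S z w) t ∧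
      strVal w = strVal (S x) - strVal Y ∧ w.length ≤ max (S x).length Y.length ∧
      t ≤ 40 * ((S x).length + Y.length + (S z).length + 1) ∧
      v'.c = decide (strVal (S x) < strVal Y) := by
  obtain ⟨hx1, hx2, hx3, -, -⟩ := hx.ne
  obtain ⟨hz1, hz2, hz3, -, -⟩ := hz.ne
  obtain ⟨h1, h2, h3, h4⟩ := hS
  obtain ⟨v₁, t₁, r₁, ht₁⟩ := runs_copyTo (Ω := Ω) hx1 (k' := .opA) (by simp) hx2 v
    (Function.update S .opB Y) (by simpa using h3) (by simpa using h1)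
  rw [Function.update_of_ne hx3] at r₁ ht₁
  obtain ⟨v₃, t₃, r₃, ht₃, hc₃⟩ := runs_zip_of_clean (Ω := Ω) subtractor v₁ S ⟨h1, h2, h3, h4⟩
    (S x) Y
  have hlen := length_zipBits subtractor false (S x) Y
  have hval := strVal_subtractor false (S x) Y
  have hlt : strVal ((zipBits subtractor false (S x) Y).2.map .digit) <
    2 ^ (zipBits subtractor false (S x) Y).2.length := by
      simpa using strVal_lt ((zipBits subtractor false (S x) Y).2.map .digit)
  set o := zipBits subtractor false (S x) Y with ho
  obtain ⟨v₄, t₄, r₄, ht₄, hc₄⟩ := runs_store (Ω := Ω) hz v₃ S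
    ⟨h1, h2, h3, h4⟩ (o.2.map .digit).reverse
  -- The digits of the result stay below `2 ^ length`, so a last borrow occurs exactly when the
  -- minuend is smaller.
  have hc : o.1 = decide (strVal (S x) < strVal Y) := by
    rcases h : o.1 <;> simp [h] at hval <;> simp <;> omega
  refine ⟨v₄, if o.1 then List.replicate o.2.length (.digit false) else o.2.map .digit,
    t₁ + (t₃ + t₄), ?_, ?_, ?_, ?_, ?_⟩
  · refine Exec.seq (r₁.congr_right ?_) (Exec.seq r₃ (r₄.congr_right ?_))
    · rw [Function.update_comm (by simp)]
    · simp [hc₃]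
  · rcases h : o.1 <;> simp [h] at hval hc ⊢
    · omega
    · rw [strVal_replicate_false]
      omega
  · rcases h : o.1 <;> simp [hlen]
  · simp [hlen] at ht₄
    have h5 : max (S x).length Y.length ≤ (S x).length + Y.length := by omega
    linarith
  · rw [hc₄, hc₃, hc]

end StackCmd

/-- The condition rules out a leading zero, which `natCode` never contains. -/
theorem natCode_bit (b : Bool) (m : ℕ) (h : b = true ∨ m ≠ 0) :
    natCode (b.toNat + 2 * m) = .digit b :: natCode m := by
  have : b.toNat + 2 * m = Nat.bit b m := by rw [Nat.bit_val]; ring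
  rw [this, natCode, Nat.bits_append_bit m b (by rcases h with h | h <;> simp [h])]
  rfl

/-! ### Decrement, questions and answers -/

namespace StackCmd

variable {N : ℕ} {Ω : OraclePort → List TapeSymbol → List TapeSymbol}

/-- `z := x - y` (truncated). -/
def sub (z x y : Stk) : StackCmd Stk (Mem N) := .seq (copyTo y .opB) (subOp z x)

theorem runs_sub {z x y : Stk} (hz : IsData z) (hx : IsData x) (hy : IsData y) (v : Mem N)
    (S : Stk → List TapeSymbol) (hS : Clean S) :
    ∃ v' w t, Runs Ω (sub z x y) (v, S) (v', Function.update S z w) t ∧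
      strVal w = strVal (S x) - strVal (S y) ∧ w.length ≤ max (S x).length (S y).length ∧
      t ≤ 60 * ((S x).length + (S y).length + (S z).length + 1) := by
  obtain ⟨hy1, hy2, hy3, -, -⟩ := hy.ne
  obtain ⟨v₁, t₁, r₁, ht₁⟩ := runs_copyTo (Ω := Ω) hy1 (k' := .opB) (by simp) hy3 v S
    hS.2.2.1 hS.2.1
  obtain ⟨v₂, w, t₂, r₂, hw, hl, ht₂, -⟩ := runs_subOp (Ω := Ω) hz hx v₁ S (S y) hS
  exact ⟨v₂, w, _, Exec.seq r₁ r₂, hw, hl, by linarith⟩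

/-- `k := k - 1`; afterwards the carry bit tells whether `k` was zero. -/
def dec (k : Stk) : StackCmd Stk (Mem N) :=
  .seq (.push .opB fun _ => .digit true) (subOp k k)

theorem runs_dec {k : Stk} (hk : IsData k) (v : Mem N) (S : Stk → List TapeSymbol)
    (hS : Clean S) :
    ∃ v' w t, Runs Ω (dec k) (v, S) (v', Function.update S k w) t ∧
      strVal w = strVal (S k) - 1 ∧ w.length ≤ max (S k).length 1 ∧
      t ≤ 80 * ((S k).length + 2) ∧ v'.c = decide (strVal (S k) = 0) := by
  obtain ⟨v₂, w, t₂, r₂, hw, hl, ht₂, hc⟩ := runs_subOp (Ω := Ω) hk hk v S [.digit true] hS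
  refine ⟨v₂, w, _, Exec.seq ((Exec.push _ _ _ _).congr_right ?_) r₂, ?_, hl, ?_, ?_⟩
  · rw [hS.2.1]
  · rw [hw]; simp [strVal]
  · simp only [List.length_singleton] at ht₂; linarith
  · rw [hc]; simp [strVal]

/-- `x := b`. -/
def const (x : Stk) (b : Bool) : StackCmd Stk (Mem N) :=
  .seq (clear x) (.push x fun _ => .digit b)

theorem runs_const (x : Stk) (b : Bool) (v : Mem N) (S : Stk → List TapeSymbol) :
    ∃ v' t, Runs Ω (const x b) (v, S) (v', Function.update S x [.digit b]) t ∧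
      t ≤ 4 * ((S x).length + 1) := by
  obtain ⟨v₁, t₁, r₁, ht₁, -⟩ := runs_clear (Ω := Ω) x v S
  refine ⟨v₁, _, Exec.seq r₁ ((Exec.push _ _ _ _).congr_right ?_), by linarith⟩
  simp

/-- Write the digits of a number on the question stack, without leading zeros. -/
def emitNum (x : Stk) : StackCmd Stk (Mem N) :=
  .seq (copyTo x .opA) (.seq (drain .opA .tmp fun _ s => s)
    (.seq (.load fun v => { v with c := false })
      (each .tmp (.ite (fun v => v.c || (v.x.map symBit).getD false)
        (.seq (.push .question fun v => .digit ((v.x.map symBit).getD false))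
          (.load fun v => { v with c := true }))
        (.load id)))))

/-- Registers may have leading zeros, but the oracles are specified on exact strings. The digits are
therefore read from the top, and the carry bit remembers whether a nonzero digit has been passed. -/
theorem runs_emitNum {x : Stk} (hx : IsData x) (v : Mem N) (S : Stk → List TapeSymbol)
    (hS : Clean S) :
    ∃ v' t, Runs Ω (emitNum x) (v, S)
      (v', Function.update S .question (natCode (strVal (S x)) ++ S .question)) t ∧
      t ≤ 30 * ((S x).length + 1) := by
  obtain ⟨hx1, hx2, -, -, hx5⟩ := hx.ne
  obtain ⟨h1, h2, h3, h4⟩ := hS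
  obtain ⟨v₁, t₁, r₁, ht₁⟩ := runs_copyTo (Ω := Ω) hx1 (k' := .opA) (by simp) hx2 v S h3 h1
  obtain ⟨v₂, t₂, r₂, ht₂, -⟩ := runs_drain (Ω := Ω) (k := .opA) (k' := .tmp) (by simp)
    (fun _ s => s) v₁ (Function.update S .opA (S x))
  obtain ⟨v₃, S₃, t₃, r₃, ht₃, d, hd, hS₃, -⟩ := runs_each (Ω := Ω) .tmp
    (.ite (fun v => v.c || (v.x.map symBit).getD false)
        (.seq (.push .question fun v => .digit ((v.x.map symBit).getD false))
          (.load fun v => { v with c := true }))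
        (.load id)) 3
    (fun l v' S' => ∃ d, (S x).reverse = d ++ l ∧
      S' = Function.update (Function.update S .tmp l) .question
        (natCode (strVal d.reverse) ++ S .question) ∧ v'.c = decide (strVal d.reverse ≠ 0))
    (by rintro l v' S' ⟨d, -, rfl, -⟩; simp)
    (by
      rintro s l v' S' ⟨d, hd, rfl, hc⟩
      by_cases hb : (symBit s = true ∨ strVal d.reverse ≠ 0)
      · refine ⟨_, _, _, Exec.ite_true ?_ (Exec.seq (Exec.push _ _ _ _) (Exec.load _ _ _)),
          le_rfl, d ++ [s], by simp [hd], ?_, ?_⟩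
        · simp only [hc]
          rcases hb with hb | hb <;> simp [hb]
        · have : strVal (d ++ [s]).reverse = (symBit s).toNat + 2 * strVal d.reverse := by
            simp [strVal]
          rw [this, natCode_bit _ _ hb]
          funext j
          by_cases e1 : j = .tmp <;> by_cases e2 : j = .question <;>
            simp_all
        · simp only [List.reverse_append, List.reverse_cons, List.reverse_nil, List.nil_append,
            List.singleton_append, strVal]
          rcases hb with hb | hb <;> simp [hb]
      · push Not at hb
        have hs : symBit s = false := by simpa using hb.1
        refine ⟨_, _, _, Exec.ite_false ?_ (Exec.load _ _ _), by norm_num, d ++ [s],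
          by simp [hd], ?_, ?_⟩
        · simp [hc, hb.2, hs]
        · funext j
          by_cases e1 : j = .tmp <;> by_cases e2 : j = .question <;>
            simp_all [strVal]
        · simp [strVal, hc, hs])
    (S x).reverse { v₂ with c := false } (Function.update S .tmp (S x).reverse)
    ⟨[], by simp, by simp [strVal, natCode], by simp [strVal]⟩
  simp only [List.append_nil] at hd
  rw [← hd, List.reverse_reverse] at hS₃
  refine ⟨_, _, Exec.seq r₁ (Exec.seq (r₂.congr_right ?_) (Exec.seq (Exec.load _ _ _)
    (r₃.congr_right ?_))), ?_⟩
  · funext j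
    by_cases e2 : j = .opA <;> by_cases e3 : j = .tmp <;>
      simp_all
  · rw [hS₃, ← h3, Function.update_eq_self]
  · simp at ht₂ ht₃
    linarith

/-- Move an answer to the register `x`. -/
def readAnswer (x : Stk) : StackCmd Stk (Mem N) :=
  .seq (drain .answer .tmp fun _ s => s) (.seq (.load fun v => { v with c := false }) (store x))

theorem runs_readAnswer {x : Stk} (hx : IsData x) (v : Mem N) (S : Stk → List TapeSymbol)
    (hS : Clean S) (w : List TapeSymbol) :
    ∃ v' t, Runs Ω (readAnswer x) (v, Function.update S .answer w) (v', Function.update S x w) t ∧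
      t ≤ 10 * ((S x).length + w.length + 1) := by
  obtain ⟨v₁, t₁, r₁, ht₁, -⟩ := runs_drain (Ω := Ω) (k := .answer) (k' := .tmp) (by simp)
    (fun _ s => s) v (Function.update S .answer w)
  obtain ⟨v₂, t₂, r₂, ht₂, -⟩ := runs_store (Ω := Ω) hx { v₁ with c := false } S hS w.reverse
  obtain ⟨h1, h2, h3, h4⟩ := hS
  refine ⟨v₂, _, Exec.seq (r₁.congr_right ?_) (Exec.seq (Exec.load _ _ _)
    (r₂.congr_right ?_)), ?_⟩
  · funext j
    by_cases e2 : j = .answer <;> by_cases e3 : j = .tmp <;>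
      simp_all
  · simp
  · simp at ht₁ ht₂
    linarith

/-- A command that answers questions: the answers have the values `ans`, and lengths at most
`len`. -/
def Answers (Ω : OraclePort → List TapeSymbol → List TapeSymbol)
    (askC : OraclePort → StackCmd Stk (Mem N)) (ans len : OraclePort → List TapeSymbol → ℕ) :
    Prop :=
  ∀ (i : OraclePort) (v : Mem N) (S : Stk → List TapeSymbol), Clean S → ∃ v' w t,
    Runs Ω (askC i) (v, S) (v', Function.update (Function.update S .question []) .answer w) t ∧
    strVal w = ans i (S .question) ∧ w.length ≤ len i (S .question) ∧
    t ≤ 10 * (len i (S .question) + 1)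

theorem answers_ask (Ω : OraclePort → List TapeSymbol → List TapeSymbol) :
    Answers (N := N) Ω (fun i => .ask i) (fun i w => strVal (Ω i w))
      (fun i w => (Ω i w).length) := by
  intro i v S _
  exact ⟨v, _, 1, Exec.ask _ _ _, rfl, le_rfl, by linarith⟩

/-! ### Division by a fixed denominator -/

/-- Long division: the digits of `a / (N + 1)` up to the precision that is written in unary on the
question stack. -/
def divide (N a : ℕ) : StackCmd Stk (Mem N) :=
  .seq (.push .answer fun _ => .digit (decide (N + 1 ≤ a)))
    (.seq (.load fun v => { v with r := Fin.ofNat (N + 1) a })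
      (each .question (.seq (.push .answer fun v => .digit (decide (N + 1 ≤ 2 * (v.r : ℕ))))
        (.load fun v => { v with r := Fin.ofNat (N + 1) (2 * v.r) }))))

/-- One step of binary long division: a remainder below `b`, once doubled, is below `2 * b`, so the
next digit is a single bit. -/
theorem div_mod_of_lt_two_mul {b x : ℕ} (h : x < 2 * b) :
    (decide (b ≤ x)).toNat * b + x % b = x := by
  by_cases hx : b ≤ x
  · have : x % b = x - b := by
      rw [Nat.mod_eq_sub_mod hx, Nat.mod_eq_of_lt (by omega)]
    simp [hx, this]
  · simp [hx, Nat.mod_eq_of_lt (not_le.mp hx)]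

/-- The denominator is fixed with the machine, so the remainder fits into the finite memory. The
invariant `value * (N + 1) + remainder = a * 2 ^ i` is that of long division, and a digit pushed on
top becomes the least significant one. -/
theorem runs_divide {a : ℕ} (ha : a ≤ N + 1) (v : Mem N) (S : Stk → List TapeSymbol)
    (hS : Clean S) :
    ∃ v' w t, Runs Ω (divide N a) (v, S)
      (v', Function.update (Function.update S .question []) .answer w) t ∧
      strVal w = a * 2 ^ (S .question).length / (N + 1) ∧
      w.length ≤ (S .question).length + 1 ∧ t ≤ 10 * ((S .question).length + 1) := by
  obtain ⟨v₃, S₃, t₃, r₃, ht₃, w, i, hi, hw, hl, hS₃⟩ := runs_each (Ω := Ω) .question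
    (.seq (.push .answer fun v => .digit (decide (N + 1 ≤ 2 * (v.r : ℕ))))
        (.load fun v => { v with r := Fin.ofNat (N + 1) (2 * v.r) })) 2
    (fun l v' S' => ∃ w i, i + l.length = (S .question).length ∧
      strVal w * (N + 1) + v'.r = a * 2 ^ i ∧ w.length = i + 1 ∧
      S' = Function.update (Function.update S .question l) .answer w)
    (by rintro l v' S' ⟨w, i, -, -, -, rfl⟩; simp)
    (by
      rintro s l v' S' ⟨w, i, hi, hw, hl, rfl⟩
      refine ⟨_, _, _, Exec.seq (Exec.push _ _ _ _) (Exec.load _ _ _), le_rfl,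
        .digit (decide (N + 1 ≤ 2 * (v'.r : ℕ))) :: w, i + 1, ?_, ?_, by simp [hl], ?_⟩
      · simp only [List.length_cons] at hi; omega
      · have := div_mod_of_lt_two_mul (b := N + 1) (x := 2 * v'.r)
          (by have := v'.r.isLt; omega)
        simp only [strVal, symBit_digit, Fin.val_ofNat, pow_succ]
        calc _ = (decide (N + 1 ≤ 2 * (v'.r : ℕ))).toNat * (N + 1) + 2 * v'.r % (N + 1) +
              2 * (strVal w * (N + 1)) := by ring
          _ = 2 * (strVal w * (N + 1) + v'.r) := by rw [this]; ring
          _ = _ := by rw [hw]; ring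
      · funext j
        by_cases e2 : j = .answer <;> by_cases e3 : j = .question <;>
          simp_all)
    (S .question) { v with r := Fin.ofNat (N + 1) a }
    (Function.update S .answer [.digit (decide (N + 1 ≤ a))])
    ⟨[.digit (decide (N + 1 ≤ a))], 0, by simp, by
      have := div_mod_of_lt_two_mul (b := N + 1) (x := a) (by omega)
      simpa [strVal] using this, by simp, by simp⟩
  simp only [List.length_nil, add_zero] at hi
  refine ⟨_, w, _, Exec.seq ((Exec.push _ _ _ _).congr_right ?_) (Exec.seq (Exec.load _ _ _)
    (r₃.congr_right hS₃.symm)), ?_, ?_, ?_⟩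
  · rw [hS.2.2.2]
  · rw [← hi, ← hw]
    have := v₃.r.isLt
    rw [Nat.mul_comm, Nat.mul_add_div (by omega), Nat.div_eq_of_lt this, add_zero]
  · omega
  · linarith

/-- The commands that answer all questions, where the exponent is the number `a / (N + 1)`. -/
def askOrDivide (N a : ℕ) : OraclePort → StackCmd Stk (Mem N)
  | .exponent => divide N a
  | i => .ask i

theorem answers_askOrDivide {a : ℕ} (ha : a ≤ N + 1)
    (Ω : OraclePort → List TapeSymbol → List TapeSymbol) :
    Answers (N := N) Ω (askOrDivide N a)
      (fun i w => if i = .exponent then a * 2 ^ w.length / (N + 1) else strVal (Ω i w))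
      (fun i w => if i = .exponent then w.length + 1 else (Ω i w).length) := by
  intro i v S hS
  cases i with
  | exponent =>
    obtain ⟨v', w, t, h1, h2, h3, h4⟩ := runs_divide (Ω := Ω) ha v S hS
    exact ⟨v', w, t, h1, by simpa using h2, by simpa using h3, by simp; omega⟩
  | body => simpa [askOrDivide] using answers_ask Ω .body v S hS
  | degree => simpa [askOrDivide] using answers_ask Ω .degree v S hS
  | accuracy => simpa [askOrDivide] using answers_ask Ω .accuracy v S hS

end StackCmd

/-! ### Loop programs on registers -/

/-- Programs with bounded loops on registers that hold natural numbers. -/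
inductive LoopProg : Type
  | const (x : Reg) (b : Bool)
  | copy (z x : Reg)
  | add (z x y : Reg)
  | sub (z x y : Reg)
  | half (x : Reg)
  | emit (s : TapeSymbol)
  | emitNum (x : Reg)
  | ask (i : OraclePort) (x : Reg)
  | seq (p q : LoopProg)
  | loop (x : Reg) (p : LoopProg)

/-- States of loop programs: the registers and the question that is being written. -/
structure LoopState : Type where
  reg : Reg → ℕ
  q : List TapeSymbol

namespace LoopProg

/-- Assignment to a register. -/
def _root_.LoopState.set (s : LoopState) (x : Reg) (v : ℕ) : LoopState :=
  ⟨Function.update s.reg x v, s.q⟩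

variable (ans len : OraclePort → List TapeSymbol → ℕ)

/-- The meaning of a loop program. -/
def run : LoopProg → LoopState → LoopState
  | const x b, s => s.set x b.toNat
  | copy z x, s => s.set z (s.reg x)
  | add z x y, s => s.set z (s.reg x + s.reg y)
  | sub z x y, s => s.set z (s.reg x - s.reg y)
  | half x, s => s.set x (s.reg x / 2)
  | emit c, s => ⟨s.reg, c :: s.q⟩
  | emitNum x, s => ⟨s.reg, natCode (s.reg x) ++ s.q⟩
  | ask i x, s => ⟨Function.update s.reg x (ans i s.q), []⟩
  | seq p q, s => run q (run p s)
  | loop x p, s => (run p)^[s.reg x] s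

/-- The cost of a loop program: the number of operations, where the length of answers is
taken into account. -/
def cost : LoopProg → LoopState → ℕ
  | ask i _, s => 1 + len i s.q
  | seq p q, s => cost p s + cost q (run ans p s)
  | loop x p, s => 1 + ∑ i ∈ Finset.range (s.reg x), (1 + cost p ((run ans p)^[i] s))
  | _, _ => 1

/-- The nesting depth of the loops. -/
def depth : LoopProg → ℕ
  | seq p q => max (depth p) (depth q)
  | loop _ p => depth p + 1
  | _ => 0

/-! ### Compilation of loop programs -/

variable {N : ℕ}

/-- Translation of loop programs to stack programs, with loop counters from `d` on. -/
def compile (askC : OraclePort → StackCmd Stk (Mem N)) : ℕ → LoopProg → StackCmd Stk (Mem N)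
  | _, const x b => .const (.reg x) b
  | _, copy z x => .copy (.reg z) (.reg x)
  | _, add z x y => .add (.reg z) (.reg x) (.reg y)
  | _, sub z x y => .sub (.reg z) (.reg x) (.reg y)
  | _, half x => .pop (.reg x) fun v _ => v
  | _, emit c => .push .question fun _ => c
  | _, emitNum x => .emitNum (.reg x)
  | _, ask i x => .seq (askC i) (.readAnswer (.reg x))
  | d, seq p q => .seq (compile askC d p) (compile askC d q)
  | d, loop x p => .seq (.copy (.ctr (Fin.ofNat 8 d)) (.reg x)) (.seq (.dec (.ctr (Fin.ofNat 8 d)))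
      (.whileDo (fun v => !v.c) (.seq (compile askC (d + 1) p) (.dec (.ctr (Fin.ofNat 8 d))))))

open StackCmd

/-- The stacks represent a state. -/
def Rep (s : LoopState) (S : Stk → List TapeSymbol) : Prop :=
  Clean S ∧ S .question = s.q ∧ ∀ r, strVal (S (.reg r)) = s.reg r

/-- The data stacks have length at most `L`. -/
def Short (S : Stk → List TapeSymbol) (L : ℕ) : Prop := ∀ k, IsData k → (S k).length ≤ L

theorem Short.mono {S : Stk → List TapeSymbol} {L L' : ℕ} (h : Short S L) (hL : L ≤ L') :
    Short S L' := fun k hk => (h k hk).trans hL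

theorem Short.update {S : Stk → List TapeSymbol} {L : ℕ} (h : Short S L) {k : Stk}
    {w : List TapeSymbol} (hw : w.length ≤ L) : Short (Function.update S k w) L := by
  intro j hj
  by_cases e : j = k
  · subst e; simpa using hw
  · rw [Function.update_of_ne e]; exact h j hj

theorem Rep.set {s : LoopState} {S : Stk → List TapeSymbol} (h : Rep s S) (x : Reg) {v : ℕ}
    {w : List TapeSymbol} (hw : strVal w = v) :
    Rep (s.set x v) (Function.update S (.reg x) w) := by
  refine ⟨h.1.update (k := .reg x) trivial w, by simpa [LoopState.set] using h.2.1, fun r => ?_⟩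
  by_cases e : r = x
  · subst e; simpa [LoopState.set] using hw
  · have : (Stk.reg r) ≠ .reg x := by simpa using e
    simpa [LoopState.set, Function.update_of_ne this, Function.update_of_ne e] using h.2.2 r

theorem Rep.update_ctr {s : LoopState} {S : Stk → List TapeSymbol} (h : Rep s S) (i : Fin 8)
    (w : List TapeSymbol) : Rep s (Function.update S (.ctr i) w) := by
  refine ⟨h.1.update (k := .ctr i) trivial w, by simpa using h.2.1, fun r => by simpa using h.2.2 r⟩

variable {ans len} {Ω : OraclePort → List TapeSymbol → List TapeSymbol}
  {askC : OraclePort → StackCmd Stk (Mem N)}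

/-- What it means that a stack program implements a state transformation with given cost. -/
def Implements (Ω : OraclePort → List TapeSymbol → List TapeSymbol) (c : StackCmd Stk (Mem N))
    (d : ℕ) (s s' : LoopState) (C : ℕ) : Prop :=
  ∀ (v : Mem N) (S : Stk → List TapeSymbol) (L : ℕ), Rep s S → Short S L → 1 ≤ L →
    ∃ v' S' t, Runs Ω c (v, S) (v', S') t ∧ Rep s' S' ∧ Short S' (L + C) ∧
      (∀ i : Fin 8, i.val < d → S' (.ctr i) = S (.ctr i)) ∧ t ≤ 400 * C * (L + C + 1)

/-- The second program starts on stacks of length up to `L + C₁`; the form of the time bound is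
superadditive enough in the cost to absorb this. -/
theorem Implements.seq {c₁ c₂ : StackCmd Stk (Mem N)} {d : ℕ} {s s₁ s₂ : LoopState} {C₁ C₂ : ℕ}
    (h₁ : Implements Ω c₁ d s s₁ C₁) (h₂ : Implements Ω c₂ d s₁ s₂ C₂) :
    Implements Ω (.seq c₁ c₂) d s s₂ (C₁ + C₂) := by
  intro v S L hR hS hL
  obtain ⟨v₁, S₁, t₁, r₁, hR₁, hS₁, hf₁, ht₁⟩ := h₁ v S L hR hS hL
  obtain ⟨v₂, S₂, t₂, r₂, hR₂, hS₂, hf₂, ht₂⟩ := h₂ v₁ S₁ (L + C₁) hR₁ hS₁ (by omega)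
  refine ⟨v₂, S₂, _, Exec.seq r₁ r₂, hR₂, hS₂.mono (by omega),
    fun i hi => (hf₂ i hi).trans (hf₁ i hi), ?_⟩
  have e1 : 400 * C₁ * (L + C₁ + 1) ≤ 400 * C₁ * (L + (C₁ + C₂) + 1) := by gcongr; omega
  have e2 : L + C₁ + C₂ + 1 = L + (C₁ + C₂) + 1 := by ring
  rw [e2] at ht₂
  calc t₁ + t₂ ≤ 400 * C₁ * (L + (C₁ + C₂) + 1) + 400 * C₂ * (L + (C₁ + C₂) + 1) := by omega
    _ = _ := by ring

/-- The main correctness statement for the translation. -/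
theorem implements_compile (hA : Answers Ω askC ans len) (p : LoopProg) :
    ∀ (d : ℕ) (s : LoopState), d + depth p ≤ 8 →
      Implements Ω (compile askC d p) d s (run ans p s) (cost ans len p s) := by
  induction p with
  | const x b =>
    intro d s _ v S L hR hS hL
    obtain ⟨v', t, r, ht⟩ := runs_const (Ω := Ω) (.reg x) b v S
    refine ⟨v', _, t, r, hR.set x (by cases b <;> simp [strVal]), (hS.update ?_).mono (by simp),
      by simp, ?_⟩
    · simpa using hL
    · have := hS (.reg x) trivial
      simp only [cost]; linarith
  | copy z x =>
    intro d s _ v S L hR hS hL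
    obtain ⟨v', t, r, ht⟩ := runs_copy (Ω := Ω) (z := .reg z) (x := .reg x) trivial trivial v S hR.1
    refine ⟨v', _, t, r, hR.set z (hR.2.2 x), (hS.update (hS (.reg x) trivial)).mono (by simp),
      by simp, ?_⟩
    have := hS (.reg x) trivial
    have := hS (.reg z) trivial
    simp only [cost]; linarith
  | add z x y =>
    intro d s _ v S L hR hS hL
    obtain ⟨v', w, t, r, hw, hl, ht⟩ := runs_add (Ω := Ω) (z := .reg z) (x := .reg x) (y := .reg y)
      trivial trivial trivial v S hR.1
    have h1 := hS (.reg x) trivial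
    have h2 := hS (.reg y) trivial
    have h3 := hS (.reg z) trivial
    refine ⟨v', _, t, r, hR.set z (by rw [hw, hR.2.2, hR.2.2]),
      (hS.mono (by simp)).update (by simp only [cost]; omega), by simp, ?_⟩
    simp only [cost]; linarith
  | sub z x y =>
    intro d s _ v S L hR hS hL
    obtain ⟨v', w, t, r, hw, hl, ht⟩ := runs_sub (Ω := Ω) (z := .reg z) (x := .reg x) (y := .reg y)
      trivial trivial trivial v S hR.1
    have h1 := hS (.reg x) trivial
    have h2 := hS (.reg y) trivial
    have h3 := hS (.reg z) trivial
    refine ⟨v', _, t, r, hR.set z (by rw [hw, hR.2.2, hR.2.2]),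
      (hS.mono (by simp)).update (by simp only [cost]; omega), by simp, ?_⟩
    simp only [cost]; linarith
  | half x =>
    intro d s _ v S L hR hS hL
    refine ⟨_, _, _, Exec.pop _ _ _ _, hR.set x ?_, (hS.update ?_).mono (by simp), by simp, ?_⟩
    · rw [← hR.2.2 x]
      cases S (.reg x) with
      | nil => simp [strVal]
      | cons c l =>
        simp only [List.tail_cons, strVal]
        have := Bool.toNat_le (symBit c)
        omega
    · have := hS (.reg x) trivial
      simp only [List.length_tail]; omega
    · simp only [cost]; linarith
  | emit c =>
    intro d s _ v S L hR hS hL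
    refine ⟨_, _, _, Exec.push _ _ _ _, ⟨?_, ?_, ?_⟩, ?_, by simp, by simp only [cost]; linarith⟩
    · simpa [Clean] using hR.1
    · simp [hR.2.1, run]
    · intro r; simpa [run] using hR.2.2 r
    -- The question stack is exempt from the length bound, since a call consumes it in a single
    -- step.
    · intro k hk
      have := hS k hk
      rw [Function.update_of_ne hk.ne.2.2.2.2]
      simp only [cost]; omega
  | emitNum x =>
    intro d s _ v S L hR hS hL
    obtain ⟨v', t, r, ht⟩ := runs_emitNum (Ω := Ω) (x := .reg x) trivial v S hR.1
    refine ⟨_, _, _, r, ⟨?_, ?_, ?_⟩, ?_, by simp, ?_⟩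
    · simpa [Clean] using hR.1
    · simp [hR.2.1, run, hR.2.2]
    · intro r; simpa [run] using hR.2.2 r
    · intro k hk
      have := hS k hk
      rw [Function.update_of_ne hk.ne.2.2.2.2]
      simp only [cost]; omega
    · have := hS (.reg x) trivial
      simp only [cost]; linarith
  | ask i x =>
    intro d s _ v S L hR hS hL
    obtain ⟨v₁, w, t₁, r₁, hw, hl, ht₁⟩ := hA i v S hR.1
    obtain ⟨v₂, t₂, r₂, ht₂⟩ := runs_readAnswer (Ω := Ω) (x := .reg x) trivial v₁
      (Function.update S .question []) (by simpa [Clean] using hR.1) w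
    rw [hR.2.1] at hw hl ht₁
    have hx := hS (.reg x) trivial
    have hR' : Rep ⟨s.reg, []⟩ (Function.update S .question []) := by
      refine ⟨by simpa [Clean] using hR.1, by simp, fun r => by simpa using hR.2.2 r⟩
    have hS' : Short (Function.update S .question []) L := by
      intro k hk
      rw [Function.update_of_ne hk.ne.2.2.2.2]
      exact hS k hk
    refine ⟨v₂, _, _, Exec.seq r₁ r₂, hR'.set x hw, ?_, by simp, ?_⟩
    · refine (hS'.mono (by simp)).update ?_
      simp only [cost]; omega
    · simp only [ne_eq, reduceCtorEq, not_false_eq_true, Function.update_of_ne] at ht₂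
      simp only [cost]
      set c := 1 + len i s.q with hc
      have h1 : t₁ + t₂ ≤ 20 * (c + (L + c + 1)) := by omega
      have h2 : 1 ≤ c := by omega
      nlinarith
  | seq p q ihp ihq =>
    intro d s hd
    simp only [depth] at hd
    exact (ihp d s (by omega)).seq (ihq d _ (by omega))
  | loop x p ih =>
    intro d s hd v S L hR hS hL
    simp only [depth] at hd
    have hdk : (Fin.ofNat 8 d).val = d := by
      simp only [Fin.val_ofNat]; exact Nat.mod_eq_of_lt (by omega)
    set k : Fin 8 := Fin.ofNat 8 d with hk
    -- Here `m` passes remain. The counter is decremented before each test, so it holds `m - 1`, and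
    -- the carry bit is set exactly when `m = 0`. The body is compiled at depth `d + 1` and leaves
    -- this counter alone.
    have key : ∀ (m : ℕ) (s : LoopState) (v : Mem N) (S : Stk → List TapeSymbol) (L : ℕ), Rep s S →
        Short S L → 1 ≤ L → v.c = decide (m = 0) → strVal (S (.ctr k)) = m - 1 →
        ∃ v' S' t, Runs Ω (.whileDo (fun v => !v.c) (.seq (compile askC (d + 1) p)
            (.dec (.ctr k)))) (v, S) (v', S') t ∧ Rep ((run ans p)^[m] s) S' ∧
          Short S' (L + ∑ i ∈ Finset.range m, (1 + cost ans len p ((run ans p)^[i] s))) ∧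
          (∀ i : Fin 8, i.val < d → S' (.ctr i) = S (.ctr i)) ∧
          t ≤ 1 + 400 * (∑ i ∈ Finset.range m, (1 + cost ans len p ((run ans p)^[i] s))) *
            (L + (∑ i ∈ Finset.range m, (1 + cost ans len p ((run ans p)^[i] s))) + 1) := by
      intro m
      induction m with
      | zero =>
        intro s v S L hR hS hL hc _
        exact ⟨v, S, 1, Exec.while_false (by simp [hc]), hR, by simpa using hS, fun _ _ => rfl,
          by simp⟩
      | succ m ihm =>
        intro s v S L hR hS hL hc hv
        obtain ⟨v₁, S₁, t₁, r₁, hR₁, hS₁, hf₁, ht₁⟩ := ih (d + 1) s (by omega) v S L hR hS hL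
        obtain ⟨v₂, w, t₂, r₂, hw, hl, ht₂, hc₂⟩ := runs_dec (Ω := Ω) (k := .ctr k) trivial v₁ S₁
          hR₁.1
        have hlen := hS₁ (.ctr k) trivial
        set c := cost ans len p s with hcdef
        have hval : strVal (S₁ (.ctr k)) = m := by rw [hf₁ k (by omega), hv]; simp
        obtain ⟨v₃, S₃, t₃, r₃, hR₃, hS₃, hf₃, ht₃⟩ := ihm (run ans p s) v₂
          (Function.update S₁ (.ctr k) w) (L + c) (hR₁.update_ctr k w)
          (hS₁.update (by omega)) (by omega) (by rw [hc₂, hval]) (by simp [hw, hval])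
        have hsum : ∑ i ∈ Finset.range (m + 1), (1 + cost ans len p ((run ans p)^[i] s)) =
            (∑ i ∈ Finset.range m, (1 + cost ans len p ((run ans p)^[i] (run ans p s)))) +
              (1 + c) := by
          rw [Finset.sum_range_succ']
          rfl
        rw [hsum]
        set tot := ∑ i ∈ Finset.range m, (1 + cost ans len p ((run ans p)^[i] (run ans p s)))
        refine ⟨v₃, S₃, _, Exec.while_true (by simp [hc]) (Exec.seq r₁ r₂) r₃, hR₃,
          hS₃.mono (by omega), ?_, ?_⟩
        · intro i hi
          have : Stk.ctr i ≠ .ctr k := by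
            intro h
            simp only [Stk.ctr.injEq] at h
            rw [h] at hi
            omega
          rw [hf₃ i hi, Function.update_of_ne this, hf₁ i (by omega)]
        · have e1 : 400 * c * (L + c + 1) ≤ 400 * c * (L + (tot + (1 + c)) + 1) := by gcongr; omega
          have e2 : 400 * tot * (L + c + tot + 1) ≤ 400 * tot * (L + (tot + (1 + c)) + 1) := by
            exact Nat.mul_le_mul_left _ (by omega)
          have e3 : t₂ + 1 ≤ 400 * 1 * (L + (tot + (1 + c)) + 1) := by omega
          calc 1 + (t₁ + t₂ + t₃) ≤ 1 + (400 * c * (L + (tot + (1 + c)) + 1) +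
              400 * 1 * (L + (tot + (1 + c)) + 1) + 400 * tot * (L + (tot + (1 + c)) + 1)) :=
                by omega
            _ = _ := by ring
    obtain ⟨v₁, t₁, r₁, ht₁⟩ := runs_copy (Ω := Ω) (z := .ctr k) (x := .reg x) trivial trivial v S
      hR.1
    have hR₁ := hR.update_ctr k (S (.reg x))
    have h1 := hS (.reg x) trivial
    have h2 := hS (.ctr k) trivial
    have hS₁ : Short (Function.update S (.ctr k) (S (.reg x))) L := hS.update h1
    obtain ⟨v₂, w, t₂, r₂, hw, hl, ht₂, hc₂⟩ := runs_dec (Ω := Ω) (k := .ctr k) trivial v₁ _ hR₁.1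
    simp only [Function.update_self, Function.update_idem, hR.2.2] at r₂ hw hl ht₂ hc₂
    obtain ⟨v₃, S₃, t₃, r₃, hR₃, hS₃, hf₃, ht₃⟩ := key (s.reg x) s v₂ (Function.update S (.ctr k) w)
      L (hR.update_ctr k w) (hS.update (by omega)) hL hc₂ (by simp [hw])
    refine ⟨v₃, S₃, _, Exec.seq r₁ (Exec.seq r₂ r₃), hR₃, hS₃.mono (by simp only [cost]; omega),
      ?_, ?_⟩
    · intro i hi
      have : Stk.ctr i ≠ .ctr k := by
        intro h
        simp only [Stk.ctr.injEq] at h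
        rw [h] at hi
        omega
      rw [hf₃ i hi, Function.update_of_ne this]
    · simp only [cost]
      set tot := ∑ i ∈ Finset.range (s.reg x), (1 + cost ans len p ((run ans p)^[i] s))
      have e2 : 400 * tot * (L + tot + 1) ≤ 400 * tot * (L + (1 + tot) + 1) := by gcongr; omega
      calc t₁ + (t₂ + t₃) ≤ 400 * 1 * (L + (1 + tot) + 1) + 400 * tot * (L + (1 + tot) + 1) :=
                by omega
        _ = _ := by ring

end LoopProg

/-! ### Frame rules and loop rules -/

namespace LoopProg

variable (ans len : OraclePort → List TapeSymbol → ℕ)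

/-- The registers that are written by a program. -/
def writes : LoopProg → Reg → Bool
  | const x _, r => r == x
  | copy z _, r => r == z
  | add z _ _, r => r == z
  | sub z _ _, r => r == z
  | half x, r => r == x
  | emit _, _ => false
  | emitNum _, _ => false
  | ask _ x, r => r == x
  | seq p q, r => writes p r || writes q r
  | loop _ p, r => writes p r

/-- Whether a program leaves the question alone. -/
def quiet : LoopProg → Bool
  | emit _ => false
  | emitNum _ => false
  | ask _ _ => false
  | seq p q => quiet p && quiet q
  | loop _ p => quiet p
  | _ => true

@[simp]
theorem _root_.LoopState.set_reg (s : LoopState) (x y : Reg) (v : ℕ) :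
    (s.set x v).reg y = if y = x then v else s.reg y := by
  simp [LoopState.set, Function.update_apply]

@[simp]
theorem _root_.LoopState.set_q (s : LoopState) (x : Reg) (v : ℕ) : (s.set x v).q = s.q := rfl

variable {ans len}

section
variable (s : LoopState) (x y z : Reg)

theorem run_const (b : Bool) : run ans (const x b) s = s.set x b.toNat := rfl

theorem run_copy : run ans (copy z x) s = s.set z (s.reg x) := rfl

theorem run_add : run ans (add z x y) s = s.set z (s.reg x + s.reg y) := rfl

theorem run_sub : run ans (sub z x y) s = s.set z (s.reg x - s.reg y) := rfl

theorem run_half : run ans (half x) s = s.set x (s.reg x / 2) := rfl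

theorem run_emit (c : TapeSymbol) : run ans (emit c) s = ⟨s.reg, c :: s.q⟩ := rfl

theorem run_emitNum : run ans (emitNum x) s = ⟨s.reg, natCode (s.reg x) ++ s.q⟩ := rfl

theorem run_ask (i : OraclePort) :
    run ans (ask i x) s = LoopState.set ⟨s.reg, []⟩ x (ans i s.q) := rfl

theorem run_seq (p q : LoopProg) : run ans (seq p q) s = run ans q (run ans p s) := rfl

theorem run_loop (p : LoopProg) : run ans (loop x p) s = (run ans p)^[s.reg x] s := rfl

end

/-- A frame rule whose hypothesis is a computation on the program text, so that `decide` proves it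
for every concrete program. -/
theorem run_reg_of_writes {p : LoopProg} {r : Reg} (h : writes p r = false) (s : LoopState) :
    (run ans p s).reg r = s.reg r := by
  induction p generalizing s with
  | const x b => simp_all [writes, run]
  | copy z x => simp_all [writes, run]
  | add z x y => simp_all [writes, run]
  | sub z x y => simp_all [writes, run]
  | half x => simp_all [writes, run]
  | emit c => simp [run]
  | emitNum x => simp [run]
  | ask i x =>
    have : r ≠ x := by simpa [writes] using h
    simp [run, Function.update_of_ne this]
  | seq p q ihp ihq =>
    simp only [writes, Bool.or_eq_false_iff] at h
    simp only [run]
    rw [ihq h.2, ihp h.1]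
  | loop x p ih =>
    simp only [writes] at h
    simp only [run]
    generalize s.reg x = k
    induction k generalizing s with
    | zero => rfl
    | succ k ihk => rw [Function.iterate_succ_apply, ihk, ih h]

theorem run_q_of_quiet {p : LoopProg} (h : quiet p = true) (s : LoopState) :
    (run ans p s).q = s.q := by
  induction p generalizing s with
  | const x b => simp [run]
  | copy z x => simp [run]
  | add z x y => simp [run]
  | sub z x y => simp [run]
  | half x => simp [run]
  | emit c => simp [quiet] at h
  | emitNum x => simp [quiet] at h
  | ask i x => simp [quiet] at h
  | seq p q ihp ihq =>
    simp only [quiet, Bool.and_eq_true] at h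
    simp only [run]
    rw [ihq h.2, ihp h.1]
  | loop x p ih =>
    simp only [quiet] at h
    simp only [run]
    generalize s.reg x = k
    induction k generalizing s with
    | zero => rfl
    | succ k ihk => rw [Function.iterate_succ_apply, ihk, ih h]

theorem iterate_reg_of_writes {p : LoopProg} {r : Reg} (h : writes p r = false) (s : LoopState)
    (k : ℕ) : ((run ans p)^[k] s).reg r = s.reg r := by
  induction k generalizing s with
  | zero => rfl
  | succ k ih => rw [Function.iterate_succ_apply, ih, run_reg_of_writes h]

/-- Induction along the passes of a loop. -/
theorem loop_induction {x : Reg} {p : LoopProg} (I : ℕ → LoopState → Prop) {s : LoopState}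
    (h0 : I 0 s) (h : ∀ i s', i < s.reg x → I i s' → I (i + 1) (run ans p s')) :
    I (s.reg x) (run ans (loop x p) s) := by
  have : ∀ k ≤ s.reg x, I k ((run ans p)^[k] s) := by
    intro k
    induction k with
    | zero => intro _; exact h0
    | succ k ih =>
      intro hk
      rw [Function.iterate_succ_apply']
      exact h k _ hk (ih (by omega))
  exact this _ le_rfl

theorem cost_loop_le {x : Reg} {p : LoopProg} (I : LoopState → Prop) {s : LoopState} {c : ℕ}
    (h0 : I s) (h : ∀ s', I s' → I (run ans p s')) (hc : ∀ s', I s' → cost ans len p s' ≤ c) :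
    cost ans len (loop x p) s ≤ 1 + s.reg x * (1 + c) := by
  have hI : ∀ k, I ((run ans p)^[k] s) := by
    intro k
    induction k with
    | zero => exact h0
    | succ k ih => rw [Function.iterate_succ_apply']; exact h _ ih
  simp only [cost]
  have : ∑ i ∈ Finset.range (s.reg x), (1 + cost ans len p ((run ans p)^[i] s)) ≤
      ∑ _i ∈ Finset.range (s.reg x), (1 + c) :=
    Finset.sum_le_sum fun i _ => by have := hc _ (hI i); omega
  simpa using this

end LoopProg

/-! ### The algorithm -/

namespace Algo

open LoopProg

/-- Sequential composition. -/
infixr:60 ";;" => LoopProg.seq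

/-- `z := x * y`, by repeated addition. -/
def mul (z x y : Reg) : LoopProg := const z false ;; loop y (add z z x)

/-- `x := x * y`. -/
def scale (x y : Reg) : LoopProg := mul .t x y ;; copy x .t

/-- Compute `(R + 1) ^ e` and `2 ^ P * R ^ e`. -/
def power : LoopProg :=
  const .num true ;; copy .den .P2 ;; loop .e (scale .num .R1 ;; scale .den .R)

/-- Move to the next level. -/
def down : LoopProg :=
  sub .e .e .m ;; loop .B (scale .S .R1 ;; scale .V .R1 ;; scale .W .R)

/-- Write one coordinate. -/
def coordinate : LoopProg :=
  emit .comma ;; emitNum .den ;; emit .slash ;; emitNum .num ;; add .S .S .W ;; add .a .a .one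

/-- Write a block of coordinates at the present level. -/
def block : LoopProg :=
  copy .q .a ;; loop .mu (half .q) ;; add .q .q .one ;; sub .rest .n .a ;; sub .t .q .rest ;;
    sub .q .q .t ;; power ;; loop .q coordinate

/-- Read the next bit of the code, and act accordingly. -/
def walkBit : LoopProg :=
  copy .half .cd ;; half .half ;; sub .bit .cd .half ;; sub .bit .bit .half ;; copy .cd .half ;;
    sub .nbit .one .bit ;; loop .nbit down ;; loop .bit block

/-- Write the question that belongs to a code. -/
def ask : LoopProg :=
  emitNum .eps ;; emit .slash ;; emitNum .one ;; const .S false ;; const .W true ;;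
    const .V true ;; const .a false ;; copy .e .T ;; copy .cd .code ;; loop .L walkBit ;;
    sub .rest .n .a ;; loop .rest (emit .comma ;; emitNum .one ;; emit .slash) ;;
    LoopProg.ask .body .ans

/-- Record the present scale if it passes the test. -/
def judge : LoopProg :=
  mul .t .V .M ;; mul .u .S .M ;; sub .t .t .V ;; sub .t .t .V ;; sub .t .t .V ;; sub .t .t .u ;;
    sub .ans .ans .t ;; loop .ans (copy .best .T)

/-- Try all codes at the present scale. -/
def tryScale : LoopProg :=
  const .code false ;; loop .Z (ask ;; judge ;; add .code .code .one)

/-- Try all scales. -/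
def tryAll : LoopProg :=
  const .T false ;; const .best false ;; loop .Tm (tryScale ;; add .T .T .one)

/-- Write the output. -/
def output : LoopProg :=
  copy .e .best ;; half .P2 ;; power ;; emitNum .den ;; emit .slash ;; emitNum .num

/-- Ask for the accuracy with one more digit. -/
def probe : LoopProg :=
  const .one true ;; add .mu .mu .one ;; loop .mu (emit (.digit true)) ;;
    LoopProg.ask .accuracy .flag ;; sub .flag .flag .one ;; sub .flag .flag .one ;;
    sub .flag .flag .one

/-- Compute `M` and the bound `H` for the logarithm of the norm of the basis vectors. -/
def setupBounds : LoopProg :=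
  const .one true ;; add .mu .mu .one ;; add .mu .mu .one ;; const .M true ;;
    loop .mu (add .M .M .M) ;; LoopProg.ask .degree .D ;; add .D .D .one ;; const .H true ;;
    loop .D (scale .H .n)

/-- Compute the bases of the geometric progressions. -/
def setupBase : LoopProg :=
  mul .nM .n .M ;; mul .B .nM .M ;; mul .R .B .M ;; add .R1 .R .one ;;
    loop .B (emit (.digit true)) ;; LoopProg.ask .exponent .u ;; mul .m .u .B ;;
    loop .B (half .m) ;; sub .m .m .one

/-- Compute the precision and the lengths of the loops. -/
def setupLoops : LoopProg :=
  add .u .nM .nM ;; add .P .H .H ;; copy .Tm .P ;; add .P .P .u ;; add .P .P .one ;;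
    add .P .P .one ;; add .P .P .one ;; add .P .P .one ;; const .P2 true ;;
    loop .P (add .P2 .P2 .P2) ;; mul .eps .P2 .nM ;; add .a .M .M ;; add .a .a .a ;;
    mul .L .a .nM ;; const .Z true ;; loop .a (scale .Z .u) ;; add .e .P .n ;; add .e .e .Tm ;;
    add .e .e .one ;; mul .Tm .R .e

/-- The main part of the algorithm. -/
def main : LoopProg := setupBounds ;; setupBase ;; setupLoops ;; tryAll ;; output

theorem depth_main : main.depth ≤ 8 := by decide

theorem depth_probe : probe.depth ≤ 8 := by decide

end Algo

/-! ### Effects of the arithmetic subprograms -/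

namespace Algo

open LoopProg

variable {ans len : OraclePort → List TapeSymbol → ℕ}

theorem iterate_add_self {z x : Reg} (h : z ≠ x) (s : LoopState) (k : ℕ) :
    (run ans (add z z x))^[k] s = s.set z (s.reg z + k * s.reg x) := by
  induction k with
  | zero => simp [LoopState.set]
  | succ k ih =>
    rw [Function.iterate_succ_apply', ih]
    simp only [run, LoopState.set_reg, h.symm, if_true, if_false]
    simp only [LoopState.set, Function.update_idem]
    congr 2
    ring

theorem run_mul {z x y : Reg} (hx : z ≠ x) (hy : z ≠ y) (s : LoopState) :
    run ans (mul z x y) s = s.set z (s.reg x * s.reg y) := by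
  simp only [mul, run_seq, run_const, run_loop, iterate_add_self hx, LoopState.set_reg,
    hx.symm, hy.symm, if_true, if_false]
  simp only [LoopState.set, Function.update_idem]
  congr 2
  simp [mul_comm]

/-- Repeated addition is linear in the value of the second factor. Only the first factor may be
exponentially large; the second one is always a number like `M`, `B` or `R`. -/
theorem cost_mul {z x y : Reg} (hy : z ≠ y) (s : LoopState) :
    cost ans len (mul z x y) s = 2 + 2 * s.reg y := by
  simp only [mul, cost, run, LoopState.set_reg, hy.symm, if_false, Finset.sum_const,
    Finset.card_range, smul_eq_mul]
  ring

theorem run_scale_self {x y : Reg} (hx : .t ≠ x) (hy : .t ≠ y) (s : LoopState) :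
    (run ans (scale x y) s).reg x = s.reg x * s.reg y := by
  simp [scale, run, run_mul hx hy]

theorem cost_scale {x y : Reg} (hy : .t ≠ y) (s : LoopState) :
    cost ans len (scale x y) s = 3 + 2 * s.reg y := by
  simp only [scale, cost, cost_mul hy]
  ring

theorem iterate_half {x : Reg} (s : LoopState) (k : ℕ) :
    (run ans (half x))^[k] s = s.set x (s.reg x / 2 ^ k) := by
  induction k with
  | zero => simp [LoopState.set]
  | succ k ih =>
    rw [Function.iterate_succ_apply', ih]
    simp only [run, LoopState.set_reg, if_true]
    simp only [LoopState.set, Function.update_idem]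
    rw [Nat.div_div_eq_div_mul, pow_succ]

theorem iterate_double {x : Reg} (s : LoopState) (k : ℕ) :
    (run ans (add x x x))^[k] s = s.set x (s.reg x * 2 ^ k) := by
  induction k with
  | zero => simp [LoopState.set]
  | succ k ih =>
    rw [Function.iterate_succ_apply', ih]
    simp only [run, LoopState.set_reg, if_true]
    simp only [LoopState.set, Function.update_idem]
    rw [pow_succ]
    congr 2
    ring

theorem iterate_scale {x y : Reg} (hx : .t ≠ x) (hy : .t ≠ y) (hxy : x ≠ y) (s : LoopState)
    (k : ℕ) : ((run ans (scale x y))^[k] s).reg x = s.reg x * s.reg y ^ k := by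
  have hw : writes (scale x y) y = false := by
    simp [scale, mul, writes, hy.symm, hxy.symm]
  induction k with
  | zero => simp
  | succ k ih =>
    rw [Function.iterate_succ_apply', run_scale_self hx hy, ih, iterate_reg_of_writes hw]
    ring

theorem iterate_emit (c : TapeSymbol) (s : LoopState) (k : ℕ) :
    (run ans (emit c))^[k] s = ⟨s.reg, List.replicate k c ++ s.q⟩ := by
  induction k with
  | zero => simp
  | succ k ih =>
    rw [Function.iterate_succ_apply', ih]
    simp [run, List.replicate_succ]

theorem run_power (s : LoopState) :
    (run ans power s).reg .num = s.reg .R1 ^ s.reg .e ∧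
      (run ans power s).reg .den = s.reg .P2 * s.reg .R ^ s.reg .e := by
  set s₁ := (s.set .num 1).set .den (s.reg .P2) with hs₁
  have h : run ans power s =
      run ans (loop .e (scale .num .R1 ;; scale .den .R)) s₁ := by
    simp [power, run, hs₁]
  have he : s₁.reg .e = s.reg .e := by simp [hs₁]
  have key := loop_induction (ans := ans) (x := .e) (p := scale .num .R1 ;; scale .den .R)
    (fun i s' => s'.reg .R1 = s.reg .R1 ∧ s'.reg .R = s.reg .R ∧ s'.reg .num = s.reg .R1 ^ i ∧
      s'.reg .den = s.reg .P2 * s.reg .R ^ i) (s := s₁) (by simp [hs₁])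
    (by
      rintro i s' - ⟨h1, h2, h3, h4⟩
      refine ⟨?_, ?_, ?_, ?_⟩
      · rw [run_reg_of_writes (by decide), h1]
      · rw [run_reg_of_writes (by decide), h2]
      · simp only [run]
        rw [run_reg_of_writes (by decide), run_scale_self (by decide) (by decide), h1, h3, pow_succ]
      · simp only [run]
        rw [run_scale_self (by decide) (by decide), run_reg_of_writes (by decide),
          run_reg_of_writes (by decide), h2, h4, pow_succ]
        ring)
  rw [h, ← he]
  exact ⟨key.2.2.1, key.2.2.2⟩

theorem run_down (s : LoopState) :
    (run ans down s).reg .e = s.reg .e - s.reg .m ∧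
      (run ans down s).reg .S = s.reg .S * s.reg .R1 ^ s.reg .B ∧
      (run ans down s).reg .V = s.reg .V * s.reg .R1 ^ s.reg .B ∧
      (run ans down s).reg .W = s.reg .W * s.reg .R ^ s.reg .B := by
  set s₁ := s.set .e (s.reg .e - s.reg .m) with hs₁
  have h : run ans down s =
      run ans (loop .B (scale .S .R1 ;; scale .V .R1 ;; scale .W .R)) s₁ := by
    simp [down, run, hs₁]
  have he : s₁.reg .B = s.reg .B := by simp [hs₁]
  have key := loop_induction (ans := ans) (x := .B)
    (p := scale .S .R1 ;; scale .V .R1 ;; scale .W .R)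
    (fun i s' => s'.reg .R1 = s.reg .R1 ∧ s'.reg .R = s.reg .R ∧
      s'.reg .S = s.reg .S * s.reg .R1 ^ i ∧ s'.reg .V = s.reg .V * s.reg .R1 ^ i ∧
      s'.reg .W = s.reg .W * s.reg .R ^ i) (s := s₁) (by simp [hs₁])
    (by
      rintro i s' - ⟨h1, h2, h3, h4, h5⟩
      refine ⟨?_, ?_, ?_, ?_, ?_⟩
      · rw [run_reg_of_writes (by decide), h1]
      · rw [run_reg_of_writes (by decide), h2]
      · simp only [run]
        rw [run_reg_of_writes (by decide), run_reg_of_writes (by decide),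
          run_scale_self (by decide) (by decide), h1, h3, pow_succ]
        ring
      · simp only [run]
        rw [run_reg_of_writes (by decide), run_scale_self (by decide) (by decide),
          run_reg_of_writes (by decide), run_reg_of_writes (by decide), h1, h4, pow_succ]
        ring
      · simp only [run]
        rw [run_scale_self (by decide) (by decide),
          run_reg_of_writes (by decide), run_reg_of_writes (by decide),
          run_reg_of_writes (by decide), run_reg_of_writes (by decide), h2, h5, pow_succ]
        ring)
  rw [he, ← h] at key
  refine ⟨?_, key.2.2.1, key.2.2.2.1, key.2.2.2.2⟩
  rw [h, run_reg_of_writes (by decide)]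
  simp [hs₁]

theorem run_coordinates (s : LoopState) (k : ℕ) :
    ((run ans coordinate)^[k] s).q = (List.replicate k (natCode (s.reg .num) ++ .slash ::
        (natCode (s.reg .den) ++ [.comma]))).flatten ++ s.q ∧
      ((run ans coordinate)^[k] s).reg .S = s.reg .S + k * s.reg .W ∧
      ((run ans coordinate)^[k] s).reg .a = s.reg .a + k * s.reg .one := by
  induction k with
  | zero => simp
  | succ k ih =>
    obtain ⟨h1, h2, h3⟩ := ih
    rw [Function.iterate_succ_apply']
    have hW := iterate_reg_of_writes (ans := ans) (p := coordinate) (r := .W) (by decide) s k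
    have ho := iterate_reg_of_writes (ans := ans) (p := coordinate) (r := .one) (by decide) s k
    have hn := iterate_reg_of_writes (ans := ans) (p := coordinate) (r := .num) (by decide) s k
    have hd := iterate_reg_of_writes (ans := ans) (p := coordinate) (r := .den) (by decide) s k
    set s' := (run ans coordinate)^[k] s
    refine ⟨?_, ?_, ?_⟩
    · simp [coordinate, run, hn, hd, h1, List.replicate_succ]
    · simp [coordinate, run, hW, h2]; ring
    · simp [coordinate, run, ho, h3]; ring

theorem run_block (s : LoopState) (h1 : s.reg .one = 1) :
    (run ans block s).q = (List.replicate
        (min (s.reg .a / 2 ^ s.reg .mu + 1) (s.reg .n - s.reg .a))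
          (natCode (s.reg .R1 ^ s.reg .e) ++ .slash ::
            (natCode (s.reg .P2 * s.reg .R ^ s.reg .e) ++ [.comma]))).flatten ++ s.q ∧
      (run ans block s).reg .S = s.reg .S +
        min (s.reg .a / 2 ^ s.reg .mu + 1) (s.reg .n - s.reg .a) * s.reg .W ∧
      (run ans block s).reg .a = s.reg .a +
        min (s.reg .a / 2 ^ s.reg .mu + 1) (s.reg .n - s.reg .a) := by
  set s₁ := run ans (copy .q .a ;; loop .mu (half .q) ;; add .q .q .one ;; sub .rest .n .a ;;
    sub .t .q .rest ;; sub .q .q .t) s with hs₁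
  -- In truncated arithmetic, `q - (q - rest)` is the minimum of `q` and `rest`.
  have hq : s₁.reg .q = min (s.reg .a / 2 ^ s.reg .mu + 1) (s.reg .n - s.reg .a) := by
    simp [hs₁, run_seq, run_copy, run_loop, run_add, run_sub, iterate_half, h1]
    generalize s.reg .a / 2 ^ s.reg .mu = d
    omega
  have hqq : s₁.q = s.q := run_q_of_quiet (by decide) s
  have hfr : ∀ r ∈ [Reg.R1, .R, .e, .P2, .S, .W, .a, .one], s₁.reg r = s.reg r := by
    intro r hr
    refine run_reg_of_writes ?_ s
    fin_cases hr <;> decide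
  have hp := run_power (ans := ans) s₁
  set s₂ := run ans power s₁ with hs₂
  have hfr₂ : ∀ r ∈ [Reg.q, .S, .W, .a, .one], s₂.reg r = s₁.reg r := by
    intro r hr
    refine run_reg_of_writes ?_ s₁
    fin_cases hr <;> decide
  have hqq₂ : s₂.q = s₁.q := run_q_of_quiet (by decide) s₁
  have h : run ans block s = (run ans coordinate)^[s₂.reg .q] s₂ := by
    simp only [block, run, hs₂, hs₁]
  have key := run_coordinates (ans := ans) s₂ (s₂.reg .q)
  rw [← h, hfr₂ .q (by simp), hfr₂ .S (by simp), hfr₂ .W (by simp), hfr₂ .a (by simp),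
    hfr₂ .one (by simp), hp.1, hp.2, hqq₂, hqq, hq, hfr .R1 (by simp), hfr .R (by simp),
    hfr .e (by simp), hfr .P2 (by simp), hfr .S (by simp), hfr .W (by simp), hfr .a (by simp),
    hfr .one (by simp), h1, mul_one] at key
  exact key

end Algo

/-! ### Codes, paths and the effect of the search -/

namespace Algo

open LoopProg

variable {ans len : OraclePort → List TapeSymbol → ℕ}

/-- The parameters of the search. -/
structure Params where
  (n mu B R m P Z L Tm : ℕ)

/-- One step of the path that is described by a code: the present level, and the levels of the
coordinates that have been written. -/
def walkStep (n M : ℕ) (b : Bool) (w : ℕ × List ℕ) : ℕ × List ℕ :=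
  if b then (w.1, List.replicate (min (w.2.length / M + 1) (n - w.2.length)) w.1 ++ w.2)
  else (w.1 + 1, w.2)

/-- The first `i` steps of the path that is described by a code. -/
def walk (n M code : ℕ) : ℕ → ℕ × List ℕ
  | 0 => (0, [])
  | i + 1 => walkStep n M (code.testBit i) (walk n M code i)

theorem length_walk_le (n M code i : ℕ) : (walk n M code i).2.length ≤ n := by
  induction i with
  | zero => simp [walk]
  | succ i ih =>
    simp only [walk, walkStep]
    split_ifs
    · simp only [List.length_append, List.length_replicate]
      omega
    · exact ih

/-- The string for a coordinate at level `l`. -/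
def coordCode (c : Params) (T l : ℕ) : List TapeSymbol :=
  natCode ((c.R + 1) ^ (T - c.m * l)) ++ .slash ::
    (natCode (2 ^ c.P * c.R ^ (T - c.m * l)) ++ [.comma])

/-- The weight of the coordinates at the levels `js`. -/
noncomputable def weight (c : Params) (js : List ℕ) : ℝ :=
  (js.map fun l => (((c.R : ℝ) / (c.R + 1)) ^ c.B) ^ l).sum

/-- The registers hold the parameters. -/
structure Ready (c : Params) (s : LoopState) : Prop where
  n : s.reg .n = c.n
  mu : s.reg .mu = c.mu
  one : s.reg .one = 1
  M : s.reg .M = 2 ^ c.mu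
  B : s.reg .B = c.B
  R : s.reg .R = c.R
  R1 : s.reg .R1 = c.R + 1
  m : s.reg .m = c.m
  P2 : s.reg .P2 = 2 ^ c.P
  eps : s.reg .eps = 2 ^ c.P * (c.n * 2 ^ c.mu)
  Z : s.reg .Z = c.Z
  L : s.reg .L = c.L
  Tm : s.reg .Tm = c.Tm

theorem Ready.congr {c : Params} {s s' : LoopState} (h : Ready c s)
    (hs : ∀ r ∈ [Reg.n, .mu, .one, .M, .B, .R, .R1, .m, .P2, .eps, .Z, .L, .Tm],
      s'.reg r = s.reg r) : Ready c s' := by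
  constructor <;> (rw [hs _ (by simp)]; simp [h.n, h.mu, h.one, h.M, h.B, h.R, h.R1, h.m, h.P2,
    h.eps, h.Z, h.L, h.Tm])

theorem Ready.run {c : Params} {s : LoopState} (h : Ready c s) {p : LoopProg}
    (hp : [Reg.n, .mu, .one, .M, .B, .R, .R1, .m, .P2, .eps, .Z, .L, .Tm].all
      (fun r => !writes p r) = true) : Ready c (run ans p s) := by
  refine h.congr fun r hr => run_reg_of_writes ?_ s
  have := List.all_eq_true.mp hp r hr
  simpa using this

/-- The state after some steps of the path. -/
structure Walking (c : Params) (T code : ℕ) (w : ℕ × List ℕ) (tail : List TapeSymbol) (i : ℕ)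
    (s : LoopState) : Prop where
  cd : s.reg .cd = code / 2 ^ i
  a : s.reg .a = w.2.length
  e : s.reg .e = T - c.m * w.1
  V : s.reg .V = (c.R + 1) ^ (c.B * w.1)
  W : s.reg .W = c.R ^ (c.B * w.1)
  S : (s.reg .S : ℝ) = (c.R + 1) ^ (c.B * w.1) * weight c w.2
  q : s.q = (w.2.map (coordCode c T)).flatten ++ tail

/-- The weights are kept as integers over the common denominator `V = (R + 1) ^ (B * level)`: a new
level multiplies `S` and `V` by `(R + 1) ^ B`, and the present weight `W` by `R ^ B`. -/
theorem run_walkBit {c : Params} {T code i : ℕ} {w : ℕ × List ℕ} {tail : List TapeSymbol}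
    {s : LoopState} (hc : Ready c s) (h : Walking c T code w tail i s) :
    Walking c T code (walkStep c.n (2 ^ c.mu) (code.testBit i) w) tail (i + 1)
      (run ans walkBit s) := by
  set s₁ := run ans (copy .half .cd ;; half .half ;; sub .bit .cd .half ;; sub .bit .bit .half ;;
    copy .cd .half ;; sub .nbit .one .bit) s with hs₁
  have hb : s₁.reg .bit = s.reg .cd % 2 := by
    simp [hs₁, run_seq, run_copy, run_half, run_sub]
    omega
  have hnb : s₁.reg .nbit = 1 - s.reg .cd % 2 := by
    simp [hs₁, run_seq, run_copy, run_half, run_sub, hc.one]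
    omega
  have hcd : s₁.reg .cd = s.reg .cd / 2 := by
    simp [hs₁, run_seq, run_copy, run_half, run_sub]
  have hq : s₁.q = s.q := run_q_of_quiet (by decide) s
  have hfr : ∀ r ∈ [Reg.a, .e, .V, .W, .S], s₁.reg r = s.reg r := by
    intro r hr
    refine run_reg_of_writes ?_ s
    fin_cases hr <;> decide
  have hc₁ : Ready c s₁ := hc.run (by decide)
  have hrun : run ans walkBit s = (run ans block)^[(run ans (loop .nbit down) s₁).reg .bit]
      (run ans (loop .nbit down) s₁) := rfl
  rw [run_reg_of_writes (p := loop .nbit down) (by decide), hb] at hrun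
  have htb : code.testBit i = decide (s.reg .cd % 2 = 1) := by
    rw [h.cd, Nat.testBit_eq_decide_div_mod_eq]
  have hcd' : s.reg .cd / 2 = code / 2 ^ (i + 1) := by
    rw [h.cd, Nat.div_div_eq_div_mul, pow_succ]
  rcases Nat.mod_two_eq_zero_or_one (s.reg .cd) with h0 | h0
  · rw [h0, Function.iterate_zero, id_eq, run_loop, hnb, h0, Nat.sub_zero,
      Function.iterate_one] at hrun
    rw [htb, h0, hrun]
    obtain ⟨d1, d2, d3, d4⟩ := run_down (ans := ans) s₁
    rw [hc₁.m, hc₁.R, hc₁.R1, hc₁.B, hfr .e (by simp)] at *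
    rw [hfr .S (by simp)] at d2
    rw [hfr .V (by simp)] at d3
    rw [hfr .W (by simp)] at d4
    simp only [walkStep, zero_ne_one, decide_false, Bool.false_eq_true, if_false]
    refine ⟨?_, ?_, ?_, ?_, ?_, ?_, ?_⟩
    · rw [run_reg_of_writes (by decide), hcd, hcd']
    · rw [run_reg_of_writes (by decide), hfr .a (by simp), h.a]
    · rw [d1, h.e, Nat.sub_sub, Nat.mul_succ]
    · rw [d3, h.V, ← pow_add, Nat.mul_succ]
    · rw [d4, h.W, ← pow_add, Nat.mul_succ]
    · rw [d2, Nat.cast_mul, h.S, Nat.mul_succ, pow_add]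
      push_cast
      ring
    · rw [run_q_of_quiet (by decide), hq, h.q]
  · rw [h0, run_loop, hnb, h0, Nat.sub_self, Function.iterate_zero, id_eq,
      Function.iterate_one] at hrun
    rw [htb, h0, hrun]
    obtain ⟨d1, d2, d3⟩ := run_block (ans := ans) s₁ hc₁.one
    rw [hc₁.n, hc₁.mu, hfr .a (by simp), h.a] at d1 d2 d3
    rw [hc₁.R, hc₁.R1, hc₁.P2, hfr .e (by simp), h.e, hq, h.q] at d1
    rw [hfr .S (by simp), hfr .W (by simp), h.W] at d2
    simp only [walkStep, decide_true, if_true]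
    set k := min (w.2.length / 2 ^ c.mu + 1) (c.n - w.2.length)
    refine ⟨?_, ?_, ?_, ?_, ?_, ?_, ?_⟩
    · rw [run_reg_of_writes (by decide), hcd, hcd']
    · rw [d3]; simp [add_comm]
    · rw [run_reg_of_writes (by decide), hfr .e (by simp), h.e]
    · rw [run_reg_of_writes (by decide), hfr .V (by simp), h.V]
    · rw [run_reg_of_writes (by decide), hfr .W (by simp), h.W]
    · rw [d2, Nat.cast_add, h.S]
      have hR : (c.R : ℝ) + 1 ≠ 0 := by positivity
      simp only [weight, List.map_append, List.map_replicate, List.sum_append, List.sum_replicate,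
        nsmul_eq_mul]
      have e : ((c.R : ℝ) + 1) ^ (c.B * w.1) * (((c.R : ℝ) / (c.R + 1)) ^ c.B) ^ w.1 =
          (c.R : ℝ) ^ (c.B * w.1) := by
        rw [← pow_mul, div_pow, mul_div_cancel₀ _ (pow_ne_zero _ hR)]
      push_cast
      rw [← e]
      ring
    · rw [d1]
      simp [coordCode]

theorem run_walk {c : Params} {T code : ℕ} {tail : List TapeSymbol} {s : LoopState}
    (hc : Ready c s) (h : Walking c T code (0, []) tail 0 s) :
    Ready c (run ans (loop .L walkBit) s) ∧ Walking c T code (walk c.n (2 ^ c.mu) code c.L) tail c.L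
      (run ans (loop .L walkBit) s) := by
  have := loop_induction (ans := ans) (x := .L) (p := walkBit)
    (fun i s' => Ready c s' ∧ Walking c T code (walk c.n (2 ^ c.mu) code i) tail i s') (s := s)
    ⟨hc, h⟩ (by
      rintro i s' - ⟨h1, h2⟩
      exact ⟨h1.run (by decide), run_walkBit h1 h2⟩)
  rw [hc.L] at this
  exact this

/-- The question about a code. -/
def question (c : Params) (T code : ℕ) : List TapeSymbol :=
  (List.replicate (c.n - (walk c.n (2 ^ c.mu) code c.L).2.length)
      (.slash :: (natCode 1 ++ [.comma]))).flatten ++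
    (((walk c.n (2 ^ c.mu) code c.L).2.map (coordCode c T)).flatten ++
      (natCode 1 ++ .slash :: natCode (2 ^ c.P * (c.n * 2 ^ c.mu))))

/-- The numerator of zero has no digits, so a zero coordinate consists of a slash and the
denominator one. -/
theorem iterate_zeros (s : LoopState) (k : ℕ) (h1 : s.reg .one = 1) :
    (run ans (emit .comma ;; emitNum .one ;; emit .slash))^[k] s =
      ⟨s.reg, (List.replicate k (.slash :: (natCode 1 ++ [.comma]))).flatten ++ s.q⟩ := by
  induction k with
  | zero => simp
  | succ k ih =>
    rw [Function.iterate_succ_apply', ih]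
    simp [run, List.replicate_succ, h1]

/-- The question is a stack and is written from its end: first the tolerance, then the coordinates
from the last to the first. This is why the list of levels grows at its head. Only the ratio of `S`
to `V` matters later, so the final level `j` is left unspecified. -/
theorem run_ask_spec {c : Params} {T code : ℕ} {s : LoopState} (hc : Ready c s)
    (hT : s.reg .T = T) (hcode : s.reg .code = code) (hq : s.q = []) :
    (run ans ask s).q = [] ∧ (run ans ask s).reg .ans = ans .body (question c T code) ∧
      ∃ j, (run ans ask s).reg .V = (c.R + 1) ^ (c.B * j) ∧
        ((run ans ask s).reg .S : ℝ) =
          (c.R + 1) ^ (c.B * j) * weight c (walk c.n (2 ^ c.mu) code c.L).2 := by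
  set s₁ := run ans (emitNum .eps ;; emit .slash ;; emitNum .one ;; const .S false ;;
    const .W true ;; const .V true ;; const .a false ;; copy .e .T ;; copy .cd .code) s with hs₁
  have hc₁ : Ready c s₁ := hc.run (by decide)
  have hw₁ : Walking c T code (0, [])
      (natCode 1 ++ .slash :: natCode (2 ^ c.P * (c.n * 2 ^ c.mu))) 0 s₁ := by
    constructor <;> simp [hs₁, run_seq, run_emitNum, run_emit, run_const, run_copy, hT, hcode, hq,
      weight, hc.one, hc.eps]
  obtain ⟨hc₂, hw₂⟩ := run_walk (ans := ans) hc₁ hw₁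
  set s₂ := run ans (loop .L walkBit) s₁ with hs₂
  have hrun : run ans ask s = run ans (LoopProg.ask .body .ans)
      ((run ans (emit .comma ;; emitNum .one ;; emit .slash))^[s₂.reg .n - s₂.reg .a]
        (s₂.set .rest (s₂.reg .n - s₂.reg .a))) := by
    simp only [ask, run_seq, run_loop, run_sub, hs₂, hs₁]
    simp
  rw [iterate_zeros _ _ (by simp [hc₂.one]), hc₂.n, hw₂.a] at hrun
  rw [hrun]
  refine ⟨rfl, ?_, (walk c.n (2 ^ c.mu) code c.L).1, ?_, ?_⟩
  · simp [run_ask, question, hw₂.q]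
  · simp [run_ask, hw₂.V]
  · simp [run_ask, hw₂.S]

/-- The test for the pair of a scale and a code. -/
def Hit (ans : OraclePort → List TapeSymbol → ℕ) (c : Params) (T code : ℕ) : Prop :=
  1 ≤ ans .body (question c T code) ∧
    (2 : ℝ) ^ c.mu ≤ 3 + 2 ^ c.mu * weight c (walk c.n (2 ^ c.mu) code c.L).2

theorem iterate_copy (s : LoopState) {x y : Reg} (h : x ≠ y) (k : ℕ) :
    ((run ans (copy x y))^[k] s).reg x = if k = 0 then s.reg x else s.reg y := by
  cases k with
  | zero => simp
  | succ k =>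
    have hw : writes (copy x y) y = false := by simp [writes, h.symm]
    rw [Function.iterate_succ_apply', run_copy]
    simp [iterate_reg_of_writes hw]

theorem run_judge (s : LoopState) :
    (run ans judge s).reg .best = if s.reg .ans - (s.reg .V * s.reg .M - s.reg .V - s.reg .V -
      s.reg .V - s.reg .S * s.reg .M) = 0 then s.reg .best else s.reg .T := by
  simp [judge, run_seq, run_sub, run_loop, iterate_copy, run_mul]

/-- Some code passes the test at a given scale. -/
def Good (ans : OraclePort → List TapeSymbol → ℕ) (c : Params) (T : ℕ) : Prop :=
  ∃ code < c.Z, Hit ans c T code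

/-- The truncated difference `V * M - 3 * V - S * M` vanishes exactly when the total weight is at
least `1 - 3 / M`. A positive difference wipes out an answer of at most 1, so the scale is recorded
only if both tests succeed. -/
theorem run_ask_judge {c : Params} {T code : ℕ} {s : LoopState} (hc : Ready c s)
    (hans : ans .body (question c T code) ≤ 1)
    (hT : s.reg .T = T) (hcode : s.reg .code = code) (hq : s.q = []) :
    (Hit ans c T code → (run ans (Algo.ask ;; judge) s).reg .best = T) ∧
      (¬ Hit ans c T code → (run ans (Algo.ask ;; judge) s).reg .best = s.reg .best) := by
  obtain ⟨-, h2, j, hV, hS⟩ := run_ask_spec (ans := ans) hc hT hcode hq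
  have hM : (run ans Algo.ask s).reg .M = 2 ^ c.mu := by
    rw [run_reg_of_writes (by decide), hc.M]
  have hT' : (run ans Algo.ask s).reg .T = T := by
    rw [run_reg_of_writes (by decide), hT]
  have hb : (run ans Algo.ask s).reg .best = s.reg .best := run_reg_of_writes (by decide) s
  rw [run_seq, run_judge, h2, hM, hT', hb]
  set s' := run ans Algo.ask s
  have hVpos : (0 : ℝ) < (c.R + 1) ^ (c.B * j) := by positivity
  have key : s'.reg .V * 2 ^ c.mu - s'.reg .V - s'.reg .V - s'.reg .V - s'.reg .S * 2 ^ c.mu = 0 ↔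
      (2 : ℝ) ^ c.mu ≤ 3 + 2 ^ c.mu * weight c (walk c.n (2 ^ c.mu) code c.L).2 := by
    have e1 : s'.reg .V * 2 ^ c.mu - s'.reg .V - s'.reg .V - s'.reg .V - s'.reg .S * 2 ^ c.mu = 0 ↔
        s'.reg .V * 2 ^ c.mu ≤ 3 * s'.reg .V + s'.reg .S * 2 ^ c.mu := by omega
    rw [e1, ← Nat.cast_le (α := ℝ)]
    push_cast
    have hV' : (s'.reg .V : ℝ) = (c.R + 1) ^ (c.B * j) := by rw [hV]; push_cast; rfl
    rw [hS, hV', ← mul_le_mul_iff_right₀ hVpos (b := (2 : ℝ) ^ c.mu)]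
    constructor <;> intro h <;> linarith
  unfold Hit
  rw [← key]
  constructor
  · rintro ⟨h3, h4⟩
    rw [if_neg (by omega)]
  · intro h
    rw [if_pos]
    by_cases h3 : 1 ≤ ans .body (question c T code)
    · have := not_and.mp h h3
      omega
    · omega

theorem run_tryScale {c : Params} {T : ℕ} {s : LoopState} (hc : Ready c s)
    (hans : ∀ code, ans .body (question c T code) ≤ 1) (hT : s.reg .T = T) (hq : s.q = []) :
    (run ans tryScale s).q = [] ∧ (Good ans c T → (run ans tryScale s).reg .best = T) ∧
      (¬ Good ans c T → (run ans tryScale s).reg .best = s.reg .best) := by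
  set s₁ := s.set .code 0 with hs₁
  have hc₁ : Ready c s₁ := hc.congr (by simp [hs₁])
  have hrun : run ans tryScale s =
      run ans (loop .Z (Algo.ask ;; judge ;; add .code .code .one)) s₁ := by
    simp [tryScale, run_seq, run_const, hs₁]
  have key := loop_induction (ans := ans) (x := .Z) (p := Algo.ask ;; judge ;; add .code .code .one)
    (fun i s' => Ready c s' ∧ s'.reg .T = T ∧ s'.q = [] ∧ s'.reg .code = i ∧
      ((∃ code < i, Hit ans c T code) → s'.reg .best = T) ∧
      (¬ (∃ code < i, Hit ans c T code) → s'.reg .best = s.reg .best)) (s := s₁)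
    ⟨hc₁, by simp [hs₁, hT], by simp [hs₁, hq], by simp [hs₁], by simp, by simp [hs₁]⟩
    (by
      rintro i s' - ⟨h1, h2, h3, h4, h5, h6⟩
      obtain ⟨h7, h8⟩ := run_ask_judge (ans := ans) h1 (hans i) h2 h4 h3
      have hb : (run ans (Algo.ask ;; judge ;; add .code .code .one) s').reg .best =
        (run ans (Algo.ask ;; judge) s').reg .best := by
        simp [run_seq, run_add]
      refine ⟨h1.run (by decide), ?_, ?_, ?_, ?_, ?_⟩
      · rw [run_reg_of_writes (by decide), h2]
      · rw [run_seq, run_q_of_quiet (by decide)]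
        exact (run_ask_spec h1 h2 h4 h3).1
      · simp only [run_seq, run_add, LoopState.set_reg, if_true]
        rw [run_reg_of_writes (p := judge) (by decide), run_reg_of_writes (p := judge) (by decide),
          run_reg_of_writes (p := Algo.ask) (by decide),
          run_reg_of_writes (p := Algo.ask) (by decide), h4, h1.one]
      · rintro ⟨code, hlt, hh⟩
        rw [hb]
        by_cases hi : Hit ans c T i
        · exact h7 hi
        · rw [h8 hi]
          refine h5 ⟨code, ?_, hh⟩
          rcases Nat.lt_succ_iff_lt_or_eq.mp hlt with h | h
          · exact h
          · exact absurd (h ▸ hh) hi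
      · intro hno
        rw [hb, h8 fun hi => hno ⟨i, by omega, hi⟩]
        exact h6 fun ⟨code, hlt, hh⟩ => hno ⟨code, by omega, hh⟩)
  rw [hc₁.Z, ← hrun] at key
  exact ⟨key.2.2.1, key.2.2.2.2.1, key.2.2.2.2.2⟩

/-- The scales are tried in increasing order, so the last one recorded is the largest good one. The
initial value 0 of `best` need not be good, hence the conditional third claim. -/
theorem run_tryAll {c : Params} {s : LoopState} (hc : Ready c s)
    (hans : ∀ T code, ans .body (question c T code) ≤ 1) (hq : s.q = []) :
    (run ans tryAll s).q = [] ∧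
      (∀ T < c.Tm, Good ans c T → T ≤ (run ans tryAll s).reg .best) ∧
      ((∃ T < c.Tm, Good ans c T) → Good ans c ((run ans tryAll s).reg .best)) ∧
      ((run ans tryAll s).reg .best ≤ c.Tm) := by
  set s₁ := (s.set .T 0).set .best 0 with hs₁
  have hc₁ : Ready c s₁ := hc.congr (by simp [hs₁])
  have hrun : run ans tryAll s = run ans (loop .Tm (tryScale ;; add .T .T .one)) s₁ := by
    simp [tryAll, run_seq, run_const, hs₁]
  have key := loop_induction (ans := ans) (x := .Tm) (p := tryScale ;; add .T .T .one)
    (fun i s' => Ready c s' ∧ s'.reg .T = i ∧ s'.q = [] ∧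
      (∀ T < i, Good ans c T → T ≤ s'.reg .best) ∧
      ((∃ T < i, Good ans c T) → Good ans c (s'.reg .best)) ∧ s'.reg .best ≤ i) (s := s₁)
    ⟨hc₁, by simp [hs₁], by simp [hs₁, hq], by simp, by simp, by simp [hs₁]⟩
    (by
      rintro i s' - ⟨h1, h2, h3, h4, h5, h6⟩
      obtain ⟨h0, h7, h8⟩ := run_tryScale (ans := ans) h1 (hans i) h2 h3
      have hb : (run ans (tryScale ;; add .T .T .one) s').reg .best =
        (run ans tryScale s').reg .best := by
        simp [run_seq, run_add]
      rw [hb]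
      refine ⟨h1.run (by decide), ?_, ?_, ?_⟩
      · simp only [run_seq, run_add, LoopState.set_reg, if_true]
        rw [run_reg_of_writes (p := tryScale) (by decide),
          run_reg_of_writes (p := tryScale) (by decide), h2, h1.one]
      · rw [run_seq, run_q_of_quiet (by decide), h0]
      · by_cases hg : Good ans c i
        · rw [h7 hg]
          exact ⟨fun T hT _ => by omega, fun _ => hg, by omega⟩
        · rw [h8 hg]
          refine ⟨fun T hT hT' => ?_, ?_, by omega⟩
          · rcases Nat.lt_succ_iff_lt_or_eq.mp hT with h | h
            · exact h4 T h hT'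
            · exact absurd (h ▸ hT') hg
          · rintro ⟨T, hT, hT'⟩
            rcases Nat.lt_succ_iff_lt_or_eq.mp hT with h | h
            · exact h5 ⟨T, h, hT'⟩
            · exact absurd (h ▸ hT') hg)
  rw [hc₁.Tm, ← hrun] at key
  exact ⟨key.2.2.1, key.2.2.2⟩

/-- Halving the power of two in the denominator doubles the scale, as the diameter is twice a norm.
-/
theorem run_output {c : Params} {s : LoopState} (hc : Ready c s) (hq : s.q = []) :
    (run ans output s).q = natCode ((c.R + 1) ^ s.reg .best) ++ .slash ::
      natCode (2 ^ c.P / 2 * c.R ^ s.reg .best) := by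
  set s₁ := (s.set .e (s.reg .best)).set .P2 (s.reg .P2 / 2) with hs₁
  have hrun : run ans output s =
      run ans (power ;; emitNum .den ;; emit .slash ;; emitNum .num) s₁ := by
    simp [output, run_seq, run_copy, run_half, hs₁]
  obtain ⟨h1, h2⟩ := run_power (ans := ans) s₁
  have h3 : (run ans power s₁).q = [] := by
    rw [run_q_of_quiet (by decide)]
    simp [hs₁, hq]
  rw [hrun]
  simp only [run_seq, run_emitNum, run_emit, h1, h2, h3]
  simp [hs₁, hc.R1, hc.R, hc.P2]

end Algo

/-! ### Cost of the search -/

namespace Algo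

open LoopProg

variable {ans len : OraclePort → List TapeSymbol → ℕ}

theorem cost_power {s : LoopState} {U : ℕ} (h1 : s.reg .R1 ≤ U) (h2 : s.reg .R ≤ U) :
    cost ans len power s ≤ 3 + s.reg .e * (7 + 4 * U) := by
  have h := cost_loop_le (ans := ans) (len := len) (x := .e) (p := scale .num .R1 ;; scale .den .R)
    (fun s' => s'.reg .R1 ≤ U ∧ s'.reg .R ≤ U)
    (s := (s.set .num 1).set .den (s.reg .P2)) (c := 6 + 4 * U) (by simp [h1, h2])
    (by
      rintro s' ⟨h1, h2⟩
      exact ⟨by rwa [run_reg_of_writes (by decide)], by rwa [run_reg_of_writes (by decide)]⟩)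
    (by
      rintro s' ⟨h1, h2⟩
      simp only [cost, cost_scale (x := .num) (y := .R1) (by decide),
        cost_scale (x := .den) (y := .R) (by decide)]
      rw [run_reg_of_writes (by decide)]
      omega)
  simp only [power, cost, run_const, run_copy, LoopState.set_reg, Bool.toNat_true, reduceCtorEq,
    if_false] at h ⊢
  have e : 1 + (6 + 4 * U) = 7 + 4 * U := by ring
  rw [e] at h
  omega

theorem cost_down {s : LoopState} {U : ℕ} (h1 : s.reg .R1 ≤ U) (h2 : s.reg .R ≤ U)
    (h3 : s.reg .B ≤ U) (hU : 1 ≤ U) : cost ans len down s ≤ 18 * U ^ 2 := by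
  have h := cost_loop_le (ans := ans) (len := len) (x := .B)
    (p := scale .S .R1 ;; scale .V .R1 ;; scale .W .R)
    (fun s' => s'.reg .R1 ≤ U ∧ s'.reg .R ≤ U)
    (s := s.set .e (s.reg .e - s.reg .m)) (c := 9 + 6 * U) (by simp [h1, h2])
    (by
      rintro s' ⟨h1, h2⟩
      exact ⟨by rwa [run_reg_of_writes (by decide)], by rwa [run_reg_of_writes (by decide)]⟩)
    (by
      rintro s' ⟨h1, h2⟩
      simp only [cost, cost_scale (x := .S) (y := .R1) (by decide),
        cost_scale (x := .V) (y := .R1) (by decide), cost_scale (x := .W) (y := .R) (by decide)]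
      rw [run_reg_of_writes (by decide), run_reg_of_writes (by decide),
        run_reg_of_writes (by decide)]
      omega)
  simp only [LoopState.set_reg, reduceCtorEq, if_false] at h
  have h4 : s.reg .B * (1 + (9 + 6 * U)) ≤ U * (1 + (9 + 6 * U)) := Nat.mul_le_mul_right _ h3
  have h5 : cost ans len down s = 1 + cost ans len
    (loop .B (scale .S .R1 ;; scale .V .R1 ;; scale .W .R)) (s.set .e (s.reg .e - s.reg .m)) := rfl
  nlinarith

theorem cost_block {s : LoopState} {U : ℕ} (h1 : s.reg .R1 ≤ U) (h2 : s.reg .R ≤ U)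
    (h3 : s.reg .n ≤ U) (h4 : s.reg .mu ≤ U) (h5 : s.reg .e ≤ U) (hU : 1 ≤ U) :
    cost ans len block s ≤ 40 * U ^ 2 := by
  set p := copy .q .a ;; loop .mu (half .q) ;; add .q .q .one ;; sub .rest .n .a ;;
    sub .t .q .rest ;; sub .q .q .t with hp
  set s₁ := run ans p s with hs₁
  have hq : s₁.reg .q ≤ U := by
    simp [hs₁, hp, run_seq, run_copy, run_loop, run_add, run_sub, iterate_half]
    generalize s.reg .a / 2 ^ s.reg .mu = d
    omega
  have hpc : cost ans len p s = 6 + 2 * s.reg .mu := by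
    simp [hp, cost, run_copy]
    ring
  have hfr : ∀ r ∈ [Reg.R1, .R, .e], s₁.reg r = s.reg r := by
    intro r hr
    refine run_reg_of_writes ?_ s
    fin_cases hr <;> decide
  have hpow := cost_power (ans := ans) (len := len) (s := s₁) (U := U)
    (by rwa [hfr .R1 (by simp)]) (by rwa [hfr .R (by simp)])
  rw [hfr .e (by simp)] at hpow
  have hco : cost ans len (loop .q coordinate) (run ans power s₁) = 1 + s₁.reg .q * 7 := by
    simp only [cost, coordinate]
    rw [run_reg_of_writes (by decide)]
    simp
  have hb : cost ans len block s = cost ans len p s + (cost ans len power s₁ +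
      cost ans len (loop .q coordinate) (run ans power s₁)) := by
    simp only [block, hp, cost, run_seq, hs₁]
    ring
  have h6 : s.reg .e * (7 + 4 * U) ≤ U * (7 + 4 * U) := Nat.mul_le_mul_right _ h5
  rw [hb, hpc, hco]
  nlinarith

/-- Upper bound for the lengths of the loops, except for the loop over all codes. -/
structure Params.BoundedBy (c : Params) (U : ℕ) : Prop where
  n : c.n ≤ U
  mu : c.mu ≤ U
  M : 2 ^ c.mu ≤ U
  B : c.B ≤ U
  R : c.R + 1 ≤ U
  L : c.L ≤ U
  Tm : c.Tm ≤ U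

/-- The bound on `e` is passed on as an invariant, because computing a power takes `e` passes of a
loop. -/
theorem cost_walkBit {c : Params} {s : LoopState} {U : ℕ} (hc : Ready c s) (hU : c.BoundedBy U)
    (he : s.reg .e ≤ U) :
    cost ans len walkBit s ≤ 70 * U ^ 2 ∧ (run ans walkBit s).reg .e ≤ U := by
  have hU1 : 1 ≤ U := le_trans (by omega) hU.R
  have hRU : c.R ≤ U := le_trans (by omega) hU.R
  set p := copy .half .cd ;; half .half ;; sub .bit .cd .half ;; sub .bit .bit .half ;;
    copy .cd .half ;; sub .nbit .one .bit with hp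
  set s₁ := run ans p s with hs₁
  have hb : s₁.reg .bit ≤ 1 := by
    simp [hs₁, hp, run_seq, run_copy, run_half, run_sub]
    omega
  have hnb : s₁.reg .nbit ≤ 1 := by
    simp [hs₁, hp, run_seq, run_copy, run_half, run_sub, hc.one]
  have hc₁ : Ready c s₁ := hc.run (by decide)
  have he₁ : s₁.reg .e = s.reg .e := run_reg_of_writes (by decide) s
  set s₂ := run ans (loop .nbit down) s₁ with hs₂
  have hc₂ : Ready c s₂ := hc₁.run (by decide)
  have he₂ : s₂.reg .e ≤ U := by
    refine loop_induction (ans := ans) (x := .nbit) (p := down) (fun _ s' => s'.reg .e ≤ U)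
      (s := s₁) (by rwa [he₁]) ?_
    rintro i s' - h
    rw [(run_down s').1]
    omega
  have hcost : cost ans len walkBit s = 6 + (cost ans len (loop .nbit down) s₁ +
      cost ans len (loop .bit block) s₂) := by
    simp only [walkBit, hp, cost, run_seq, hs₁, hs₂]
    ring
  have hd := cost_loop_le (ans := ans) (len := len) (x := .nbit) (p := down)
    (Ready c) (s := s₁) (c := 18 * U ^ 2) hc₁ (fun s' h => h.run (by decide))
    (fun s' h => cost_down (by rw [h.R1]; exact hU.R) (by rw [h.R]; exact hRU)
      (by rw [h.B]; exact hU.B) hU1)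
  have hbl := cost_loop_le (ans := ans) (len := len) (x := .bit) (p := block)
    (fun s' => Ready c s' ∧ s'.reg .e ≤ U) (s := s₂) (c := 40 * U ^ 2) ⟨hc₂, he₂⟩
    (fun s' h => ⟨h.1.run (by decide), by rw [run_reg_of_writes (by decide)]; exact h.2⟩)
    (fun s' h => cost_block (by rw [h.1.R1]; exact hU.R) (by rw [h.1.R]; exact hRU)
      (by rw [h.1.n]; exact hU.n) (by rw [h.1.mu]; exact hU.mu) h.2 hU1)
  have hb₂ : s₂.reg .bit = s₁.reg .bit := run_reg_of_writes (by decide) s₁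
  rw [hb₂] at hbl
  have e1 : s₁.reg .nbit * (1 + 18 * U ^ 2) ≤ 1 * (1 + 18 * U ^ 2) := Nat.mul_le_mul_right _ hnb
  have e2 : s₁.reg .bit * (1 + 40 * U ^ 2) ≤ 1 * (1 + 40 * U ^ 2) := Nat.mul_le_mul_right _ hb
  have e3 : 1 ≤ U ^ 2 := Nat.one_le_pow _ _ hU1
  refine ⟨by omega, ?_⟩
  have hrun : run ans walkBit s = run ans (loop .bit block) s₂ := rfl
  rw [hrun, run_reg_of_writes (by decide)]
  exact he₂

/-- The length of the answer is part of the cost and is controlled only for questions that arise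
from codes. The effect of the walk is therefore needed here, not just its length. -/
theorem cost_ask {c : Params} {s : LoopState} {U T code : ℕ} (hc : Ready c s) (hU : c.BoundedBy U)
    (hT : s.reg .T = T) (hTU : T ≤ U) (hcode : s.reg .code = code) (hq : s.q = [])
    (hlen : len .body (question c T code) ≤ 1) : cost ans len Algo.ask s ≤ 100 * U ^ 3 := by
  have hU1 : 1 ≤ U := le_trans (by omega) hU.R
  set p := emitNum .eps ;; emit .slash ;; emitNum .one ;; const .S false ;;
    const .W true ;; const .V true ;; const .a false ;; copy .e .T ;; copy .cd .code with hp
  set s₁ := run ans p s with hs₁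
  have hc₁ : Ready c s₁ := hc.run (by decide)
  have hw₁ : Walking c T code (0, [])
      (natCode 1 ++ .slash :: natCode (2 ^ c.P * (c.n * 2 ^ c.mu))) 0 s₁ := by
    constructor <;> simp [hs₁, hp, run_seq, run_emitNum, run_emit, run_const, run_copy, hT, hcode,
      hq, weight, hc.one, hc.eps]
  obtain ⟨hc₂, hw₂⟩ := run_walk (ans := ans) hc₁ hw₁
  set s₂ := run ans (loop .L walkBit) s₁ with hs₂
  set s₃ := s₂.set .rest (s₂.reg .n - s₂.reg .a) with hs₃
  set s₄ := run ans (loop .rest (emit .comma ;; emitNum .one ;; emit .slash)) s₃ with hs₄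
  have hq₄ : s₄.q = question c T code := by
    rw [hs₄, run_loop, iterate_zeros _ _ (by simp [hs₃, hc₂.one])]
    simp [hs₃, hc₂.n, hw₂.a, hw₂.q, question]
  have hL := cost_loop_le (ans := ans) (len := len) (x := .L) (p := walkBit)
    (fun s' => Ready c s' ∧ s'.reg .e ≤ U) (s := s₁) (c := 70 * U ^ 2)
    ⟨hc₁, by rw [hw₁.e]; omega⟩
    (fun s' h => ⟨h.1.run (by decide), (cost_walkBit (ans := ans) (len := len) h.1 hU h.2).2⟩)
    (fun s' h => (cost_walkBit h.1 hU h.2).1)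
  have hz : cost ans len (loop .rest (emit .comma ;; emitNum .one ;; emit .slash)) s₃ =
      1 + (c.n - s₂.reg .a) * 4 := by
    simp [cost, hs₃, hc₂.n]
  have hcost : cost ans len Algo.ask s = 9 + (cost ans len (loop .L walkBit) s₁ + (1 +
      (cost ans len (loop .rest (emit .comma ;; emitNum .one ;; emit .slash)) s₃ +
        (1 + len .body s₄.q)))) := by
    simp only [Algo.ask, hp, cost, run_seq, hs₁, hs₂, hs₃, hs₄, run_sub]
    ring
  rw [hc₁.L] at hL
  have e1 : c.L * (1 + 70 * U ^ 2) ≤ U * (1 + 70 * U ^ 2) := Nat.mul_le_mul_right _ hU.L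
  have e2 : c.n ≤ U := hU.n
  rw [hcost, hz, hq₄]
  have e3 : U ≤ U ^ 3 := Nat.le_self_pow (by norm_num) U
  have e4 : U * (1 + 70 * U ^ 2) = U + 70 * U ^ 3 := by ring
  omega

theorem cost_judge {s : LoopState} {U : ℕ} (hM : s.reg .M ≤ U) (ha : s.reg .ans ≤ 1)
    (hU : 1 ≤ U) : cost ans len judge s ≤ 20 * U := by
  simp only [judge, cost, cost_mul (z := .t) (y := .M) (by decide),
    cost_mul (z := .u) (y := .M) (by decide), run_mul (z := .t) (x := .V) (y := .M) (by decide)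
    (by decide), run_mul (z := .u) (x := .S) (y := .M) (by decide) (by decide), run_sub,
    LoopState.set_reg, Finset.sum_const, Finset.card_range, smul_eq_mul, reduceCtorEq, if_true,
    if_false]
  omega

theorem cost_tryScale {c : Params} {s : LoopState} {U T : ℕ} (hc : Ready c s)
    (hU : c.BoundedBy U) (hT : s.reg .T = T) (hTU : T ≤ U) (hq : s.q = [])
    (hans : ∀ code, ans .body (question c T code) ≤ 1)
    (hlen : ∀ code, len .body (question c T code) ≤ 1) :
    cost ans len tryScale s ≤ 2 + c.Z * (125 * U ^ 3) := by
  have hU1 : 1 ≤ U := le_trans (by omega) hU.R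
  have e3 : U ≤ U ^ 3 := Nat.le_self_pow (by norm_num) U
  have h := cost_loop_le (ans := ans) (len := len) (x := .Z)
    (p := Algo.ask ;; judge ;; add .code .code .one)
    (fun s' => Ready c s' ∧ s'.reg .T = T ∧ s'.q = []) (s := s.set .code 0) (c := 124 * U ^ 3)
    ⟨hc.congr (by simp), by simp [hT], by simp [hq]⟩
    (by
      rintro s' ⟨h1, h2, h3⟩
      refine ⟨h1.run (by decide), by rw [run_reg_of_writes (by decide), h2], ?_⟩
      rw [run_seq, run_q_of_quiet (by decide)]
      exact (run_ask_spec h1 h2 rfl h3).1)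
    (by
      rintro s' ⟨h1, h2, h3⟩
      have c1 := cost_ask (ans := ans) (len := len) h1 hU h2 hTU rfl h3 (hlen _)
      have c2 := cost_judge (ans := ans) (len := len) (s := run ans Algo.ask s') (U := U)
        (by rw [run_reg_of_writes (by decide), h1.M]; exact hU.M)
        (by rw [(run_ask_spec h1 h2 rfl h3).2.1]; exact hans _) hU1
      simp only [cost]
      omega)
  have hcost : cost ans len tryScale s = 1 + cost ans len
    (loop .Z (Algo.ask ;; judge ;; add .code .code .one)) (s.set .code 0) := rfl
  simp only [LoopState.set_reg, reduceCtorEq, if_false, hc.Z] at h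
  have e4 : c.Z * (1 + 124 * U ^ 3) ≤ c.Z * (125 * U ^ 3) := Nat.mul_le_mul_left _ (by omega)
  omega

/-- The number `Z` of codes, which alone is not polynomial, enters linearly; the remaining loops
contribute powers of `U`. -/
theorem cost_tryAll {c : Params} {s : LoopState} {U : ℕ} (hc : Ready c s)
    (hU : c.BoundedBy U) (hZ : 1 ≤ c.Z) (hq : s.q = [])
    (hans : ∀ T code, ans .body (question c T code) ≤ 1)
    (hlen : ∀ T code, len .body (question c T code) ≤ 1) :
    cost ans len tryAll s ≤ 150 * U ^ 4 * c.Z := by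
  have hU1 : 1 ≤ U := le_trans (by omega) hU.R
  have key : ∀ i s', i < c.Tm → Ready c s' → s'.reg .T = i → s'.q = [] →
      cost ans len (tryScale ;; add .T .T .one) s' ≤ 3 + c.Z * (125 * U ^ 3) := by
    intro i s' hi h1 h2 h3
    have := cost_tryScale (ans := ans) (len := len) h1 hU h2 (hi.le.trans hU.Tm) h3 (hans i)
      (hlen i)
    simp only [cost]
    omega
  set s₁ := (s.set .T 0).set .best 0 with hs₁
  have hc₁ : Ready c s₁ := hc.congr (by simp [hs₁])
  have hI : ∀ i, Ready c ((run ans (tryScale ;; add .T .T .one))^[i] s₁) ∧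
      ((run ans (tryScale ;; add .T .T .one))^[i] s₁).reg .T = i ∧
      ((run ans (tryScale ;; add .T .T .one))^[i] s₁).q = [] := by
    intro i
    induction i with
    | zero => exact ⟨hc₁, by simp [hs₁], by simp [hs₁, hq]⟩
    | succ i ih =>
      obtain ⟨h1, h2, h3⟩ := ih
      rw [Function.iterate_succ_apply']
      set s' := (run ans (tryScale ;; add .T .T .one))^[i] s₁
      refine ⟨h1.run (by decide), ?_, ?_⟩
      · simp only [run_seq, run_add, LoopState.set_reg, if_true]
        rw [run_reg_of_writes (p := tryScale) (by decide),
          run_reg_of_writes (p := tryScale) (by decide), h2, h1.one]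
      · rw [run_seq, run_q_of_quiet (by decide)]
        exact (run_tryScale h1 (hans i) h2 h3).1
  have hcost : cost ans len tryAll s = 2 + (1 + ∑ i ∈ Finset.range (s₁.reg .Tm),
      (1 + cost ans len (tryScale ;; add .T .T .one)
        ((run ans (tryScale ;; add .T .T .one))^[i] s₁))) := by
    simp only [tryAll, cost, run_const, Bool.toNat_false, hs₁]
    ring
  have hsum : ∑ i ∈ Finset.range (s₁.reg .Tm), (1 + cost ans len (tryScale ;; add .T .T .one)
        ((run ans (tryScale ;; add .T .T .one))^[i] s₁)) ≤
      ∑ _i ∈ Finset.range (s₁.reg .Tm), (4 + c.Z * (125 * U ^ 3)) := by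
    refine Finset.sum_le_sum fun i hi => ?_
    rw [hc₁.Tm, Finset.mem_range] at hi
    have := key i _ hi (hI i).1 (hI i).2.1 (hI i).2.2
    omega
  rw [hc₁.Tm] at hcost hsum
  rw [Finset.sum_const, Finset.card_range, smul_eq_mul] at hsum
  have e1 : c.Tm * (4 + c.Z * (125 * U ^ 3)) ≤ U * (4 + c.Z * (125 * U ^ 3)) :=
    Nat.mul_le_mul_right _ hU.Tm
  have e2 : U ≤ U ^ 4 := Nat.le_self_pow (by norm_num) U
  have e3 : U * (4 + c.Z * (125 * U ^ 3)) = 4 * U + 125 * (U ^ 4 * c.Z) := by ring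
  have e4 : U ^ 4 ≤ U ^ 4 * c.Z := Nat.le_mul_of_pos_right _ hZ
  have e5 : 150 * U ^ 4 * c.Z = 150 * (U ^ 4 * c.Z) := by ring
  omega

theorem cost_output {c : Params} {s : LoopState} {U : ℕ} (hc : Ready c s)
    (hU : c.BoundedBy U) (hb : s.reg .best ≤ U) : cost ans len output s ≤ 20 * U ^ 2 := by
  have hU1 : 1 ≤ U := le_trans (by omega) hU.R
  have hRU : c.R ≤ U := le_trans (by omega) hU.R
  have h := cost_power (ans := ans) (len := len) (s := (s.set .e (s.reg .best)).set .P2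
    (s.reg .P2 / 2)) (U := U) (by simpa [hc.R1] using hU.R) (by simpa [hc.R] using hRU)
  have hcost : cost ans len output s = 5 + cost ans len power ((s.set .e (s.reg .best)).set .P2
    (s.reg .P2 / 2)) := by
    simp only [output, cost, run_copy, run_half, LoopState.set_reg, reduceCtorEq, if_false]
    ring
  simp only [LoopState.set_reg, reduceCtorEq, if_true, if_false] at h
  have e1 : s.reg .best * (7 + 4 * U) ≤ U * (7 + 4 * U) := Nat.mul_le_mul_right _ hb
  rw [hcost]
  nlinarith

end Algo

/-! ### The choice of the parameters -/

namespace Algo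

open LoopProg

variable {ans len : OraclePort → List TapeSymbol → ℕ}

/-- The bound for the logarithms of the norms of the basis vectors. -/
def heightBound (ans : OraclePort → List TapeSymbol → ℕ) (n : ℕ) : ℕ := n ^ (ans .degree [] + 1)

/-- The parameters that the algorithm chooses in dimension `n`, if `k` binary digits of the accuracy
suffice. -/
def params (ans : OraclePort → List TapeSymbol → ℕ) (n k : ℕ) : Params where
  n := n
  -- This makes `M = 2 ^ (k + 2)`. The search for `k` ends with `3 ≤ 2 ^ k * δ ≤ 8`, so `M * δ` lies
  -- between 12 and 32.
  mu := k + 2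
  -- As `B / R = 1 / M`, the ratio of consecutive weights is about `1 - 1 / M`. The extra factors `n
  -- * M` in `R` keep `3 * M * G / R ≤ 3 / M` for all `G ≤ n * M`.
  B := n * 2 ^ (k + 2) * 2 ^ (k + 2)
  R := n * 2 ^ (k + 2) * 2 ^ (k + 2) * 2 ^ (k + 2)
  -- The precision `B` puts `B / p` within 1 before rounding; subtracting 1 ensures that `m` does
  -- not exceed `B / p`.
  m := ans .exponent (unaryCode (n * 2 ^ (k + 2) * 2 ^ (k + 2))) *
    (n * 2 ^ (k + 2) * 2 ^ (k + 2)) / 2 ^ (n * 2 ^ (k + 2) * 2 ^ (k + 2)) - 1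
  -- The terms of `P` provide for the smallest possible norm, for the offset of the exponents that
  -- avoids truncation, and for a constant factor 16.
  P := 2 * heightBound ans n + 2 * (n * 2 ^ (k + 2)) + 4
  Z := (2 * (n * 2 ^ (k + 2))) ^ (4 * 2 ^ (k + 2))
  L := 4 * 2 ^ (k + 2) * (n * 2 ^ (k + 2))
  -- Here `R` is multiplied by an exponent: `base ^ R ≥ 2`, so the scales reach beyond the largest
  -- possible norm, which is at most `n * 2 ^ (2 * H)`.
  Tm := n * 2 ^ (k + 2) * 2 ^ (k + 2) * 2 ^ (k + 2) *
    (2 * heightBound ans n + 2 * (n * 2 ^ (k + 2)) + 4 + n + 2 * heightBound ans n + 1)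

theorem run_setupBounds {s : LoopState} {n k : ℕ} (hn : s.reg .n = n) (hk : s.reg .mu = k)
    (hq : s.q = []) :
    let s' := run ans setupBounds s
    s'.q = [] ∧ s'.reg .n = n ∧ s'.reg .mu = k + 2 ∧ s'.reg .one = 1 ∧
      s'.reg .M = 2 ^ (k + 2) ∧ s'.reg .H = heightBound ans n := by
  set p := const .one true ;; add .mu .mu .one ;; add .mu .mu .one ;; const .M true ;;
    loop .mu (add .M .M .M) ;; LoopProg.ask .degree .D ;; add .D .D .one ;; const .H true with hp
  set s₁ := run ans p s with hs₁
  have hrun : run ans setupBounds s = (run ans (scale .H .n))^[s₁.reg .D] s₁ := rfl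
  have hmu : s₁.reg .mu = k + 2 := by
    simp [hs₁, hp, run_seq, run_const, run_add, run_loop, iterate_double, run_ask, hk]
  have hone : s₁.reg .one = 1 := by
    simp [hs₁, hp, run_seq, run_const, run_add, run_loop, iterate_double, run_ask]
  have hM : s₁.reg .M = 2 ^ (k + 2) := by
    simp [hs₁, hp, run_seq, run_const, run_add, run_loop, iterate_double, run_ask, hk]
  have hD : s₁.reg .D = ans .degree [] + 1 := by
    simp [hs₁, hp, run_seq, run_const, run_add, run_loop, iterate_double, run_ask, hq]
  have hH : s₁.reg .H = 1 := by
    simp [hs₁, hp, run_seq, run_const]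
  have hn₁ : s₁.reg .n = n := by rw [hs₁, run_reg_of_writes (by decide), hn]
  have hq₁ : s₁.q = [] := by
    simp [hs₁, hp, run_seq, run_const, run_add, run_ask]
  intro s'
  have hs' : s' = run ans (loop .D (scale .H .n)) s₁ := rfl
  refine ⟨?_, ?_, ?_, ?_, ?_, ?_⟩
  · rw [hs', run_q_of_quiet (by decide), hq₁]
  · rw [hs', run_reg_of_writes (by decide), hn₁]
  · rw [hs', run_reg_of_writes (by decide), hmu]
  · rw [hs', run_reg_of_writes (by decide), hone]
  · rw [hs', run_reg_of_writes (by decide), hM]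
  · rw [hs', run_loop, iterate_scale (by decide) (by decide) (by decide), hH, hn₁, hD, one_mul]
    rfl

theorem run_setupBase {s : LoopState} {n M : ℕ} (hn : s.reg .n = n) (hM : s.reg .M = M)
    (h1 : s.reg .one = 1) (hq : s.q = []) :
    let s' := run ans setupBase s
    s'.q = [] ∧ s'.reg .nM = n * M ∧ s'.reg .B = n * M * M ∧ s'.reg .R = n * M * M * M ∧
      s'.reg .R1 = n * M * M * M + 1 ∧
      s'.reg .m = ans .exponent (unaryCode (n * M * M)) * (n * M * M) / 2 ^ (n * M * M) - 1 := by
  intro s'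
  have hB : n * M * M = s.reg .n * s.reg .M * s.reg .M := by rw [hn, hM]
  rw [hB]
  refine ⟨?_, ?_, ?_, ?_, ?_, ?_⟩ <;>
    simp [s', setupBase, run_seq, run_mul, run_add, run_loop, iterate_emit, run_ask, iterate_half,
      run_sub, hq, h1, hn, hM, unaryCode]

theorem run_setupLoops {s : LoopState} {n M H R : ℕ} (hn : s.reg .n = n) (hM : s.reg .M = M)
    (h1 : s.reg .one = 1) (hnM : s.reg .nM = n * M) (hH : s.reg .H = H) (hR : s.reg .R = R) :
    let s' := run ans setupLoops s
    s'.reg .P2 = 2 ^ (2 * H + 2 * (n * M) + 4) ∧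
      s'.reg .eps = 2 ^ (2 * H + 2 * (n * M) + 4) * (n * M) ∧
      s'.reg .L = 4 * M * (n * M) ∧ s'.reg .Z = (2 * (n * M)) ^ (4 * M) ∧
      s'.reg .Tm = R * (2 * H + 2 * (n * M) + 4 + n + 2 * H + 1) := by
  set p := add .u .nM .nM ;; add .P .H .H ;; copy .Tm .P ;; add .P .P .u ;; add .P .P .one ;;
    add .P .P .one ;; add .P .P .one ;; add .P .P .one ;; const .P2 true ;;
    loop .P (add .P2 .P2 .P2) ;; mul .eps .P2 .nM ;; add .a .M .M ;; add .a .a .a ;;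
    mul .L .a .nM ;; const .Z true with hp
  set s₁ := run ans p s with hs₁
  have hPe : H + H + (n * M + n * M) + 1 + 1 + 1 + 1 = 2 * H + 2 * (n * M) + 4 := by ring
  have fP : s₁.reg .P = 2 * H + 2 * (n * M) + 4 := by
    simp [hs₁, hp, run_seq, run_const, run_add, run_loop, iterate_double, run_mul, run_copy, hnM,
      hH, h1, hPe]
  have fP2 : s₁.reg .P2 = 2 ^ (2 * H + 2 * (n * M) + 4) := by
    simp [hs₁, hp, run_seq, run_const, run_add, run_loop, iterate_double, run_mul, run_copy, hnM,
      hH, h1, hPe]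
  have feps : s₁.reg .eps = 2 ^ (2 * H + 2 * (n * M) + 4) * (n * M) := by
    simp [hs₁, hp, run_seq, run_const, run_add, run_loop, iterate_double, run_mul, run_copy, hnM,
      hH, h1, hPe]
  have fTm : s₁.reg .Tm = 2 * H := by
    simp [hs₁, hp, run_seq, run_const, run_add, run_loop, iterate_double, run_mul, run_copy, hH]
    ring
  have fa : s₁.reg .a = 4 * M := by
    simp [hs₁, hp, run_seq, run_const, run_add, run_loop, iterate_double, run_mul, run_copy, hM]
    ring
  have fL : s₁.reg .L = 4 * M * (n * M) := by
    simp [hs₁, hp, run_seq, run_const, run_add, run_loop, iterate_double, run_mul, run_copy, hM,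
      hnM]
    left; ring
  have fu : s₁.reg .u = 2 * (n * M) := by
    simp [hs₁, hp, run_seq, run_const, run_add, run_loop, iterate_double, run_mul, run_copy, hnM]
    ring
  have fZ : s₁.reg .Z = 1 := by simp [hs₁, hp, run_seq, run_const]
  have fn : s₁.reg .n = n := by rw [hs₁, run_reg_of_writes (by decide), hn]
  have fR : s₁.reg .R = R := by rw [hs₁, run_reg_of_writes (by decide), hR]
  have f1 : s₁.reg .one = 1 := by rw [hs₁, run_reg_of_writes (by decide), h1]
  set s₂ := run ans (loop .a (scale .Z .u)) s₁ with hs₂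
  have gZ : s₂.reg .Z = (2 * (n * M)) ^ (4 * M) := by
    rw [hs₂, run_loop, iterate_scale (by decide) (by decide) (by decide), fZ, fu, fa, one_mul]
  have hfr : ∀ r ∈ [Reg.P, .P2, .eps, .Tm, .L, .n, .R, .one], s₂.reg r = s₁.reg r := by
    intro r hr
    refine run_reg_of_writes ?_ s₁
    fin_cases hr <;> decide
  intro s'
  have hs' : s' = run ans (add .e .P .n ;; add .e .e .Tm ;; add .e .e .one ;; mul .Tm .R .e) s₂ :=
    rfl
  refine ⟨?_, ?_, ?_, ?_, ?_⟩
  · rw [hs', run_reg_of_writes (by decide), hfr .P2 (by simp), fP2]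
  · rw [hs', run_reg_of_writes (by decide), hfr .eps (by simp), feps]
  · rw [hs', run_reg_of_writes (by decide), hfr .L (by simp), fL]
  · rw [hs', run_reg_of_writes (by decide), gZ]
  · simp [hs', run_seq, run_add, run_mul, hfr, fP, fn, fTm, f1, fR]

/-- The first part of the algorithm: the choice of the parameters. -/
def setup : LoopProg := setupBounds ;; setupBase ;; setupLoops

theorem run_setup {s : LoopState} {n k : ℕ} (hn : s.reg .n = n) (hk : s.reg .mu = k)
    (hq : s.q = []) :
    (run ans setup s).q = [] ∧ Ready (params ans n k) (run ans setup s) := by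
  rw [setup, run_seq, run_seq]
  obtain ⟨q1, n1, mu1, one1, M1, H1⟩ := run_setupBounds (ans := ans) hn hk hq
  generalize run ans setupBounds s = s₁ at q1 n1 mu1 one1 M1 H1 ⊢
  obtain ⟨q2, nM2, B2, R2, R12, m2⟩ := run_setupBase (ans := ans) n1 M1 one1 q1
  have hfr : ∀ r, writes setupBase r = false → (run ans setupBase s₁).reg r = s₁.reg r :=
    fun r hr => run_reg_of_writes hr s₁
  generalize run ans setupBase s₁ = s₂ at q2 nM2 B2 R2 R12 m2 hfr ⊢
  rw [← hfr _ (by decide)] at n1 mu1 one1 M1 H1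
  obtain ⟨P3, e3, L3, Z3, T3⟩ := run_setupLoops (ans := ans) n1 M1 one1 nM2 H1 R2
  have hfr₃ : ∀ r, writes setupLoops r = false → (run ans setupLoops s₂).reg r = s₂.reg r :=
    fun r hr => run_reg_of_writes hr s₂
  have hq₃ : (run ans setupLoops s₂).q = s₂.q := run_q_of_quiet (by decide) s₂
  generalize run ans setupLoops s₂ = s₃ at P3 e3 L3 Z3 T3 hfr₃ hq₃ ⊢
  rw [← hfr₃ _ (by decide)] at n1 mu1 one1 M1 B2 R2 R12 m2
  refine ⟨hq₃.trans q2, ?_⟩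
  constructor <;> (try simp only [params]) <;> assumption

theorem cost_setupBounds {s : LoopState} {n k U : ℕ} (hn : s.reg .n = n) (hk : s.reg .mu = k)
    (hq : s.q = []) (hnU : n ≤ U) (hkU : k + 2 ≤ U) (hlen : len .degree [] ≤ U)
    (hD : ans .degree [] + 1 ≤ U) : cost ans len setupBounds s ≤ 20 * U ^ 2 := by
  set p := const .one true ;; add .mu .mu .one ;; add .mu .mu .one ;; const .M true ;;
    loop .mu (add .M .M .M) ;; LoopProg.ask .degree .D ;; add .D .D .one ;; const .H true with hp
  set s₁ := run ans p s with hs₁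
  have hD₁ : s₁.reg .D = ans .degree [] + 1 := by
    simp [hs₁, hp, run_seq, run_const, run_add, run_loop, iterate_double, run_ask, hq]
  have hn₁ : s₁.reg .n = n := by rw [hs₁, run_reg_of_writes (by decide), hn]
  have hcost : cost ans len setupBounds s = cost ans len p s +
      cost ans len (loop .D (scale .H .n)) s₁ := by
    simp only [setupBounds, hs₁, hp, cost, run_seq]
    ring
  have h := cost_loop_le (ans := ans) (len := len) (x := .D) (p := scale .H .n)
    (fun s' => s'.reg .n ≤ U) (s := s₁) (c := 3 + 2 * U) (by rw [hn₁]; exact hnU)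
    (by intro s' h; rwa [run_reg_of_writes (by decide)])
    (by intro s' h; rw [cost_scale (by decide)]; omega)
  have hp₁ : cost ans len p s = 7 + (1 + (k + 2) * 2) + len .degree [] := by
    simp only [hp, cost, run_const, run_add, run_loop, iterate_double]
    simp [hk, hq]
    ring
  rw [hD₁] at h
  have e1 : (ans .degree [] + 1) * (1 + (3 + 2 * U)) ≤ U * (1 + (3 + 2 * U)) :=
    Nat.mul_le_mul_right _ hD
  nlinarith

theorem cost_setupBase {s : LoopState} {n M U : ℕ} (hn : s.reg .n = n) (hM : s.reg .M = M)
    (hq : s.q = []) (hMU : M ≤ U) (hBU : n * M * M ≤ U) (hU : 1 ≤ U)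
    (hlen : len .exponent (unaryCode (n * M * M)) ≤ U) :
    cost ans len setupBase s ≤ 40 * U := by
  have : cost ans len setupBase s = 13 + 6 * M + 6 * (n * M * M) +
      len .exponent (unaryCode (n * M * M)) := by
    simp only [setupBase, cost, run_loop, iterate_emit, run_add]
    rw [cost_mul (by decide), cost_mul (by decide), cost_mul (by decide), cost_mul (by decide)]
    simp [run_mul, run_ask, hn, hM, hq, unaryCode]
    ring
  omega

theorem cost_setupLoops {s : LoopState} {n M H U : ℕ} (hn : s.reg .n = n) (hM : s.reg .M = M)
    (h1 : s.reg .one = 1) (hnM : s.reg .nM = n * M) (hH : s.reg .H = H) (hMU : 4 * M ≤ U)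
    (hnMU : 2 * (n * M) ≤ U) (hPU : 2 * H + 2 * (n * M) + 4 + n + 2 * H + 1 ≤ U) :
    cost ans len setupLoops s ≤ 60 * U ^ 2 := by
  set p := add .u .nM .nM ;; add .P .H .H ;; copy .Tm .P ;; add .P .P .u ;; add .P .P .one ;;
    add .P .P .one ;; add .P .P .one ;; add .P .P .one ;; const .P2 true ;;
    loop .P (add .P2 .P2 .P2) ;; mul .eps .P2 .nM ;; add .a .M .M ;; add .a .a .a ;;
    mul .L .a .nM ;; const .Z true with hp
  set s₁ := run ans p s with hs₁
  have hPe : H + H + (n * M + n * M) + 1 + 1 + 1 + 1 = 2 * H + 2 * (n * M) + 4 := by ring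
  have fP : s₁.reg .P = 2 * H + 2 * (n * M) + 4 := by
    simp [hs₁, hp, run_seq, run_const, run_add, run_loop, iterate_double, run_mul, run_copy, hnM,
      hH, h1, hPe]
  have fTm : s₁.reg .Tm = 2 * H := by
    simp [hs₁, hp, run_seq, run_const, run_add, run_loop, iterate_double, run_mul, run_copy, hH]
    ring
  have fa : s₁.reg .a = 4 * M := by
    simp [hs₁, hp, run_seq, run_const, run_add, run_loop, iterate_double, run_mul, run_copy, hM]
    ring
  have fu : s₁.reg .u = 2 * (n * M) := by
    simp [hs₁, hp, run_seq, run_const, run_add, run_loop, iterate_double, run_mul, run_copy, hnM]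
    ring
  have fn : s₁.reg .n = n := by rw [hs₁, run_reg_of_writes (by decide), hn]
  have f1 : s₁.reg .one = 1 := by rw [hs₁, run_reg_of_writes (by decide), h1]
  have hcp : cost ans len p s = 17 + 2 * (2 * H + 2 * (n * M) + 4) + 4 * (n * M) := by
    simp only [hp, cost, run_loop, iterate_double]
    rw [cost_mul (by decide), cost_mul (by decide)]
    simp [run_add, run_copy, run_const, run_mul, hnM, hH, h1]
    ring
  have h := cost_loop_le (ans := ans) (len := len) (x := .a) (p := scale .Z .u)
    (fun s' => s'.reg .u ≤ U) (s := s₁) (c := 3 + 2 * U) (by rw [fu]; exact hnMU)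
    (by intro s' h; rwa [run_reg_of_writes (by decide)])
    (by intro s' h; rw [cost_scale (by decide)]; omega)
  set s₂ := run ans (loop .a (scale .Z .u)) s₁ with hs₂
  have gP : s₂.reg .P = s₁.reg .P := run_reg_of_writes (by decide) s₁
  have gT : s₂.reg .Tm = s₁.reg .Tm := run_reg_of_writes (by decide) s₁
  have gn : s₂.reg .n = s₁.reg .n := run_reg_of_writes (by decide) s₁
  have g1 : s₂.reg .one = s₁.reg .one := run_reg_of_writes (by decide) s₁
  have hcr : cost ans len (add .e .P .n ;; add .e .e .Tm ;; add .e .e .one ;; mul .Tm .R .e) s₂ =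
      5 + 2 * (2 * H + 2 * (n * M) + 4 + n + 2 * H + 1) := by
    simp only [cost]
    rw [cost_mul (by decide)]
    simp [run_add, gP, gT, gn, g1, fP, fTm, fn, f1]
    ring
  have hcost : cost ans len setupLoops s = cost ans len p s +
      (cost ans len (loop .a (scale .Z .u)) s₁ +
        cost ans len (add .e .P .n ;; add .e .e .Tm ;; add .e .e .one ;; mul .Tm .R .e) s₂) := by
    simp only [setupLoops, hs₂, hs₁, hp, cost, run_seq]
    ring
  rw [fa] at h
  have e1 : 4 * M * (1 + (3 + 2 * U)) ≤ U * (1 + (3 + 2 * U)) := Nat.mul_le_mul_right _ hMU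
  nlinarith

theorem cost_setup {s : LoopState} {n k U : ℕ} (hn : s.reg .n = n) (hk : s.reg .mu = k)
    (hq : s.q = []) (hn2 : 1 ≤ n) (hlen : len .degree [] ≤ U) (hD : ans .degree [] + 1 ≤ U)
    (hlen' : len .exponent (unaryCode (n * 2 ^ (k + 2) * 2 ^ (k + 2))) ≤ U)
    (hB : n * 2 ^ (k + 2) * 2 ^ (k + 2) ≤ U)
    (hP : 2 * heightBound ans n + 2 * (n * 2 ^ (k + 2)) + 4 + n + 2 * heightBound ans n + 1 ≤ U) :
    cost ans len setup s ≤ 120 * U ^ 2 := by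
  obtain ⟨q1, n1, mu1, one1, M1, H1⟩ := run_setupBounds (ans := ans) hn hk hq
  have hM1 : 4 ≤ 2 ^ (k + 2) := by rw [pow_add]; have := Nat.one_le_two_pow (n := k); omega
  have hM2 : k + 2 ≤ 2 ^ (k + 2) := Nat.lt_two_pow_self.le
  generalize hM : 2 ^ (k + 2) = M at *
  have hnM : M ≤ n * M := Nat.le_mul_of_pos_left _ hn2
  have hMM : 4 * M ≤ n * M * M := Nat.mul_le_mul_right M (hM1.trans hnM)
  have hU : 1 ≤ U := by omega
  have c1 := cost_setupBounds (ans := ans) (len := len) hn hk hq (U := U) (by omega) (by omega)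
    hlen hD
  have c2 := cost_setupBase (ans := ans) (len := len) n1 M1 q1 (U := U) (by omega) hB hU hlen'
  obtain ⟨q2, nM2, B2, R2, R12, m2⟩ := run_setupBase (ans := ans) n1 M1 one1 q1
  have hcost : cost ans len setup s = cost ans len setupBounds s +
      (cost ans len setupBase (run ans setupBounds s) +
        cost ans len setupLoops (run ans setupBase (run ans setupBounds s))) := rfl
  generalize run ans setupBounds s = s₁ at *
  have hfr : ∀ r, writes setupBase r = false → (run ans setupBase s₁).reg r = s₁.reg r :=
    fun r hr => run_reg_of_writes hr s₁
  generalize run ans setupBase s₁ = s₂ at *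
  rw [← hfr _ (by decide)] at n1 M1 one1 H1
  have c3 := cost_setupLoops (ans := ans) (len := len) n1 M1 one1 nM2 H1 (U := U) (by omega)
    (by omega) hP
  nlinarith

end Algo

/-! ### The bounded program as a whole -/

namespace Algo

open LoopProg

variable {ans len : OraclePort → List TapeSymbol → ℕ}

theorem four_le_two_pow_add_two (k : ℕ) : 4 ≤ 2 ^ (k + 2) := by
  rw [pow_add]; have := Nat.one_le_two_pow (n := k); omega

/-- This lets the single number `Tm` serve as the bound `U` in all cost estimates. -/
theorem params_boundedBy {n : ℕ} (hn : 2 ≤ n) (k : ℕ) :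
    (params ans n k).BoundedBy (params ans n k).Tm ∧
      2 * heightBound ans n + 2 * (n * 2 ^ (k + 2)) + 4 + n + 2 * heightBound ans n + 1 ≤
        (params ans n k).Tm ∧ (params ans n k).B + 2 ≤ (params ans n k).Tm ∧
      ans .degree [] + 1 ≤ (params ans n k).Tm := by
  have hM := four_le_two_pow_add_two k
  have hmu : k + 2 ≤ 2 ^ (k + 2) := Nat.lt_two_pow_self.le
  have hD : ans .degree [] + 1 ≤ heightBound ans n :=
    (Nat.lt_two_pow_self.le).trans (Nat.pow_le_pow_left hn _)
  simp only [params]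
  generalize hMe : 2 ^ (k + 2) = M at *
  generalize heightBound ans n = H at *
  have h1 : M ≤ n * M := Nat.le_mul_of_pos_left _ (by omega)
  have h1' : n ≤ n * M := Nat.le_mul_of_pos_right _ (by omega)
  have h2 : n * M ≤ n * M * M := Nat.le_mul_of_pos_right _ (by omega)
  have h3 : n * M * M ≤ n * M * M * M := Nat.le_mul_of_pos_right _ (by omega)
  have h4 : 4 * M * (n * M) = 4 * (n * M * M) := by ring
  have h5 : n * M * M * 4 ≤ n * M * M * M := Nat.mul_le_mul_left _ hM
  generalize n * M * M * M = R at *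
  set K := 2 * H + 2 * (n * M) + 4 + n + 2 * H + 1 with hK
  have h6 : K ≤ R * K := Nat.le_mul_of_pos_left _ (by omega)
  have h7 : R * 5 ≤ R * K := Nat.mul_le_mul_left _ (by omega)
  generalize R * K = U at *
  refine ⟨⟨?_, ?_, ?_, ?_, ?_, ?_, ?_⟩, ?_, ?_, ?_⟩ <;> (try simp only [hMe]) <;> omega

theorem main_spec {s : LoopState} {n k : ℕ} (hn2 : 2 ≤ n) (hn : s.reg .n = n) (hk : s.reg .mu = k)
    (hq : s.q = []) (hans : ∀ T code, ans .body (question (params ans n k) T code) ≤ 1)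
    (hlen : ∀ T code, len .body (question (params ans n k) T code) ≤ 1)
    (hlenD : len .degree [] ≤ ans .degree [] + 1)
    (hlenE : len .exponent (unaryCode (params ans n k).B) ≤ (params ans n k).B + 2) :
    ∃ best, (run ans main s).q = natCode (((params ans n k).R + 1) ^ best) ++ .slash ::
        natCode (2 ^ (params ans n k).P / 2 * (params ans n k).R ^ best) ∧
      (∀ T < (params ans n k).Tm, Good ans (params ans n k) T → T ≤ best) ∧
      ((∃ T < (params ans n k).Tm, Good ans (params ans n k) T) →
        Good ans (params ans n k) best) ∧
      cost ans len main s ≤ 290 * (params ans n k).Tm ^ 4 * (params ans n k).Z := by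
  obtain ⟨hU, hP, hB, hD⟩ := params_boundedBy (ans := ans) hn2 k
  have hc1 : cost ans len setup s ≤ 120 * (params ans n k).Tm ^ 2 := by
    have hU3 := hU.B
    have hE := hlenE.trans hB
    have eB : (params ans n k).B = n * 2 ^ (k + 2) * 2 ^ (k + 2) := by simp only [params]
    generalize (params ans n k).Tm = U at *
    rw [eB] at hU3 hE
    exact cost_setup hn hk hq (by omega) (hlenD.trans hD) hD hE hU3 hP
  obtain ⟨hq1, hR⟩ := run_setup (ans := ans) hn hk hq
  have hrun : run ans main s = run ans output (run ans tryAll (run ans setup s)) := by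
    simp only [main, setup, run_seq]
  have hcost : cost ans len main s = cost ans len setup s + (cost ans len tryAll (run ans setup s)
      + cost ans len output (run ans tryAll (run ans setup s))) := by
    simp only [main, setup, cost, run_seq]
    ring
  have hZ : 1 ≤ (params ans n k).Z := by
    simp only [params]
    exact Nat.one_le_pow _ _ (Nat.mul_pos (by norm_num) (Nat.mul_pos (by omega) (by positivity)))
  generalize run ans setup s = s₁ at *
  generalize params ans n k = c at *
  have hc2 := cost_tryAll (ans := ans) (len := len) hR hU hZ hq1 hans hlen
  obtain ⟨hq2, h1, h2, h3⟩ := run_tryAll (ans := ans) hR hans hq1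
  have hR2 : Ready c (run ans tryAll s₁) := hR.run (by decide)
  have hc3 := cost_output (ans := ans) (len := len) hR2 hU h3
  refine ⟨_, by rw [hrun]; exact run_output hR2 hq2, h1, h2, ?_⟩
  have e1 : c.Tm ^ 2 ≤ c.Tm ^ 4 := Nat.pow_le_pow_right (le_trans (by omega) hU.R) (by norm_num)
  have e2 : c.Tm ^ 4 ≤ c.Tm ^ 4 * c.Z := Nat.le_mul_of_pos_right _ hZ
  rw [hcost]
  nlinarith

/-! ### The search for the accuracy -/

theorem run_probe {s : LoopState} {j : ℕ} (hmu : s.reg .mu = j) (hq : s.q = []) :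
    (run ans probe s).q = [] ∧ (run ans probe s).reg .mu = j + 1 ∧
      (run ans probe s).reg .n = s.reg .n ∧
      (run ans probe s).reg .flag = ans .accuracy (unaryCode (j + 1)) - 3 ∧
      cost ans len probe s = 7 + 2 * (j + 1) + len .accuracy (unaryCode (j + 1)) := by
  refine ⟨?_, ?_, ?_, ?_, ?_⟩
  · simp [probe, run_seq, run_const, run_add, run_loop, iterate_emit, run_ask, run_sub]
  · simp [probe, run_seq, run_const, run_add, run_loop, iterate_emit, run_ask, run_sub, hmu]
  · rw [run_reg_of_writes (by decide)]
  · simp [probe, run_seq, run_const, run_add, run_loop, iterate_emit, run_ask, run_sub, hmu, hq,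
      unaryCode, Nat.sub_sub]
  · simp only [probe, run_const, run_add, run_loop, iterate_emit, cost]
    simp [hmu, hq, unaryCode]
    ring

variable {N : ℕ} {Ω : OraclePort → List TapeSymbol → List TapeSymbol}
  {askC : OraclePort → StackCmd Stk (Mem N)}

open StackCmd

/-- Ask for one more digit of the accuracy, and test whether there are enough. -/
def probeStep (askC : OraclePort → StackCmd Stk (Mem N)) : StackCmd Stk (Mem N) :=
  .seq (compile askC 0 probe) (.dec (.reg .flag))

/-- The whole algorithm. -/
def program (askC : OraclePort → StackCmd Stk (Mem N)) : StackCmd Stk (Mem N) :=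
  .seq (.whileDo (fun v => v.c) (probeStep askC)) (compile askC 0 main)

/-- The carry bit left by the last decrement is the loop test: `flag` holds the answer minus 3,
truncated, and is zero exactly when the answer is at most 3. -/
theorem runs_probeStep (hA : Answers Ω askC ans len) {s : LoopState} {j C : ℕ}
    (hmu : s.reg .mu = j) (hq : s.q = [])
    (hC : 8 + 2 * (j + 1) + len .accuracy (unaryCode (j + 1)) ≤ C) (v : Mem N)
    {S : Stk → List TapeSymbol} {L : ℕ} (hR : Rep s S) (hS : Short S L) (hL : 1 ≤ L) :
    ∃ v' S' s' t, Runs Ω (probeStep askC) (v, S) (v', S') t ∧ Rep s' S' ∧ Short S' (L + C) ∧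
      s'.reg .mu = j + 1 ∧ s'.reg .n = s.reg .n ∧ s'.q = [] ∧
      v'.c = decide (ans .accuracy (unaryCode (j + 1)) ≤ 3) ∧ t ≤ 400 * C * (L + C + 1) := by
  obtain ⟨h1, h2, h3, h4, h5⟩ := run_probe (ans := ans) (len := len) hmu hq
  obtain ⟨v₁, S₁, t₁, r₁, hR₁, hS₁, -, ht₁⟩ :=
    implements_compile hA probe 0 s (by rw [Nat.zero_add]; exact depth_probe) v S L hR hS hL
  obtain ⟨v₂, w, t₂, r₂, hw, hl, ht₂, hc⟩ :=
    runs_dec (Ω := Ω) (k := .reg .flag) trivial v₁ S₁ hR₁.1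
  have hlen := hS₁ (.reg .flag) trivial
  rw [hR₁.2.2, h4] at hc hw
  rw [h5] at hlen ht₁ hS₁
  set C₁ := 7 + 2 * (j + 1) + len .accuracy (unaryCode (j + 1)) with hC₁
  refine ⟨v₂, _, _, _, Exec.seq r₁ r₂, hR₁.set .flag hw, (hS₁.mono (by omega)).update (by omega),
    by simpa using h2, by simpa using h3, h1,
    by rw [hc]; congr 1; simp [Nat.sub_eq_zero_iff_le], ?_⟩
  have e1 : C₁ + 1 ≤ C := by omega
  have e2 : 400 * (C₁ + 1) * (L + C₁ + 1) ≤ 400 * C * (L + C + 1) :=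
    Nat.mul_le_mul (Nat.mul_le_mul_left _ e1) (by omega)
  have e3 : 400 * (C₁ + 1) * (L + C₁ + 1) = 400 * C₁ * (L + C₁ + 1) + 400 * (L + C₁ + 1) := by ring
  omega

/-- The induction is on the number `r` of probes after the next one. Each probe is charged `C - 1`,
and the remaining unit of cost pays for the tests of the loop. -/
theorem runs_search (hA : Answers Ω askC ans len) {k C : ℕ} {s : LoopState} {j r : ℕ}
    (hjr : j + r + 1 = k) (hmu : s.reg .mu = j) (hq : s.q = [])
    (hC : ∀ i < k, 9 + 2 * (i + 1) + len .accuracy (unaryCode (i + 1)) ≤ C)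
    (hlt : ∀ i, 1 ≤ i → i < k → ans .accuracy (unaryCode i) ≤ 3)
    (hge : 3 < ans .accuracy (unaryCode k)) {v : Mem N} (hv : v.c = true)
    {S : Stk → List TapeSymbol} {L : ℕ} (hR : Rep s S) (hS : Short S L) (hL : 1 ≤ L) :
    ∃ v' S' s' t, Runs Ω (.whileDo (fun v => v.c) (probeStep askC)) (v, S) (v', S') t ∧
      Rep s' S' ∧ Short S' (L + (r + 1) * C) ∧ s'.reg .mu = k ∧ s'.reg .n = s.reg .n ∧ s'.q = [] ∧
      t ≤ 400 * ((r + 1) * C) * (L + (r + 1) * C + 1) := by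
  induction r generalizing j s v S L with
  | zero =>
    have hCj := hC j (by omega)
    obtain ⟨v₁, S₁, s₁, t₁, r₁, hR₁, hS₁, a1, a2, a3, a4, ht₁⟩ :=
      runs_probeStep hA hmu hq (C := C - 1) (by omega) v hR hS hL
    have hk : j + 1 = k := by omega
    rw [hk] at a4 a1
    have hf : v₁.c = false := by rw [a4]; simpa using hge
    refine ⟨v₁, S₁, s₁, _, Exec.while_true hv r₁ (Exec.while_false hf), hR₁, hS₁.mono (by omega),
      a1, a2, a3, ?_⟩
    obtain ⟨c, rfl⟩ : ∃ c, C = c + 1 := ⟨C - 1, by omega⟩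
    simp only [Nat.add_sub_cancel] at ht₁
    have e : 400 * ((0 + 1) * (c + 1)) * (L + (0 + 1) * (c + 1) + 1) =
        400 * c * (L + c + 1) + 400 * c + 400 * (L + c + 2) := by ring
    omega
  | succ r ih =>
    have hCj := hC j (by omega)
    obtain ⟨v₁, S₁, s₁, t₁, r₁, hR₁, hS₁, a1, a2, a3, a4, ht₁⟩ :=
      runs_probeStep hA hmu hq (C := C - 1) (by omega) v hR hS hL
    have hf : v₁.c = true := by rw [a4]; simpa using hlt (j + 1) (by omega) (by omega)
    obtain ⟨v₂, S₂, s₂, t₂, r₂, hR₂, hS₂, b1, b2, b3, ht₂⟩ := ih (by omega) a1 a3 hf hR₁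
      (hS₁.mono (show L + (C - 1) ≤ L + C by omega)) (by omega)
    refine ⟨v₂, S₂, s₂, _, Exec.while_true hv r₁ r₂, hR₂, hS₂.mono (by ring_nf; omega), b1,
      b2.trans a2, b3, ?_⟩
    obtain ⟨c, rfl⟩ : ∃ c, C = c + 1 := ⟨C - 1, by omega⟩
    simp only [Nat.add_sub_cancel] at ht₁
    have e : L + (r + 1 + 1) * (c + 1) + 1 = (L + (c + 1) + (r + 1) * (c + 1) + 1) := by ring
    have e1 : 400 * c * (L + c + 1) + 1 ≤ 400 * (c + 1) * (L + (r + 1 + 1) * (c + 1) + 1) := by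
      have e2 : L + (r + 1 + 1) * (c + 1) + 1 = L + c + 1 + (r * c + r + c + 2) := by ring
      rw [e2]
      have e3 : 400 * c * (L + c + 1) ≤ 400 * (c + 1) * (L + c + 1) :=
        Nat.mul_le_mul_right _ (by omega)
      have e4 : 1 ≤ 400 * (c + 1) * (r * c + r + c + 2) :=
        Nat.mul_pos (by omega) (by omega)
      rw [Nat.mul_add (400 * (c + 1))]
      omega
    rw [← e] at ht₂
    calc 1 + (t₁ + t₂) ≤ 400 * (c + 1) * (L + (r + 1 + 1) * (c + 1) + 1) +
          400 * ((r + 1) * (c + 1)) * (L + (r + 1 + 1) * (c + 1) + 1) := by omega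
      _ = _ := by ring

/-- The machine that runs the algorithm. -/
def algorithm (askC : OraclePort → StackCmd Stk (Mem N)) : OracleTM :=
  machine (program askC) (.reg .n) .question .question .answer ⟨none, none, true, 0⟩

theorem algorithm_spec (hA : Answers Ω askC ans len) {n k C : ℕ} (hn2 : 2 ≤ n) (hk : 1 ≤ k)
    (hC : ∀ i < k, 9 + 2 * (i + 1) + len .accuracy (unaryCode (i + 1)) ≤ C)
    (hlt : ∀ i, 1 ≤ i → i < k → ans .accuracy (unaryCode i) ≤ 3)
    (hge : 3 < ans .accuracy (unaryCode k))
    (hans : ∀ T code, ans .body (question (params ans n k) T code) ≤ 1)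
    (hlen : ∀ T code, len .body (question (params ans n k) T code) ≤ 1)
    (hlenD : len .degree [] ≤ ans .degree [] + 1)
    (hlenE : len .exponent (unaryCode (params ans n k).B) ≤ (params ans n k).B + 2) :
    ∃ best, (∀ T < (params ans n k).Tm, Good ans (params ans n k) T → T ≤ best) ∧
      ((∃ T < (params ans n k).Tm, Good ans (params ans n k) T) →
        Good ans (params ans n k) best) ∧
      ∀ T, 400 * (k * C + 290 * (params ans n k).Tm ^ 4 * (params ans n k).Z) *
          (n + (k * C + 290 * (params ans n k).Tm ^ 4 * (params ans n k).Z) + 1) + 1 ≤ T →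
        (algorithm askC).OutputsWithin Ω (natCode n) T
          (natCode (((params ans n k).R + 1) ^ best) ++ .slash ::
            natCode (2 ^ (params ans n k).P / 2 * (params ans n k).R ^ best)) := by
  set s₀ : LoopState := ⟨Function.update (fun _ => 0) .n n, []⟩ with hs₀
  set S₀ : Stk → List TapeSymbol := Function.update (fun _ => []) (.reg .n) (natCode n) with hS₀
  have hR₀ : Rep s₀ S₀ := by
    refine ⟨⟨by simp [hS₀], by simp [hS₀], by simp [hS₀]⟩, by simp [hS₀, hs₀], fun r => ?_⟩
    by_cases e : r = .n
    · subst e; simp [hS₀, hs₀, strVal_natCode]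
    · have : (Stk.reg r) ≠ .reg .n := by simpa using e
      simp [hS₀, hs₀, Function.update_of_ne this, Function.update_of_ne e, strVal]
  have hSh : Short S₀ n := by
    have h0 : Short (fun _ : Stk => []) n := fun k _ => by simp
    refine h0.update ?_
    simp only [natCode, List.length_map, Nat.size_eq_bits_len]
    exact Nat.size_le.mpr Nat.lt_two_pow_self
  -- The carry bit is set in the initial memory, so that a first probe takes place.
  obtain ⟨v₁, S₁, s₁, t₁, r₁, hR₁, hS₁, a1, a2, a3, ht₁⟩ := runs_search hA (k := k) (C := C)
    (s := s₀) (j := 0) (r := k - 1) (by omega) (by simp [hs₀]) rfl hC hlt hge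
    (v := ⟨none, none, true, 0⟩) rfl hR₀ hSh (by omega)
  have hn₁ : s₁.reg .n = n := by rw [a2]; simp [hs₀]
  obtain ⟨best, hq, hb1, hb2, hcost⟩ := main_spec hn2 hn₁ a1 a3 hans hlen hlenD hlenE
  obtain ⟨v₂, S₂, t₂, r₂, hR₂, -, -, ht₂⟩ :=
    implements_compile hA main 0 s₁ (by rw [Nat.zero_add]; exact depth_main) v₁ S₁ _ hR₁ hS₁
      (by omega)
  refine ⟨best, hb1, hb2, fun T hT => ?_⟩
  rw [← hq, ← hR₂.2.1]
  refine Exec.outputsWithin (Exec.seq r₁ r₂) (le_trans ?_ hT)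
  rw [Nat.sub_add_cancel hk] at ht₁ ht₂
  set X := 290 * (params ans n k).Tm ^ 4 * (params ans n k).Z
  set Y := cost ans len main s₁
  have e1 : 400 * (k * C) * (n + k * C + 1) ≤ 400 * (k * C) * (n + (k * C + X) + 1) :=
    Nat.mul_le_mul_left _ (by omega)
  have e2 : 400 * Y * (n + k * C + Y + 1) ≤ 400 * X * (n + (k * C + X) + 1) :=
    Nat.mul_le_mul (Nat.mul_le_mul_left _ hcost) (by omega)
  calc t₁ + t₂ + 1 ≤
        400 * (k * C) * (n + (k * C + X) + 1) + 400 * X * (n + (k * C + X) + 1) + 1 := by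
        omega
    _ = _ := by ring

end Algo

/-! ### Rational points and their codes -/

theorem ratCode_natCast_div {a b : ℕ} (hb : b ≠ 0) (h : Nat.Coprime a b) :
    ratCode ((a : ℚ) / b) = natCode a ++ .slash :: natCode b := by
  have h1 : ((a : ℚ) / b).num = a := by
    have := Rat.num_div_eq_of_coprime (a := a) (b := b) (by positivity) (by simpa using h)
    simpa using this
  have h2 : ((a : ℚ) / b).den = b := by
    have := Rat.den_div_eq_of_coprime (a := a) (b := b) (by positivity) (by simpa using h)
    simpa using this
  simp [ratCode, intCode, h1, h2]

theorem queryCode_getElem {n : ℕ} {l : List ℚ} (h : l.length = n) (ε : ℚ) :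
    queryCode (fun i : Fin n => l[i]) ε =
      (l.map fun q => ratCode q ++ [.comma]).flatten ++ ratCode ε := by
  subst h
  have : List.ofFn (fun i : Fin l.length => ratCode l[i] ++ [TapeSymbol.comma]) =
      l.map fun q => ratCode q ++ [.comma] := by
    apply List.ext_getElem <;> simp
  simp only [queryCode, this]

/-! ### The questions as rational points -/

namespace Algo

/-- The value of a coordinate at level `l`. -/
def coordVal (c : Params) (T l : ℕ) : ℚ :=
  (((c.R + 1) ^ (T - c.m * l) : ℕ) : ℚ) / ((2 ^ c.P * c.R ^ (T - c.m * l) : ℕ) : ℚ)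

/-- The levels of the coordinates that a code stands for. -/
def levels (c : Params) (code : ℕ) : List ℕ := (walk c.n (2 ^ c.mu) code c.L).2

/-- The coordinates of the point that a code stands for. -/
def coords (c : Params) (T code : ℕ) : List ℚ :=
  List.replicate (c.n - (levels c code).length) 0 ++ (levels c code).map (coordVal c T)

theorem length_levels_le (c : Params) (code : ℕ) : (levels c code).length ≤ c.n :=
  length_walk_le _ _ _ _

theorem length_coords (c : Params) (T code : ℕ) : (coords c T code).length = c.n := by
  have := length_levels_le c code
  simp [coords, this]

/-- The tolerance of the questions. -/
def tolerance (c : Params) : ℚ := ((1 : ℕ) : ℚ) / ((2 ^ c.P * (c.n * 2 ^ c.mu) : ℕ) : ℚ)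

/-- Evenness of `R` makes `R + 1` prime to 2 as well as to `R`. The machine may thus write its
fractions without computing a greatest common divisor. -/
theorem coprime_succ_pow {R : ℕ} (hR : Even R) (e P : ℕ) :
    Nat.Coprime ((R + 1) ^ e) (2 ^ P * R ^ e) := by
  have h2 : Nat.Coprime (R + 1) 2 := by
    obtain ⟨r, rfl⟩ := hR
    rw [Nat.coprime_two_right]
    exact ⟨r, by ring⟩
  have hR1 : Nat.Coprime (R + 1) R := by simp
  exact Nat.Coprime.mul_right (Nat.Coprime.pow _ _ h2) (Nat.Coprime.pow _ _ hR1)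

theorem question_eq_queryCode {n : ℕ} {c : Params} (hn : c.n = n) (hn0 : n ≠ 0) (hR : Even c.R)
    (hR0 : c.R ≠ 0) (T code : ℕ) :
    question c T code = queryCode
      (fun i : Fin n => (coords c T code)[i]'(by rw [length_coords, hn]; exact i.2))
      (tolerance c) := by
  have h := queryCode_getElem (n := n) (l := coords c T code) (by rw [length_coords, hn])
    (tolerance c)
  refine Eq.trans ?_ h.symm
  have hz : ratCode 0 = .slash :: natCode 1 := by simp [ratCode, intCode, natCode]
  have hc : ∀ l, ratCode (coordVal c T l) ++ [.comma] = coordCode c T l := by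
    intro l
    rw [coordVal, ratCode_natCast_div (by positivity) (coprime_succ_pow hR _ _)]
    simp [coordCode]
  have ht : ratCode (tolerance c) =
      natCode 1 ++ .slash :: natCode (2 ^ c.P * (c.n * 2 ^ c.mu)) :=
    ratCode_natCast_div (by rw [hn]; positivity) (Nat.coprime_one_left _)
  simp only [question, coords, List.map_append, List.map_replicate, List.map_map,
    List.flatten_append, List.append_assoc, hz, ht]
  congr 3
  exact List.map_congr_left fun l _ => (hc l).symm

end Algo

/-! ### Answers of oracles -/

theorem length_natCode (m : ℕ) : (natCode m).length = m.size := by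
  simp [natCode, Nat.size_eq_bits_len]

/-- A positive number is approximated by natural numbers. -/
theorem IsRealOracle.answer {x : ℝ} {O : List TapeSymbol → List TapeSymbol} (h : IsRealOracle x O)
    (hx : 0 < x) (k : ℕ) :
    |x - strVal (O (unaryCode k)) / 2 ^ k| ≤ 1 / 2 ^ k ∧
      (O (unaryCode k)).length = (strVal (O (unaryCode k))).size := by
  obtain ⟨m, hO, hm⟩ := h k
  have h2 : (0 : ℝ) < 2 ^ k := by positivity
  have h0 : 0 ≤ m := by
    -- A negative integer is at most `-1`, which puts `m / 2 ^ k` farther than `1 / 2 ^ k` from a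
    -- positive number.
    by_contra hlt
    have h3 : (m : ℝ) ≤ -1 := by exact_mod_cast Int.le_sub_one_of_lt (not_le.mp hlt)
    have h4 : (m : ℝ) / 2 ^ k ≤ -1 / 2 ^ k := by gcongr
    have h5 : -1 / (2 : ℝ) ^ k = -(1 / 2 ^ k) := by ring
    linarith [(abs_le.mp hm).2]
  have e : O (unaryCode k) = natCode m.toNat := by
    rw [hO, intCode, if_neg h0.not_gt, List.nil_append]
    congr 1
    omega
  rw [e, strVal_natCode, length_natCode]
  refine ⟨?_, rfl⟩
  have : ((m.toNat : ℕ) : ℝ) = (m : ℝ) := by exact_mod_cast Int.toNat_of_nonneg h0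
  rwa [this]

namespace Algo

/-- The answer of the body oracle about a code. -/
theorem answer_question {n : ℕ} {S : Set (EuclideanSpace ℝ (Fin n))}
    {O : List TapeSymbol → List TapeSymbol} (hO : IsWeakMembershipOracle S O) {c : Params}
    (hn : c.n = n) (hn0 : n ≠ 0) (hR : Even c.R) (hR0 : c.R ≠ 0) (T code : ℕ) {y : Fin n → ℝ}
    (hy : ∀ (i : Fin n) (hi : i.val < (coords c T code).length), y i = ((coords c T code)[i] : ℚ)) :
    (O (question c T code)).length = 1 ∧ strVal (O (question c T code)) ≤ 1 ∧
      (1 ≤ strVal (O (question c T code)) →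
        WithLp.toLp 2 y ∈ Metric.cthickening (tolerance c : ℝ) S) ∧
      (Metric.closedBall (WithLp.toLp 2 y) (tolerance c : ℝ) ⊆ S →
        1 ≤ strVal (O (question c T code))) := by
  have hε : 0 < tolerance c := by
    rw [tolerance, hn]
    positivity
  have hlen : ∀ i : Fin n, i.val < (coords c T code).length := fun i => by
    rw [length_coords, hn]; exact i.2
  have hy' : y = fun i : Fin n => (((coords c T code)[i]'(hlen i) : ℚ) : ℝ) :=
    funext fun i => hy i (hlen i)
  rw [question_eq_queryCode hn hn0 hR hR0, hy']
  rcases hO (fun i : Fin n => (coords c T code)[i]'(hlen i)) (tolerance c) hε with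
    ⟨h1, h2⟩ | ⟨h1, h2⟩
  · rw [h1]
    exact ⟨rfl, by simp [strVal], fun _ => h2, fun _ => by simp [strVal]⟩
  · rw [h1]
    exact ⟨rfl, by simp [strVal], fun h => by simp [strVal] at h, fun h => absurd h h2⟩

end Algo

/-! ### Symmetric norms -/

namespace IsSymmetricNorm

variable {n : ℕ} {N : Seminorm ℝ (Fin n → ℝ)}

theorem apply_perm (h : IsSymmetricNorm N) (x : Fin n → ℝ) (π : Equiv.Perm (Fin n)) :
    N (fun i => x (π i)) = N x := by
  simpa using h.apply_signed_perm x π 1 (by simp)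

theorem apply_sign (h : IsSymmetricNorm N) (x s : Fin n → ℝ) (hs : ∀ i, s i = 1 ∨ s i = -1) :
    N (fun i => s i * x i) = N x := by
  simpa using h.apply_signed_perm x 1 s hs

/-- Shrinking one coordinate does not increase the norm. -/
theorem apply_update_mul_le (h : IsSymmetricNorm N) (x : Fin n → ℝ) (j : Fin n) {t : ℝ}
    (ht : |t| ≤ 1) : N (Function.update x j (t * x j)) ≤ N x := by
  set x' : Fin n → ℝ := fun i => (if i = j then -1 else 1) * x i with hx'
  have h1 : N x' = N x := h.apply_sign x _ fun i => by by_cases e : i = j <;> simp [e]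
  -- The shrunken vector is a convex combination of `x` and its reflection in the coordinate `j`.
  have h2 : Function.update x j (t * x j) = ((1 + t) / 2) • x + ((1 - t) / 2) • x' := by
    ext i
    by_cases e : i = j
    · subst e; simp [hx']; ring
    · simp [hx', e]; ring
  obtain ⟨ht1, ht2⟩ := abs_le.mp ht
  rw [h2]
  refine (map_add_le_add N _ _).trans ?_
  rw [map_smul_eq_mul, map_smul_eq_mul, h1, Real.norm_of_nonneg (by linarith),
    Real.norm_of_nonneg (by linarith)]
  apply le_of_eq; ring

/-- The norm is monotone in the absolute values of the coordinates. -/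
theorem mono (h : IsSymmetricNorm N) {x y : Fin n → ℝ} (hxy : ∀ i, |x i| ≤ |y i|) : N x ≤ N y := by
  classical
  -- The coordinates are exchanged one at a time.
  have key : ∀ s : Finset (Fin n), N (fun i => if i ∈ s then x i else y i) ≤ N y := by
    intro s
    induction s using Finset.induction_on with
    | empty => simp
    | insert j s hj ih =>
      refine le_trans ?_ ih
      set z : Fin n → ℝ := fun i => if i ∈ s then x i else y i with hz
      obtain ⟨t, ht, hxt⟩ : ∃ t, |t| ≤ 1 ∧ x j = t * y j := by
        by_cases e : y j = 0
        · have := hxy j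
          rw [e, abs_zero, abs_nonpos_iff] at this
          exact ⟨0, by simp, by rw [this]; ring⟩
        · refine ⟨x j / y j, ?_, by field_simp⟩
          rw [abs_div]
          exact div_le_one_of_le₀ (hxy j) (abs_nonneg _)
      have e : (fun i => if i ∈ insert j s then x i else y i) = Function.update z j (t * z j) := by
        ext i
        by_cases e : i = j
        · subst e; simp [hz, hj, hxt]
        · simp [hz, e]
      rw [e]
      exact h.apply_update_mul_le z j ht
  simpa using key Finset.univ

theorem abs_mul_apply_single_le (h : IsSymmetricNorm N) (x : Fin n → ℝ) (i : Fin n) :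
    |x i| * N (Pi.single i 1) ≤ N x := by
  have e : |x i| * N (Pi.single i 1) = N (Pi.single i (x i)) := by
    rw [← Real.norm_eq_abs, ← map_smul_eq_mul]
    congr 1
    ext j
    simp [Pi.single_apply]
  rw [e]
  refine h.mono fun j => ?_
  by_cases hj : j = i
  · subst hj; simp
  · simp [Pi.single_eq_of_ne hj]

end IsSymmetricNorm

theorem Seminorm.apply_le_sum_abs {n : ℕ} (N : Seminorm ℝ (Fin n → ℝ)) (x : Fin n → ℝ) :
    N x ≤ ∑ i, |x i| * N (Pi.single i 1) := by
  have e : x = ∑ i, x i • (Pi.single i 1 : Fin n → ℝ) := by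
    ext j
    simp [Finset.sum_apply, Pi.single_apply]
  conv_lhs => rw [e]
  refine (Finset.le_sum_of_subadditive N (map_zero N).le (map_add_le_add N) _ _).trans
    (Finset.sum_le_sum fun i _ => ?_)
  rw [map_smul_eq_mul, Real.norm_eq_abs]

/-! ### Norms in `ℓ_pⁿ` -/

section PiLp

variable {n : ℕ} {p : ENNReal} [hp : Fact (1 ≤ p)]

theorem PiLp.norm_le_sum_abs (x : PiLp p fun _ : Fin n => ℝ) : ‖x‖ ≤ ∑ i, |x i| := by
  have e : x = ∑ i, x i • PiLp.single p i (1 : ℝ) := by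
    ext j
    simp [WithLp.ofLp_sum, Finset.sum_apply, Pi.single_apply]
  conv_lhs => rw [e]
  refine (norm_sum_le _ _).trans (Finset.sum_le_sum fun i _ => ?_)
  rw [norm_smul, PiLp.norm_single]
  simp

/-- A crude factor that serves for every `p`; the tolerance of the questions is small enough to
absorb it. -/
theorem PiLp.norm_toLp_le_card_mul (x : EuclideanSpace ℝ (Fin n)) :
    ‖WithLp.toLp p (WithLp.ofLp x)‖ ≤ n * ‖x‖ := by
  refine (PiLp.norm_le_sum_abs _).trans ?_
  calc ∑ i, |x i| ≤ ∑ _i : Fin n, ‖x‖ :=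
        Finset.sum_le_sum fun i _ => PiLp.norm_apply_le x i
    _ = n * ‖x‖ := by simp

/-- A vector whose coordinates dominate powers of weights has large norm. -/
theorem PiLp.le_norm_of_weights {x : PiLp p fun _ : Fin n => ℝ} {w : Fin n → ℝ} {t l : ℝ}
    (hw : ∀ i, 0 ≤ w i) (hl : 0 ≤ l) (ht : 0 < t) (ht1 : t ≤ 1) (hsum : t ≤ ∑ i, w i)
    (h : ∀ i, 0 < w i → l * w i ^ (p⁻¹).toReal ≤ |x i|) : l * t ≤ ‖x‖ := by
  rcases eq_or_ne p ⊤ with rfl | hpt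
  -- For `p = ∞` the exponent is zero, and one coordinate of positive weight is enough.
  · obtain ⟨i, hi⟩ : ∃ i, 0 < w i := by
      by_contra hne
      push Not at hne
      linarith [Finset.sum_nonpos fun i (_ : i ∈ Finset.univ) => hne i]
    have h1 := h i hi
    simp only [ENNReal.inv_top, ENNReal.toReal_zero, Real.rpow_zero, mul_one] at h1
    have h2 := PiLp.norm_apply_le x i
    rw [Real.norm_eq_abs] at h2
    nlinarith
  · have hp1 : 1 ≤ p.toReal := by
      have := ENNReal.toReal_mono hpt hp.out
      simpa using this
    have hp0 : 0 < p.toReal := by linarith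
    rw [PiLp.norm_eq_sum hp0]
    have hlt : 0 ≤ l * t := by positivity
    rw [← Real.rpow_le_rpow_iff hlt (by positivity) hp0, ← Real.rpow_mul
      (Finset.sum_nonneg fun i _ => by positivity), one_div, inv_mul_cancel₀ hp0.ne', Real.rpow_one,
      Real.mul_rpow hl ht.le]
    -- As `t ≤ 1 ≤ p`, the total weight `t` may be weakened to `t ^ p`. This gives a loss of at most
    -- the factor `t`, uniformly in `p`.
    calc l ^ p.toReal * t ^ p.toReal ≤ l ^ p.toReal * t := by
          gcongr
          calc t ^ p.toReal ≤ t ^ (1 : ℝ) := Real.rpow_le_rpow_of_exponent_ge ht ht1 hp1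
            _ = t := Real.rpow_one t
      _ ≤ l ^ p.toReal * ∑ i, w i := by gcongr
      _ = ∑ i, l ^ p.toReal * w i := Finset.mul_sum _ _ _
      _ ≤ _ := Finset.sum_le_sum fun i _ => ?_
    rcases (hw i).eq_or_lt with h0 | h0
    · rw [← h0, mul_zero]; positivity
    · have h1 := Real.rpow_le_rpow (by have := hw i; positivity) (h i h0) hp0.le
      rw [Real.mul_rpow hl (by have := hw i; positivity), ← Real.rpow_mul (hw i),
        ENNReal.toReal_inv, inv_mul_cancel₀ hp0.ne', Real.rpow_one] at h1
      simpa using h1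

/-- Every nonzero vector has weights that witness its norm. -/
theorem PiLp.exists_weights {x : PiLp p fun _ : Fin n => ℝ} (hx : x ≠ 0) :
    ∃ w : Fin n → ℝ, (∀ i, 0 ≤ w i) ∧ ∑ i, w i = 1 ∧
      ∀ i, 0 < w i → ‖x‖ * w i ^ (p⁻¹).toReal ≤ |x i| := by
  classical
  rcases eq_or_ne p ⊤ with rfl | hpt
  · have : Nonempty (Fin n) := by
      by_contra hne
      rw [not_nonempty_iff] at hne
      exact hx (by ext i; exact isEmptyElim i)
    -- For `p = ∞` all the weight is put on a coordinate of maximal absolute value.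
    obtain ⟨j, hj⟩ := exists_eq_ciSup_of_finite (f := fun i => ‖x i‖)
    refine ⟨Pi.single j 1, fun i => ?_, by simp, fun i hi => ?_⟩
    · by_cases e : i = j
      · subst e; simp
      · simp [Pi.single_eq_of_ne e]
    · have e : i = j := by
        by_contra e
        simp [Pi.single_eq_of_ne e] at hi
      subst e
      simp only [ENNReal.inv_top, ENNReal.toReal_zero, Real.rpow_zero, mul_one]
      rw [PiLp.norm_eq_ciSup, ← hj, Real.norm_eq_abs]
  · have hp1 : 1 ≤ p.toReal := by
      have := ENNReal.toReal_mono hpt hp.out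
      simpa using this
    have hp0 : 0 < p.toReal := by linarith
    have hn : 0 < ‖x‖ := norm_pos_iff.mpr hx
    have hs : ‖x‖ ^ p.toReal = ∑ i, ‖x i‖ ^ p.toReal := by
      conv_lhs => rw [PiLp.norm_eq_sum hp0]
      rw [← Real.rpow_mul (Finset.sum_nonneg fun i _ => by positivity), one_div,
        inv_mul_cancel₀ hp0.ne', Real.rpow_one]
    refine ⟨fun i => (|x i| / ‖x‖) ^ p.toReal, fun i => by positivity, ?_, fun i _ => ?_⟩
    · simp_rw [Real.div_rpow (abs_nonneg _) hn.le, ← Finset.sum_div]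
      rw [hs]
      simp only [Real.norm_eq_abs]
      rw [div_self]
      have : 0 < ‖x‖ ^ p.toReal := by positivity
      simp only [hs, Real.norm_eq_abs] at this
      exact this.ne'
    · rw [← Real.rpow_mul (by positivity), ENNReal.toReal_inv, mul_inv_cancel₀ hp0.ne',
        Real.rpow_one, mul_div_cancel₀ _ hn.ne']

end PiLp

/-! ### The unit ball of a symmetric norm in `ℓ_pⁿ` -/

theorem neg_mem_unitBallIn {n : ℕ} {N : Seminorm ℝ (Fin n → ℝ)} {p : ENNReal}
    {z : PiLp p fun _ : Fin n => ℝ} (hz : z ∈ unitBallIn p N) :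
    -z ∈ unitBallIn p N := by
  simpa [unitBallIn] using hz

section UnitBall

variable {n : ℕ} {N : Seminorm ℝ (Fin n → ℝ)} {p : ENNReal} [hp : Fact (1 ≤ p)] {h : ℝ}

theorem norm_le_of_mem_unitBallIn (hN : IsSymmetricNorm N)
    (hlow : ∀ i, 1 / Real.exp h ≤ N (Pi.single i 1)) {z : PiLp p fun _ : Fin n => ℝ}
    (hz : z ∈ unitBallIn p N) : ‖z‖ ≤ n * Real.exp h := by
  refine (PiLp.norm_le_sum_abs z).trans ?_
  have key : ∀ i, |z i| ≤ Real.exp h := by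
    intro i
    have h1 := (hN.abs_mul_apply_single_le (WithLp.ofLp z) i).trans hz
    have h2 : |z i| * (1 / Real.exp h) ≤ 1 :=
      (mul_le_mul_of_nonneg_left (hlow i) (abs_nonneg _)).trans h1
    rw [mul_one_div, div_le_one (Real.exp_pos _)] at h2
    exact h2
  calc ∑ i, |z i| ≤ ∑ _i : Fin n, Real.exp h := Finset.sum_le_sum fun i _ => key i
    _ = n * Real.exp h := by simp

theorem isBounded_unitBallIn (hN : IsSymmetricNorm N)
    (hlow : ∀ i, 1 / Real.exp h ≤ N (Pi.single i 1)) :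
    Bornology.IsBounded (unitBallIn p N) :=
  (Metric.isBounded_closedBall (x := 0) (r := n * Real.exp h)).subset fun z hz => by
    simpa using norm_le_of_mem_unitBallIn hN hlow hz

theorem two_mul_norm_le_diam (hN : IsSymmetricNorm N)
    (hlow : ∀ i, 1 / Real.exp h ≤ N (Pi.single i 1)) {z : PiLp p fun _ : Fin n => ℝ}
    (hz : z ∈ unitBallIn p N) : 2 * ‖z‖ ≤ Metric.diam (unitBallIn p N) := by
  have h1 := Metric.dist_le_diam_of_mem (isBounded_unitBallIn (p := p) hN hlow) hz
    (neg_mem_unitBallIn hz)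
  rwa [dist_eq_norm, sub_neg_eq_add, ← two_smul ℝ, norm_smul, Real.norm_ofNat] at h1

/-- A basis vector divided by its norm lies in the ball. This bounds the range of scales from below.
-/
theorem exp_neg_le_diam (hN : IsSymmetricNorm N) (hn : 0 < n)
    (hlow : ∀ i, 1 / Real.exp h ≤ N (Pi.single i 1))
    (hup : ∀ i, N (Pi.single i 1) ≤ Real.exp h) :
    2 * Real.exp (-h) ≤ Metric.diam (unitBallIn p N) := by
  set i : Fin n := ⟨0, hn⟩
  set a := N (Pi.single i 1) with ha
  have ha0 : 0 < a := lt_of_lt_of_le (by positivity) (hlow i)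
  have hz : PiLp.single p i a⁻¹ ∈ unitBallIn p N := by
    have e : (Pi.single i a⁻¹ : Fin n → ℝ) = a⁻¹ • Pi.single i 1 := by
      rw [← Pi.single_smul, smul_eq_mul, mul_one]
    change N (Pi.single i a⁻¹) ≤ 1
    rw [e, map_smul_eq_mul, ← ha, Real.norm_of_nonneg (by positivity), inv_mul_cancel₀ ha0.ne']
  have h1 := two_mul_norm_le_diam hN hlow hz
  rw [PiLp.norm_single, Real.norm_of_nonneg (by positivity)] at h1
  refine le_trans ?_ h1
  rw [Real.exp_neg]
  gcongr
  exact hup i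

/-- Half the difference of two points of the ball is again in the ball, so norms bound distances.
Coming within a factor `1 - η` avoids the question whether the supremum is attained. -/
theorem exists_norm_near_diam {η : ℝ} (hη : 0 < η)
    (hd : 0 < Metric.diam (unitBallIn p N)) :
    ∃ z ∈ unitBallIn p N, (1 - η) * Metric.diam (unitBallIn p N) ≤ 2 * ‖z‖ := by
  rcases le_or_gt 1 η with h1 | h1
  · refine ⟨0, by simp [unitBallIn], ?_⟩
    rw [norm_zero]
    nlinarith
  by_contra hcon
  push Not at hcon
  have hle : Metric.diam (unitBallIn p N) ≤ (1 - η) * Metric.diam (unitBallIn p N) := by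
    refine Metric.diam_le_of_forall_dist_le (by nlinarith) fun x hx y hy => ?_
    have hz : (1 / 2 : ℝ) • (x - y) ∈ unitBallIn p N := by
      change N (WithLp.ofLp ((1 / 2 : ℝ) • (x - y))) ≤ 1
      rw [WithLp.ofLp_smul, map_smul_eq_mul, WithLp.ofLp_sub]
      have h2 := map_sub_le_add N (WithLp.ofLp x) (WithLp.ofLp y)
      have hx' : N (WithLp.ofLp x) ≤ 1 := hx
      have hy' : N (WithLp.ofLp y) ≤ 1 := hy
      rw [Real.norm_of_nonneg (by norm_num)]
      linarith
    have h3 := hcon _ hz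
    rw [norm_smul, Real.norm_of_nonneg (by norm_num)] at h3
    rw [dist_eq_norm]
    linarith
  nlinarith

/-- Points near the unit ball that dominate weights witness a lower bound for the diameter. -/
theorem mul_le_diam_of_mem_cthickening (hN : IsSymmetricNorm N)
    (hlow : ∀ i, 1 / Real.exp h ≤ N (Pi.single i 1)) {y w : Fin n → ℝ} {l M ε : ℝ}
    (hw : ∀ i, 0 ≤ w i) (hl : 0 ≤ l) (hM : 3 < M) (hsum : 1 - 3 / M ≤ ∑ i, w i)
    (hy : ∀ i, 0 < w i → l * w i ^ (p⁻¹).toReal ≤ |y i|) (hε : 0 < ε) (hεl : n * ε ≤ l / M)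
    (hmem : WithLp.toLp 2 y ∈ Metric.cthickening ε (unitBallIn 2 N)) :
    2 * (l * (1 - 5 / M)) ≤ Metric.diam (unitBallIn p N) := by
  have h3 : 3 / M < 1 := (div_lt_one (by linarith)).mpr hM
  have h1 : l * (1 - 3 / M) ≤ ‖(WithLp.toLp p y : PiLp p fun _ : Fin n => ℝ)‖ :=
    PiLp.le_norm_of_weights hw hl (by linarith) (by have : 0 ≤ 3 / M := by positivity
                                                    linarith) hsum hy
  -- Doubling the radius gives an actual point of the ball near `y`. The price is `2 / M`, which
  -- together with `3 / M` for the missing weight makes `5 / M`.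
  have h2 := Metric.cthickening_subset_thickening' (δ₁ := ε) (δ₂ := 2 * ε) (by linarith)
    (by linarith) (unitBallIn 2 N) hmem
  rw [Metric.mem_thickening_iff] at h2
  obtain ⟨z, hz, hd⟩ := h2
  have hz' : WithLp.toLp p (WithLp.ofLp z) ∈ unitBallIn p N := hz
  have h4 := two_mul_norm_le_diam hN hlow hz'
  have h5 := PiLp.norm_toLp_le_card_mul (p := p) (WithLp.toLp 2 y - z)
  rw [dist_eq_norm] at hd
  rw [WithLp.ofLp_sub, WithLp.toLp_sub] at h5
  have h6 := norm_sub_norm_le (WithLp.toLp p y) (WithLp.toLp p (WithLp.ofLp z))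
  have h7 : (n : ℝ) * ‖WithLp.toLp 2 y - z‖ ≤ n * (2 * ε) := by gcongr
  have e : l * (1 - 5 / M) = l * (1 - 3 / M) - 2 * (l / M) := by ring
  rw [e]
  simp only at *
  linarith

/-- Points well inside the unit ball have their neighborhoods inside it. -/
theorem closedBall_subset_unitBallIn (hup : ∀ i, N (Pi.single i 1) ≤ Real.exp h)
    {y : Fin n → ℝ} {M ε : ℝ} (hy : N y ≤ 1 - 1 / M) (hε : n * ε * Real.exp h ≤ 1 / M) :
    Metric.closedBall (WithLp.toLp 2 y) ε ⊆ unitBallIn 2 N := by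
  intro u hu
  rw [Metric.mem_closedBall, dist_eq_norm] at hu
  change N (WithLp.ofLp u) ≤ 1
  have e : WithLp.ofLp u = y + WithLp.ofLp (u - WithLp.toLp 2 y) := by simp
  have h1 : N (WithLp.ofLp (u - WithLp.toLp 2 y)) ≤ n * ε * Real.exp h := by
    refine (N.apply_le_sum_abs _).trans ?_
    calc ∑ i, |(u - WithLp.toLp 2 y) i| * N (Pi.single i 1) ≤ ∑ _i : Fin n, ε * Real.exp h := by
          refine Finset.sum_le_sum fun i _ => ?_
          have h2 := (PiLp.norm_apply_le (u - WithLp.toLp 2 y) i).trans hu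
          rw [Real.norm_eq_abs] at h2
          exact mul_le_mul h2 (hup i) (apply_nonneg N _) ((abs_nonneg _).trans h2)
      _ = n * ε * Real.exp h := by simp; ring
  rw [e]
  linarith [map_add_le_add N y (WithLp.ofLp (u - WithLp.toLp 2 y))]

end UnitBall

namespace Algo

/-! ### Codes for paths -/

theorem walk_congr {n M code code' : ℕ} {i : ℕ}
    (h : ∀ j < i, code.testBit j = code'.testBit j) : walk n M code i = walk n M code' i := by
  induction i with
  | zero => rfl
  | succ i ih => rw [walk, walk, ih fun j hj => h j (by omega), h i (by omega)]

/-- The state `u` is reached by a code with `l` bits. -/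
def Reach (n M l : ℕ) (u : ℕ × List ℕ) : Prop := ∃ code < 2 ^ l, walk n M code l = u

/-- The new bit goes on top of the code, so the earlier steps of the walk are unchanged. -/
theorem Reach.step {n M l : ℕ} {u : ℕ × List ℕ} (h : Reach n M l u) (b : Bool) :
    Reach n M (l + 1) (walkStep n M b u) := by
  obtain ⟨code, hc, hw⟩ := h
  refine ⟨2 ^ l * b.toNat + code, ?_, ?_⟩
  · rw [pow_succ]
    cases b <;> simp <;> omega
  · have h1 : (2 ^ l * b.toNat + code).testBit l = b := by
      rw [Nat.testBit_two_pow_mul_add _ hc]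
      cases b <;> simp
    rw [walk, h1, ← hw]
    congr 1
    refine walk_congr fun j hj => ?_
    rw [Nat.testBit_two_pow_mul_add _ hc, if_pos hj]

/-- Above its highest bit a code reads as zeros, and these only advance the level. Hence one fixed
number of steps serves for all shorter codes. -/
theorem walk_of_lt {n M code l : ℕ} (hc : code < 2 ^ l) (k : ℕ) :
    walk n M code (l + k) = ((walk n M code l).1 + k, (walk n M code l).2) := by
  induction k with
  | zero => rfl
  | succ k ih =>
    have : code.testBit (l + k) = false :=
      Nat.testBit_lt_two_pow (hc.trans_le (Nat.pow_le_pow_right (by norm_num) (by omega)))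
    rw [← Nat.add_assoc, walk, this, ih]
    simp [walkStep]
    omega

/-- The `k`-th coordinate that is written has a level `l` with `k < c l`. -/
def Admissible (c : ℕ → ℕ) : List ℕ → Prop
  | [] => True
  | l :: t => t.length < c l ∧ Admissible c t

theorem Admissible.replicate_append {c : ℕ → ℕ} {js : List ℕ} (h : Admissible c js) {j q : ℕ}
    (hq : q + js.length ≤ c j) : Admissible c (List.replicate q j ++ js) := by
  induction q with
  | zero => exact h
  | succ q ih =>
    refine ⟨?_, ih (by omega)⟩
    change (List.replicate q j ++ js).length < c j
    rw [List.length_append, List.length_replicate]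
    omega

/-- The latest coordinate is at the head of the list, so index `i` belongs to the coordinate
numbered `js.length - 1 - i`. -/
theorem Admissible.lt {c : ℕ → ℕ} {js : List ℕ} (h : Admissible c js) {i : ℕ}
    (hi : i < js.length) : js.length - 1 - i < c (js.getD i 0) := by
  induction js generalizing i with
  | nil => simp at hi
  | cons l t ih =>
    cases i with
    | zero => simpa using h.1
    | succ i =>
      have := ih h.2 (i := i) (by simpa using hi)
      simp only [List.length_cons, List.getD_cons_succ]
      rwa [show t.length + 1 - 1 - (i + 1) = t.length - 1 - i by omega]

/-- The path can be continued until no further block fits below `c j`. -/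
theorem exists_fill {n M j : ℕ} (hM : 0 < M) {c : ℕ → ℕ} (hc : c j ≤ n) {γ : ℝ}
    (hγ : γ = 1 + 1 / M) (k : ℕ) :
    ∀ (o : ℕ) (js : List ℕ), Reach n M (j + o) (j, js) → Admissible c js → js.length ≤ c j →
      c j - js.length ≤ k → (o = 0 ∨ γ ^ o ≤ γ * js.length) →
      ∃ (o' q : ℕ), Reach n M (j + o') (j, List.replicate q j ++ js) ∧
        Admissible c (List.replicate q j ++ js) ∧ q + js.length ≤ c j ∧
        c j ≤ (q + js.length) + (q + js.length) / M ∧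
        (o' = 0 ∨ γ ^ o' ≤ γ * ((q + js.length : ℕ) : ℝ)) := by
  induction k with
  | zero =>
    intro o js h1 h2 h3 h4 h5
    exact ⟨o, 0, h1, h2, by omega, by rw [Nat.zero_add]; generalize js.length / M = d; omega,
      by simpa using h5⟩
  | succ k ih =>
    intro o js h1 h2 h3 h4 h5
    obtain ⟨d, hd⟩ : ∃ d, d = js.length / M := ⟨_, rfl⟩
    by_cases hfit : js.length + d + 1 ≤ c j
    · have hstep := h1.step true
      have hmin : min (d + 1) (n - js.length) = d + 1 := by omega
      simp only [walkStep, if_true, ← hd, hmin] at hstep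
      have hlen : (List.replicate (d + 1) j ++ js).length = d + 1 + js.length := by simp
      -- A block has at least `js.length / M` coordinates and thus multiplies the length by at least
      -- `γ`; this is what bounds the number of blocks.
      have hgrow : γ * js.length ≤ ((d + 1 + js.length : ℕ) : ℝ) := by
        have h6 : (js.length : ℝ) / M ≤ d + 1 := by
          rw [div_le_iff₀ (by exact_mod_cast hM)]
          have := Nat.lt_succ_iff.mp (Nat.lt_succ_of_lt (Nat.lt_div_mul_add (a := js.length) hM))
          rw [← hd] at this
          have h7 : ((js.length : ℕ) : ℝ) ≤ ((d * M + M : ℕ) : ℝ) := by exact_mod_cast this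
          push_cast at h7
          linarith
        rw [hγ]
        push_cast
        have : (1 + 1 / (M : ℝ)) * js.length = js.length + (js.length : ℝ) / M := by ring
        linarith
      obtain ⟨o', q, r1, r2, r3, r4, r5⟩ := ih (o + 1) (List.replicate (d + 1) j ++ js) hstep
        (h2.replicate_append (by omega)) (by rw [hlen]; omega) (by rw [hlen]; omega) (by
          right
          rw [hlen]
          have hγ0 : 0 < γ := by rw [hγ]; positivity
          rcases h5 with rfl | h5
          · have : (1 : ℝ) ≤ ((d + 1 + js.length : ℕ) : ℝ) := by
              exact_mod_cast (by omega : 1 ≤ d + 1 + js.length)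
            simpa using le_mul_of_one_le_right hγ0.le this
          · rw [pow_succ, mul_comm]
            exact mul_le_mul_of_nonneg_left (h5.trans hgrow) hγ0.le)
      rw [← List.append_assoc, List.replicate_append_replicate] at r1 r2
      rw [hlen, ← Nat.add_assoc] at r3 r4 r5
      exact ⟨o', q + (d + 1), r1, r2, r3, r4, r5⟩
    · exact ⟨o, 0, h1, h2, by omega, by rw [Nat.zero_add, ← hd]; omega, by simpa using h5⟩

/-- At each level the path stays below `c`, but within the factor `γ`. The last inequality is a
summation by parts: with `a i` coordinates written up to level `i`, the terms `(γ * a i - c i) * (q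
^ i - q ^ (i + 1))` are nonnegative, and the induction carries the boundary term `(γ * a j - c j) *
q ^ j`. The factor `q` before `s j` accounts for weights that may be as large as `q ^ j` but are
counted only at level `j + 1`. -/
theorem exists_path {n M : ℕ} (hM : 0 < M) {c : ℕ → ℕ} (hcn : ∀ j, c j ≤ n) (hc : Monotone c)
    {γ q : ℝ} (hγ : γ = 1 + 1 / M) (hq0 : 0 ≤ q) (hq1 : q ≤ 1) {s : ℕ → ℝ} (hs0 : s 0 ≤ c 0)
    (hs0' : 0 ≤ s 0) (hs : ∀ j, s (j + 1) ≤ s j + ((c (j + 1) : ℝ) - c j) * q ^ j) (j : ℕ) :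
    ∃ (o : ℕ) (js : List ℕ), Reach n M (j + o) (j, js) ∧ Admissible c js ∧ js.length ≤ c j ∧
      (c j : ℝ) ≤ γ * js.length ∧ (o = 0 ∨ γ ^ o ≤ γ * js.length) ∧ (∀ l ∈ js, l ≤ j) ∧
      q * s j + (γ * js.length - c j) * q ^ j ≤ γ * (js.map fun l => q ^ l).sum := by
  have hfloor : ∀ a : ℕ, ((a + a / M : ℕ) : ℝ) ≤ γ * a := by
    intro a
    rw [hγ]
    push_cast
    have := Nat.cast_div_le (α := ℝ) (m := a) (n := M)
    have e : (1 + 1 / (M : ℝ)) * a = a + (a : ℝ) / M := by ring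
    linarith
  induction j with
  | zero =>
    obtain ⟨o, k, r1, r2, r3, r4, r5⟩ := exists_fill hM (hcn 0) hγ (c 0) 0 []
      ⟨0, by simp, rfl⟩ trivial (by simp) (by simp) (Or.inl rfl)
    have hlen : (List.replicate k 0 ++ []).length = k + ([] : List ℕ).length := by simp
    refine ⟨o, List.replicate k 0 ++ [], r1, r2, by omega, ?_, by rwa [hlen], by simp, ?_⟩
    · rw [hlen]
      exact le_trans (by exact_mod_cast r4) (hfloor _)
    · have := mul_le_of_le_one_left hs0' hq1
      simp
      linarith
  | succ j ih =>
    obtain ⟨o, js, h1, h2, h3, h4, h5, h6, h7⟩ := ih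
    have h8 := h1.step false
    simp only [walkStep, Bool.false_eq_true, if_false] at h8
    rw [show j + o + 1 = j + 1 + o by omega] at h8
    obtain ⟨o', k, r1, r2, r3, r4, r5⟩ := exists_fill hM (hcn (j + 1)) hγ _ o js h8 h2
      (h3.trans (hc (by omega))) le_rfl h5
    have hlen : (List.replicate k (j + 1) ++ js).length = k + js.length := by simp
    refine ⟨o', List.replicate k (j + 1) ++ js, r1, r2, by omega, ?_, by rwa [hlen], ?_, ?_⟩
    · rw [hlen]
      exact le_trans (by exact_mod_cast r4) (hfloor _)
    · intro l hl
      rcases List.mem_append.mp hl with hl | hl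
      · exact (List.eq_of_mem_replicate hl).le
      · exact (h6 l hl).trans (by omega)
    · have hsj := mul_le_mul_of_nonneg_left (hs j) hq0
      have hqj : 0 ≤ q ^ j := by positivity
      simp only [hlen, List.map_append, List.map_replicate, List.sum_append, List.sum_replicate,
        nsmul_eq_mul]
      push_cast
      rw [pow_succ]
      -- The hint is the term that the summation by parts adds at this level.
      nlinarith [mul_nonneg (mul_nonneg (sub_nonneg.mpr h4) hqj) (sub_nonneg.mpr hq1)]

end Algo

/-! ### Counting weights above a threshold -/

namespace Algo

section Weights

variable {n : ℕ} (w : Fin n → ℝ) (q : ℝ)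

/-- The number of weights that are at least `q ^ j`. -/
noncomputable def heavyCount (j : ℕ) : ℕ := (Finset.univ.filter fun i => q ^ j ≤ w i).card

/-- The sum of the weights that are at least `q ^ j`. -/
noncomputable def heavySum (j : ℕ) : ℝ := ∑ i ∈ Finset.univ.filter fun i => q ^ j ≤ w i, w i

variable {w q}

theorem heavyCount_le (j : ℕ) : heavyCount w q j ≤ n := by
  simpa [heavyCount] using Finset.card_le_univ (Finset.univ.filter fun i => q ^ j ≤ w i)

theorem heavyCount_mono (hq0 : 0 ≤ q) (hq1 : q ≤ 1) : Monotone (heavyCount w q) := by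
  intro j k hjk
  refine Finset.card_le_card fun i hi => ?_
  simp only [Finset.mem_filter, Finset.mem_univ, true_and] at hi ⊢
  exact (pow_le_pow_of_le_one hq0 hq1 hjk).trans hi

theorem heavySum_zero_le (hw1 : ∀ i, w i ≤ 1) : heavySum w q 0 ≤ heavyCount w q 0 := by
  refine (Finset.sum_le_card_nsmul _ _ 1 fun i _ => hw1 i).trans ?_
  simp [heavyCount]

/-- The weights that are new at level `j + 1` lie below `q ^ j`. -/
theorem heavySum_succ_le (hq0 : 0 ≤ q) (hq1 : q ≤ 1) (j : ℕ) :
    heavySum w q (j + 1) ≤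
      heavySum w q j + ((heavyCount w q (j + 1) : ℝ) - heavyCount w q j) * q ^ j := by
  have hsub : (Finset.univ.filter fun i => q ^ j ≤ w i) ⊆
      Finset.univ.filter fun i => q ^ (j + 1) ≤ w i := by
    intro i hi
    simp only [Finset.mem_filter, Finset.mem_univ, true_and] at hi ⊢
    exact (pow_le_pow_of_le_one hq0 hq1 (by omega)).trans hi
  rw [heavySum, ← Finset.sum_sdiff hsub, heavySum, add_comm]
  gcongr
  refine (Finset.sum_le_card_nsmul _ _ (q ^ j) fun i hi => ?_).trans ?_
  · simp only [Finset.mem_sdiff, Finset.mem_filter, Finset.mem_univ, true_and] at hi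
    exact (not_le.mp hi.2).le
  · rw [Finset.card_sdiff_of_subset hsub, nsmul_eq_mul, Nat.cast_sub (Finset.card_le_card hsub)]
    rfl

theorem one_sub_le_heavySum (hsum : ∑ i, w i = 1) (j : ℕ) (hq0 : 0 ≤ q) :
    1 - n * q ^ j ≤ heavySum w q j := by
  have h := Finset.sum_filter_add_sum_filter_not Finset.univ (fun i => q ^ j ≤ w i) w
  rw [hsum] at h
  have h2 : ∑ i ∈ Finset.univ.filter (fun i => ¬ q ^ j ≤ w i), w i ≤ n * q ^ j := by
    refine (Finset.sum_le_card_nsmul _ _ (q ^ j) fun i hi => ?_).trans ?_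
    · simp only [Finset.mem_filter, Finset.mem_univ, true_and] at hi
      exact (not_le.mp hi).le
    · rw [nsmul_eq_mul]
      gcongr
      simpa using Finset.card_le_univ (Finset.univ.filter fun i => ¬ q ^ j ≤ w i)
  rw [heavySum]
  linarith

/-- For decreasing weights the heavy ones occupy an initial segment of the indices. -/
theorem le_of_lt_heavyCount (hw : Antitone w) {j : ℕ} {k : Fin n} (h : k.val < heavyCount w q j) :
    q ^ j ≤ w k := by
  by_contra hlt
  have hsub : (Finset.univ.filter fun i => q ^ j ≤ w i) ⊆ Finset.Iio k := by
    intro i hi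
    simp only [Finset.mem_filter, Finset.mem_univ, true_and, Finset.mem_Iio] at hi ⊢
    by_contra hik
    exact hlt (hi.trans (hw (not_lt.mp hik)))
  have := Finset.card_le_card hsub
  rw [Fin.card_Iio] at this
  rw [heavyCount] at h
  omega

end Weights

/-- Bernoulli's inequality gives `(1 + 1 / M) ^ M ≥ 2`. -/
theorem two_pow_le_one_add_inv_pow {M : ℕ} (hM : 0 < M) (G : ℕ) :
    (2 : ℝ) ^ G ≤ (1 + 1 / (M : ℝ)) ^ (M * G) := by
  rw [pow_mul]
  gcongr
  have hM' : (0 : ℝ) < M := by exact_mod_cast hM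
  have h : (-2 : ℝ) ≤ 1 / M := by
    have : 0 < 1 / (M : ℝ) := by positivity
    linarith
  have h2 := one_add_mul_le_pow h M
  rw [mul_one_div_cancel hM'.ne'] at h2
  linarith

/-- Every decreasing sequence of weights is approximated by a path with a short code. -/
theorem exists_code {n M G : ℕ} (hn : 0 < n) (hM : 2 ≤ M) (hG : n * M ≤ 2 ^ G)
    (hG' : 2 ^ G ≤ 2 * (n * M)) {w : Fin n → ℝ} (hw : Antitone w) (hw0 : ∀ i, 0 ≤ w i)
    (hsum : ∑ i, w i = 1) {q : ℝ} (hq : 1 - 1 / (M : ℝ) ≤ q) (hqγ : q * (1 + 1 / (M : ℝ)) ≤ 1) :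
    ∃ code < (2 * (n * M)) ^ (4 * M), ∃ js : List ℕ,
      (walk n M code (4 * M * (n * M))).2 = js ∧ js.length ≤ n ∧
      1 - 3 / (M : ℝ) ≤ (js.map fun l => q ^ l).sum ∧ (∀ l ∈ js, l ≤ M * G) ∧
      ∀ i < js.length, ∀ k : Fin n, k.val = js.length - 1 - i → q ^ js.getD i 0 ≤ w k := by
  have hM0 : (0 : ℝ) < M := by exact_mod_cast (by omega : 0 < M)
  have hM2 : (2 : ℝ) ≤ M := by exact_mod_cast hM
  have hn0 : (0 : ℝ) < n := by exact_mod_cast hn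
  set x : ℝ := 1 / M with hx
  have hx0 : 0 < x := by positivity
  have hx1 : x ≤ 1 / 2 := by rw [hx]; gcongr
  have hq0 : 0 < q := by linarith
  have hq1 : q ≤ 1 := by nlinarith
  have hw1 : ∀ i, w i ≤ 1 := fun i => by
    rw [← hsum]; exact Finset.single_le_sum (fun i _ => hw0 i) (Finset.mem_univ i)
  have hpow := two_pow_le_one_add_inv_pow (M := M) (by omega) G
  have hGr : (n : ℝ) * M ≤ 2 ^ G := by exact_mod_cast hG
  obtain ⟨o, js, ⟨code, hcode, hwalk⟩, h2, h3, h4, h5, h6, h7⟩ :=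
    exists_path (n := n) (M := M) (by omega) (c := heavyCount w q) heavyCount_le
      (heavyCount_mono hq0.le hq1) (γ := 1 + x) (q := q) (by rw [hx]) hq0.le hq1 (s := heavySum w q)
      (heavySum_zero_le hw1) (Finset.sum_nonneg fun i _ => hw0 i) (heavySum_succ_le hq0.le hq1)
      (M * G)
  have hjn : js.length ≤ n := h3.trans (heavyCount_le _)
  -- One more block would force `2 ^ G ≤ (1 + x) ^ (M * G) ≤ n`, whereas `n * M ≤ 2 ^ G`.
  have ho : o ≤ M * G := by
    by_contra hcon
    rcases h5 with rfl | h5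
    · omega
    · have h8 : (1 + x) ^ (M * G + 1) ≤ (1 + x) ^ o :=
        pow_le_pow_right₀ (by linarith) (by omega)
      have h9 : (1 + x) ^ (M * G) * (1 + x) ≤ n * (1 + x) := by
        rw [← pow_succ]
        refine (h8.trans h5).trans ?_
        rw [mul_comm]
        gcongr
      have h10 := le_of_mul_le_mul_right h9 (by linarith)
      nlinarith
  have hbits : M * G + o ≤ 2 * (M * G) := by omega
  have hGn : G ≤ n * M := by
    by_contra hcon
    have h8 : n * M + 1 ≤ G := by omega
    have h9 : 2 ^ (n * M + 1) ≤ 2 ^ G := Nat.pow_le_pow_right (by norm_num) h8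
    have h10 := (Nat.lt_two_pow_self (n := n * M))
    rw [pow_succ] at h9
    omega
  have hL : M * G + o ≤ 4 * M * (n * M) := by
    have : M * G ≤ M * (n * M) := Nat.mul_le_mul_left _ hGn
    rw [Nat.mul_assoc]
    omega
  refine ⟨code, ?_, js, ?_, hjn, ?_, h6, ?_⟩
  · calc code < 2 ^ (M * G + o) := hcode
      _ ≤ 2 ^ (G * (4 * M)) := Nat.pow_le_pow_right (by norm_num) (by
          rw [show G * (4 * M) = 4 * (M * G) by ring]; omega)
      _ = (2 ^ G) ^ (4 * M) := by rw [pow_mul]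
      _ ≤ _ := Nat.pow_le_pow_left hG' _
  · obtain ⟨k, hk⟩ := Nat.exists_eq_add_of_le hL
    rw [hk, walk_of_lt hcode, hwalk]
  -- The inequality `q * (1 + x) ≤ 1` turns the growth of `(1 + x) ^ (M * G)` into decay of `q ^ (M
  -- * G)`, so the neglected weights total at most `x = 1 / M`.
  · have hqJ : n * q ^ (M * G) ≤ x := by
      have h8 : q ^ (M * G) * (1 + x) ^ (M * G) ≤ 1 := by
        rw [← mul_pow]
        exact pow_le_one₀ (by positivity) hqγ
      have h9 : q ^ (M * G) * (n * M) ≤ 1 :=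
        le_trans (mul_le_mul_of_nonneg_left (hGr.trans hpow) (by positivity)) h8
      rw [hx, le_div_iff₀ hM0]
      linarith
    have h8 := one_sub_le_heavySum hsum (M * G) hq0.le (q := q)
    have h9 : 0 ≤ ((1 + x) * js.length - heavyCount w q (M * G)) * q ^ (M * G) :=
      mul_nonneg (by linarith) (by positivity)
    set A := (js.map fun l => q ^ l).sum
    have h10 : (1 - x) * (1 - x) ≤ (1 + x) * A := by
      calc (1 - x) * (1 - x) ≤ q * heavySum w q (M * G) :=
            mul_le_mul hq (by linarith) (by linarith) hq0.le
        _ ≤ (1 + x) * A := by linarith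
    have h11 : 3 / (M : ℝ) = 3 * x := by rw [hx]; ring
    rw [h11]
    -- The contradiction is `(1 + x) * (1 - 3 * x) = 1 - 2 * x - 3 * x ^ 2 < (1 - x) ^ 2`.
    by_contra hcon
    push Not at hcon
    have h12 : (1 + x) * A < (1 + x) * (1 - 3 * x) := by gcongr
    nlinarith
  · intro i hi k hk
    refine le_of_lt_heavyCount hw ?_
    rw [hk]
    exact h2.lt hi

end Algo

namespace Algo

/-! ### The points of the search -/

/-- The vector with last coordinates `f j`, `j ∈ js`, and zeros in front of them. -/
def padded (n : ℕ) (f : ℕ → ℝ) (js : List ℕ) (i : Fin n) : ℝ :=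
  if i.val + js.length < n then 0 else f (js.getD (i.val + js.length - n) 0)

theorem getElem_replicate_append_map {α : Type*} [Zero α] {n : ℕ} {js : List ℕ}
    (hjs : js.length ≤ n) (g : ℕ → α) {i : ℕ}
    (hi : i < (List.replicate (n - js.length) 0 ++ js.map g).length) :
    (List.replicate (n - js.length) 0 ++ js.map g)[i] =
      if i + js.length < n then 0 else g (js.getD (i + js.length - n) 0) := by
  simp only [List.length_append, List.length_replicate, List.length_map] at hi
  rw [List.getElem_append]
  by_cases h : i + js.length < n
  · rw [if_pos h, dif_pos (by simp; omega)]
    simp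
  · rw [if_neg h, dif_neg (by simp; omega)]
    simp only [List.length_replicate, List.getElem_map]
    have e : i - (n - js.length) = i + js.length - n := by omega
    have h2 : i + js.length - n < js.length := by omega
    simp only [e, List.getD_eq_getElem _ _ h2]

theorem sum_padded {n : ℕ} {js : List ℕ} (hjs : js.length ≤ n) (f : ℕ → ℝ) :
    ∑ i, padded n f js i = (js.map f).sum := by
  set l : List ℝ := List.replicate (n - js.length) 0 ++ js.map f with hl
  have hlen : l.length = n := by simp [hl, hjs]
  have h1 : l.sum = (js.map f).sum := by simp [hl]
  rw [← h1]
  have h2 : ∑ i : Fin l.length, l[i] = l.sum := Fin.sum_univ_getElem l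
  rw [← h2]
  refine Fintype.sum_equiv (finCongr hlen.symm) _ _ fun i => ?_
  exact (getElem_replicate_append_map hjs f _).symm

/-- The base of the geometric progressions. -/
noncomputable def base (c : Params) : ℝ := ((c.R : ℝ) + 1) / c.R

theorem ratio_pow_eq (c : Params) : ((c.R : ℝ) / (c.R + 1)) ^ c.B = (base c ^ c.B)⁻¹ := by
  rw [base, ← inv_pow, inv_div]

theorem cast_coordVal (c : Params) (T l : ℕ) :
    ((coordVal c T l : ℚ) : ℝ) = base c ^ (T - c.m * l) / 2 ^ c.P := by
  simp only [coordVal, base]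
  push_cast
  rw [div_pow, div_div, mul_comm (2 ^ c.P : ℝ)]

theorem cast_coords {n : ℕ} {c : Params} (hn : c.n = n) (T code : ℕ) (i : Fin n)
    (hi : i.val < (coords c T code).length) :
    padded n (fun l => base c ^ (T - c.m * l) / 2 ^ c.P) (levels c code) i =
      ((coords c T code)[i] : ℚ) := by
  have h := getElem_replicate_append_map (length_levels_le c code) (coordVal c T) (i := i.val) hi
  refine Eq.trans ?_ (congrArg (fun x : ℚ => (x : ℝ)) h.symm)
  simp only [padded, hn]
  split_ifs
  · simp
  · rw [cast_coordVal]

/-- The relations between the parameters. -/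
structure Suits (c : Params) (n M H : ℕ) (θ : ℝ) : Prop where
  n_eq : c.n = n
  M_eq : 2 ^ c.mu = M
  B_eq : c.B = n * M * M
  R_eq : c.R = n * M * M * M
  P_eq : c.P = 2 * H + 2 * (n * M) + 4
  Z_eq : c.Z = (2 * (n * M)) ^ (4 * M)
  L_eq : c.L = 4 * M * (n * M)
  Tm_eq : c.Tm = n * M * M * M * (2 * H + 2 * (n * M) + 4 + n + 2 * H + 1)
  m_le : (c.m : ℝ) ≤ c.B * θ
  le_m : c.B * θ - 3 ≤ c.m
  two_le_n : 2 ≤ n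
  M_ge : 24 ≤ M

/-! ### Estimates for powers of the base -/

namespace Suits

variable {c : Params} {n M H : ℕ} {θ : ℝ}

theorem even_R (hc : Suits c n M H θ) : Even c.R := by
  have h := hc.M_eq
  have hmu : c.mu ≠ 0 := by
    intro h0
    have := hc.M_ge
    rw [h0] at h
    omega
  have hM : Even M := by
    rw [← h]
    exact (Nat.even_pow.mpr ⟨even_two, hmu⟩)
  rw [hc.R_eq]
  exact hM.mul_left _

theorem M_pos (hc : Suits c n M H θ) : (0 : ℝ) < M := by
  have := hc.M_ge
  exact_mod_cast (by omega : 0 < M)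

theorem n_pos (hc : Suits c n M H θ) : (0 : ℝ) < n := by
  have := hc.two_le_n
  exact_mod_cast (by omega : 0 < n)

theorem R_pos (hc : Suits c n M H θ) : (0 : ℝ) < c.R := by
  rw [hc.R_eq]
  push_cast
  have := hc.M_pos
  have := hc.n_pos
  positivity

theorem R_ne_zero (hc : Suits c n M H θ) : c.R ≠ 0 := by exact_mod_cast hc.R_pos.ne'

theorem B_div_R (hc : Suits c n M H θ) : (c.B : ℝ) / c.R = 1 / M := by
  have := hc.M_pos
  have := hc.n_pos
  rw [hc.B_eq, hc.R_eq]
  push_cast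
  field_simp

theorem base_eq (hc : Suits c n M H θ) : base c = 1 + 1 / c.R := by
  have := hc.R_pos
  rw [base]
  field_simp

theorem one_lt_base (hc : Suits c n M H θ) : 1 < base c := by
  have := hc.R_pos
  have h : 0 < 1 / (c.R : ℝ) := by positivity
  rw [hc.base_eq]
  linarith

theorem ratio_pow_rpow (hc : Suits c n M H θ) (l : ℕ) :
    ((((c.R : ℝ) / (c.R + 1)) ^ c.B) ^ l) ^ θ = base c ^ (-(c.B * θ * l)) := by
  have hb : 0 ≤ base c := by linarith [hc.one_lt_base]
  rw [ratio_pow_eq, ← Real.rpow_natCast, ← Real.rpow_natCast (base c), ← Real.rpow_neg hb,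
    ← Real.rpow_mul hb, ← Real.rpow_mul hb]
  congr 1
  ring

/-- Because `m ≤ B * θ`, coordinates are never below their ideal values; truncating the exponent at
zero only enlarges them. Soundness rests on this. -/
theorem mul_ratio_le (hc : Suits c n M H θ) (T l : ℕ) :
    base c ^ T * ((((c.R : ℝ) / (c.R + 1)) ^ c.B) ^ l) ^ θ ≤ base c ^ (T - c.m * l) := by
  have hb := hc.one_lt_base
  rw [hc.ratio_pow_rpow, ← Real.rpow_natCast (base c) T, ← Real.rpow_natCast (base c) (T - _),
    ← Real.rpow_add (by linarith)]
  refine Real.rpow_le_rpow_of_exponent_le hb.le ?_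
  have h3 : (T : ℝ) ≤ ((T - c.m * l : ℕ) : ℝ) + c.m * l := by
    exact_mod_cast (by omega : T ≤ T - c.m * l + c.m * l)
  have h4 : (c.m : ℝ) * l ≤ c.B * θ * l := by gcongr; exact hc.m_le
  linarith

/-- Each level overshoots by at most a factor `base ^ 3`, as `m` falls short of `B * θ` by at most
3. -/
theorem le_mul_ratio (hc : Suits c n M H θ) {T l J : ℕ} (hT : c.m * l ≤ T) (hl : l ≤ J) :
    base c ^ (T - c.m * l) ≤
      base c ^ T * base c ^ (3 * J) * ((((c.R : ℝ) / (c.R + 1)) ^ c.B) ^ l) ^ θ := by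
  have hb := hc.one_lt_base
  rw [hc.ratio_pow_rpow, ← pow_add, ← Real.rpow_natCast (base c) (T + _),
    ← Real.rpow_natCast (base c) (T - _), ← Real.rpow_add (by linarith)]
  refine Real.rpow_le_rpow_of_exponent_le hb.le ?_
  push_cast [Nat.cast_sub hT]
  have h3 : (l : ℝ) ≤ J := by exact_mod_cast hl
  have h4 : (c.B * θ - 3) * l ≤ (c.m : ℝ) * l := by gcongr; exact hc.le_m
  linarith

/-- Bernoulli's inequality for `1 - 1 / (R + 1)`, with `B / R = 1 / M`. -/
theorem le_ratio (hc : Suits c n M H θ) : 1 - 1 / (M : ℝ) ≤ ((c.R : ℝ) / (c.R + 1)) ^ c.B := by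
  have hR := hc.R_pos
  have h1 : (-2 : ℝ) ≤ -(1 / (c.R + 1)) := by
    have : 1 / ((c.R : ℝ) + 1) ≤ 1 := by
      rw [div_le_one (by linarith)]; linarith
    linarith
  have h2 := one_add_mul_le_pow h1 c.B
  have h3 : 1 + -(1 / ((c.R : ℝ) + 1)) = c.R / (c.R + 1) := by field_simp; ring
  rw [h3] at h2
  refine le_trans ?_ h2
  rw [← hc.B_div_R]
  have h4 : (c.B : ℝ) / (c.R + 1) ≤ c.B / c.R := by gcongr; linarith
  have h5 : (c.B : ℝ) * -(1 / (c.R + 1)) = -(c.B / (c.R + 1)) := by ring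
  linarith

/-- Bernoulli's inequality for the reciprocal: `base ^ B ≥ 1 + B / R = 1 + 1 / M`. -/
theorem ratio_mul_le (hc : Suits c n M H θ) :
    ((c.R : ℝ) / (c.R + 1)) ^ c.B * (1 + 1 / (M : ℝ)) ≤ 1 := by
  have hR := hc.R_pos
  have hb := hc.one_lt_base
  rw [ratio_pow_eq, ← hc.B_div_R, inv_mul_le_one₀ (by positivity)]
  have h2 := one_add_mul_le_pow (a := 1 / (c.R : ℝ)) (by
    have : 0 < 1 / (c.R : ℝ) := by positivity
    linarith) c.B
  rw [hc.base_eq]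
  calc 1 + (c.B : ℝ) / c.R = 1 + c.B * (1 / c.R) := by ring
    _ ≤ _ := h2

theorem tolerance_eq (hc : Suits c n M H θ) : (tolerance c : ℝ) = 1 / (2 ^ c.P * (n * M)) := by
  simp only [tolerance, hc.n_eq]
  push_cast
  rw [← hc.M_eq]
  push_cast
  rfl

theorem tolerance_mul (hc : Suits c n M H θ) : n * (tolerance c : ℝ) = 1 / 2 ^ c.P / M := by
  have := hc.M_pos
  have := hc.n_pos
  rw [hc.tolerance_eq]
  field_simp

theorem base_pow_le_exp (hc : Suits c n M H θ) (k : ℕ) : base c ^ k ≤ Real.exp (k / c.R) := by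
  have hR := hc.R_pos
  rw [hc.base_eq]
  calc (1 + 1 / (c.R : ℝ)) ^ k ≤ Real.exp (1 / c.R) ^ k := by
        gcongr
        linarith [Real.add_one_le_exp (1 / (c.R : ℝ))]
    _ = Real.exp (k / c.R) := by rw [← Real.exp_nat_mul]; congr 1; ring

theorem two_le_base_pow (hc : Suits c n M H θ) : 2 ≤ base c ^ c.R := by
  have hR := hc.R_pos
  have h2 := one_add_mul_le_pow (a := 1 / (c.R : ℝ)) (by
    have : 0 < 1 / (c.R : ℝ) := by positivity
    linarith) c.R
  rw [hc.base_eq]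
  rw [mul_one_div_cancel hR.ne'] at h2
  linarith

end Suits

/-! ### Soundness and completeness of the search -/

section Search

variable {n M H : ℕ} {N : Seminorm ℝ (Fin n → ℝ)} {p : ENNReal} [hp : Fact (1 ≤ p)] {h : ℝ}
  {c : Params} {ans : OraclePort → List TapeSymbol → ℕ} {O : List TapeSymbol → List TapeSymbol}

/-- Soundness of the search. -/
theorem Good.le_diam (hN : IsSymmetricNorm N) (hlow : ∀ i, 1 / Real.exp h ≤ N (Pi.single i 1))
    (hc : Suits c n M H (p⁻¹).toReal) (hO : IsWeakMembershipOracle (unitBallIn 2 N) O)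
    (hans : ∀ w, ans .body w = strVal (O w)) {T : ℕ} (hT : Good ans c T) :
    2 * (base c ^ T / 2 ^ c.P * (1 - 5 / M)) ≤ Metric.diam (unitBallIn p N) := by
  obtain ⟨code, -, h1, h2⟩ := hT
  have hb := hc.one_lt_base
  have hR := hc.R_pos
  have hM := hc.M_pos
  have hMc : (2 : ℝ) ^ c.mu = M := by exact_mod_cast hc.M_eq
  have hlen : (levels c code).length ≤ n := hc.n_eq ▸ length_levels_le c code
  set q := ((c.R : ℝ) / (c.R + 1)) ^ c.B with hq
  have hq0 : 0 < q := by positivity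
  have hw : ∀ l, 0 < q ^ l := fun l => by positivity
  rw [hans] at h1
  have hmem := (answer_question hO hc.n_eq (by have := hc.two_le_n; omega) hc.even_R
    hc.R_ne_zero T code (cast_coords hc.n_eq T code)).2.2.1 h1
  -- No scale is below `1 / 2 ^ P`, so `n` times the tolerance is at most the fraction `1 / M` of
  -- any scale.
  have hTP : 1 / 2 ^ c.P ≤ base c ^ T / 2 ^ c.P := by
    gcongr
    exact one_le_pow₀ hb.le
  refine mul_le_diam_of_mem_cthickening hN hlow (w := padded n (fun l => q ^ l) (levels c code))
    (ε := tolerance c) ?_ (by positivity) ?_ ?_ ?_ ?_ ?_ hmem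
  · intro i
    simp only [padded]
    split_ifs
    · exact le_rfl
    · exact (hw _).le
  · have := hc.M_ge
    exact_mod_cast (by omega : 3 < M)
  · rw [sum_padded hlen]
    rw [hMc] at h2
    change (M : ℝ) ≤ 3 + M * ((levels c code).map fun l => q ^ l).sum at h2
    have e : 1 - 3 / (M : ℝ) = (M - 3) / M := by field_simp
    rw [e, div_le_iff₀ hM]
    linarith
  · intro i hi
    simp only [padded] at hi ⊢
    split_ifs at hi ⊢
    · exact absurd hi (lt_irrefl _)
    · set l := (levels c code).getD (i.val + (levels c code).length - n) 0
      have hb0 : 0 < base c := by linarith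
      rw [abs_of_nonneg (by positivity), div_mul_eq_mul_div]
      gcongr
      exact hc.mul_ratio_le T l
  · rw [hc.tolerance_eq]
    have := hc.n_pos
    positivity
  · rw [hc.tolerance_mul]
    gcongr

/-- Completeness of the search. -/
theorem exists_good (hN : IsSymmetricNorm N) (hup : ∀ i, N (Pi.single i 1) ≤ Real.exp h)
    (hhH : h ≤ H) (hc : Suits c n M H (p⁻¹).toReal)
    (hO : IsWeakMembershipOracle (unitBallIn 2 N) O)
    (hans : ∀ w, ans .body w = strVal (O w)) {z : PiLp p fun _ : Fin n => ℝ}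
    (hz : z ∈ unitBallIn p N) (hz0 : z ≠ 0) {T G : ℕ} (hG : n * M ≤ 2 ^ G)
    (hG' : 2 ^ G ≤ 2 * (n * M)) (hGn : G ≤ n * M)
    (hT : base c ^ T / 2 ^ c.P ≤ ‖z‖ * (1 - 4 / M)) (hTB : c.B * (M * G) ≤ T) :
    Good ans c T := by
  obtain ⟨w₀, hw₀, hsum₀, hzw₀⟩ := PiLp.exists_weights hz0
  have hb := hc.one_lt_base
  have hR := hc.R_pos
  have hM := hc.M_pos
  have hM24 : (24 : ℝ) ≤ M := by exact_mod_cast hc.M_ge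
  have hMc : (2 : ℝ) ^ c.mu = M := by exact_mod_cast hc.M_eq
  set ρ := ‖z‖ with hρ
  have hρ0 : 0 < ρ := norm_pos_iff.mpr hz0
  set θ := (p⁻¹).toReal with hθ
  have hθ0 : 0 ≤ θ := ENNReal.toReal_nonneg
  have hθ1 : θ ≤ 1 := by
    have : p⁻¹ ≤ 1 := ENNReal.inv_le_one.mpr hp.out
    simpa [hθ] using ENNReal.toReal_mono ENNReal.one_ne_top this
  -- Arrange the weights in decreasing order, against the order of the coordinates of the points.
  set σ : Equiv.Perm (Fin n) := Fin.revPerm.trans (Tuple.sort w₀) with hσ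
  set w : Fin n → ℝ := fun i => w₀ (σ i) with hw
  have hanti : Antitone w := by
    intro i j hij
    exact Tuple.monotone_sort w₀ (Fin.rev_le_rev.mpr hij)
  have hsum : ∑ i, w i = 1 := by rw [← hsum₀]; exact Equiv.sum_comp σ w₀
  set q := ((c.R : ℝ) / (c.R + 1)) ^ c.B with hq
  have hq0 : 0 < q := by positivity
  obtain ⟨code, hcode, js, hjs, hlen, hA, hJ, hdom⟩ := exists_code (G := G)
    (by have := hc.two_le_n; omega) (by have := hc.M_ge; omega) hG hG' hanti
    (fun i => hw₀ _) hsum hc.le_ratio hc.ratio_mul_le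
  have hlev : levels c code = js := by
    rw [levels, hc.n_eq, hc.M_eq, hc.L_eq, hjs]
  refine ⟨code, by rw [hc.Z_eq]; exact hcode, ?_, ?_⟩
  swap
  · rw [hMc]
    change (M : ℝ) ≤ 3 + M * ((levels c code).map fun l => q ^ l).sum
    rw [hlev]
    have e : 1 - 3 / (M : ℝ) = (M - 3) / M := by field_simp
    rw [e, div_le_iff₀ hM] at hA
    linarith
  rw [hans]
  refine (answer_question hO hc.n_eq (by have := hc.two_le_n; omega) hc.even_R
    hc.R_ne_zero T code (cast_coords hc.n_eq T code)).2.2.2 ?_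
  refine closedBall_subset_unitBallIn hup (M := M) ?_ ?_
  swap
  · rw [hc.tolerance_mul, div_mul_eq_mul_div]
    gcongr
    rw [one_div, inv_mul_le_one₀ (by positivity), hc.P_eq]
    calc Real.exp h ≤ Real.exp H := Real.exp_le_exp.mpr hhH
      _ = Real.exp 1 ^ H := by rw [← Real.exp_nat_mul, mul_one]
      _ ≤ (2 ^ 2) ^ H := by
          gcongr
          linarith [Real.exp_one_lt_d9]
      _ = 2 ^ (2 * H) := by rw [pow_mul]
      _ ≤ _ := pow_le_pow_right₀ (by norm_num) (by omega)
  rw [hlev]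
  set K := base c ^ (3 * (M * G)) with hK
  have hK0 : 0 < K := by positivity
  set t := base c ^ T / 2 ^ c.P with ht
  have ht0 : 0 < t := by positivity
  -- The point of the question is dominated by a multiple of a rearrangement of `z`; monotonicity
  -- and symmetry then bound its norm.
  have hbound : ∀ i, |padded n (fun l => base c ^ (T - c.m * l) / 2 ^ c.P) js i| ≤
      |(t * K / ρ) * z (σ (Fin.revPerm i))| := by
    intro i
    simp only [padded]
    split_ifs with hi
    · rw [abs_zero]; exact abs_nonneg _
    · set l := js.getD (i.val + js.length - n) 0 with hl
      have hil : i.val + js.length - n < js.length := by omega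
      have hlJ : l ≤ M * G := hJ l (by
        rw [hl, List.getD_eq_getElem _ _ hil]
        exact List.getElem_mem hil)
      have hwl : q ^ l ≤ w (Fin.revPerm i) := hdom _ hil _ (by
        simp only [Fin.revPerm_apply, Fin.val_rev]; omega)
      have hzl : ρ * w (Fin.revPerm i) ^ θ ≤ |z (σ (Fin.revPerm i))| :=
        hzw₀ _ (lt_of_lt_of_le (by positivity) hwl)
      have h1 : (q ^ l) ^ θ ≤ w (Fin.revPerm i) ^ θ := by gcongr
      -- This keeps the exponent `T - m * l` from being truncated; it uses `m ≤ B`, which holds as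
      -- `θ ≤ 1`.
      have hml : c.m * l ≤ T := by
        refine le_trans (Nat.mul_le_mul ?_ hlJ) hTB
        have : (c.m : ℝ) ≤ c.B := hc.m_le.trans (mul_le_of_le_one_right (by positivity) hθ1)
        exact_mod_cast this
      have h2 : base c ^ (T - c.m * l) / 2 ^ c.P ≤ t * K * (q ^ l) ^ θ := by
        rw [ht, div_mul_eq_mul_div, div_mul_eq_mul_div]
        gcongr
        exact hc.le_mul_ratio hml hlJ
      rw [abs_of_nonneg (by positivity), abs_mul, abs_of_nonneg (by positivity : 0 ≤ t * K / ρ)]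
      calc base c ^ (T - c.m * l) / 2 ^ c.P ≤ t * K * (q ^ l) ^ θ := h2
        _ ≤ t * K * w (Fin.revPerm i) ^ θ := by gcongr
        _ = t * K / ρ * (ρ * w (Fin.revPerm i) ^ θ) := by field_simp
        _ ≤ _ := by gcongr
  -- With `x = 1 / M`, one has `K ≤ exp (3 * x)`, `exp (3 * x) * (1 - 3 * x) ≤ 1` and `1 - 4 * x ≤
  -- (1 - x) * (1 - 3 * x)`.
  have hKM : K * (1 - 4 / M) ≤ 1 - 1 / M := by
    have h1 : K ≤ Real.exp (3 / M) := by
      refine (hc.base_pow_le_exp _).trans (Real.exp_le_exp.mpr ?_)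
      rw [div_le_div_iff₀ hR hM, hc.R_eq]
      push_cast
      have : (G : ℝ) ≤ n * M := by exact_mod_cast hGn
      have h5 : (M : ℝ) * M * G ≤ M * M * (n * M) := by gcongr
      nlinarith
    have h2 : Real.exp (3 / M) * (1 - 3 / M) ≤ 1 := by
      have h3 := Real.add_one_le_exp (-(3 / (M : ℝ)))
      calc Real.exp (3 / M) * (1 - 3 / M) ≤ Real.exp (3 / M) * Real.exp (-(3 / M)) := by
            gcongr; linarith
        _ = 1 := by rw [← Real.exp_add]; simp
    set x : ℝ := 1 / M with hx
    have e3 : 3 / (M : ℝ) = 3 * x := by rw [hx]; ring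
    have e4 : 4 / (M : ℝ) = 4 * x := by rw [hx]; ring
    have hx0 : 0 < x := by positivity
    have hx1 : x ≤ 1 / 24 := by rw [hx]; gcongr
    rw [e3] at h1 h2
    rw [e4]
    have h6 : K * (1 - 3 * x) ≤ 1 := (mul_le_mul_of_nonneg_right h1 (by linarith)).trans h2
    have h7 : 1 - 4 * x ≤ (1 - x) * (1 - 3 * x) := by nlinarith
    calc K * (1 - 4 * x) ≤ K * ((1 - x) * (1 - 3 * x)) := by gcongr
      _ = (1 - x) * (K * (1 - 3 * x)) := by ring
      _ ≤ (1 - x) * 1 := mul_le_mul_of_nonneg_left h6 (by linarith)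
      _ = 1 - x := mul_one _
  calc N (padded n (fun l => base c ^ (T - c.m * l) / 2 ^ c.P) js)
      ≤ N (fun i => (t * K / ρ) * z (σ (Fin.revPerm i))) := hN.mono hbound
    _ = t * K / ρ * N (fun i => z ((Fin.revPerm.trans σ) i)) := by
        have := map_smul_eq_mul N (t * K / ρ) (fun i => z ((Fin.revPerm.trans σ) i))
        rw [Real.norm_of_nonneg (by positivity)] at this
        exact this
    _ = t * K / ρ * N (WithLp.ofLp z) := by rw [hN.apply_perm]
    _ ≤ t * K / ρ * 1 := by gcongr; exact hz
    _ ≤ 1 - 1 / M := by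
        refine le_trans ?_ hKM
        rw [mul_one, div_le_iff₀ hρ0]
        calc t * K ≤ ρ * (1 - 4 / M) * K := by gcongr
          _ = _ := by ring

end Search

end Algo

/-! ### Accuracy of the best scale -/

namespace Algo

theorem exp_natCast_le_two_pow (k : ℕ) : Real.exp k ≤ 2 ^ (2 * k) := by
  calc Real.exp k = Real.exp 1 ^ k := by rw [← Real.exp_nat_mul, mul_one]
    _ ≤ (2 ^ 2) ^ k := by
        gcongr
        linarith [Real.exp_one_lt_d9]
    _ = 2 ^ (2 * k) := by rw [pow_mul]

variable {n M H : ℕ} {N : Seminorm ℝ (Fin n → ℝ)} {p : ENNReal} [hp : Fact (1 ≤ p)] {h : ℝ}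
  {c : Params} {ans : OraclePort → List TapeSymbol → ℕ} {O : List TapeSymbol → List TapeSymbol}

/-- There is a good scale that nearly attains the diameter. -/
theorem exists_good_near_diam (hN : IsSymmetricNorm N)
    (hlow : ∀ i, 1 / Real.exp h ≤ N (Pi.single i 1)) (hup : ∀ i, N (Pi.single i 1) ≤ Real.exp h)
    (hhH : h ≤ H) (hc : Suits c n M H (p⁻¹).toReal)
    (hO : IsWeakMembershipOracle (unitBallIn 2 N) O)
    (hans : ∀ w, ans .body w = strVal (O w)) :
    ∃ T < c.Tm, Good ans c T ∧
      (1 - 6 / M) * Metric.diam (unitBallIn p N) ≤ 2 * (base c ^ T / 2 ^ c.P) := by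
  have hb := hc.one_lt_base
  have hR := hc.R_pos
  have hM := hc.M_pos
  have hn := hc.n_pos
  have hM24 : (24 : ℝ) ≤ M := by exact_mod_cast hc.M_ge
  have hn2 := hc.two_le_n
  have hMN := hc.M_ge
  have hd := exp_neg_le_diam (p := p) hN (by omega) hlow hup
  set d := Metric.diam (unitBallIn p N) with hdd
  have hd0 : 0 < d := lt_of_lt_of_le (by positivity) hd
  set x : ℝ := 1 / M with hx
  have hx0 : 0 < x := by positivity
  have hx1 : x ≤ 1 / 24 := by rw [hx]; gcongr
  have e4 : 4 / (M : ℝ) = 4 * x := by rw [hx]; ring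
  have e6 : 6 / (M : ℝ) = 6 * x := by rw [hx]; ring
  obtain ⟨z, hz, hzd⟩ := exists_norm_near_diam (p := p) (N := N) hx0 hd0
  rw [← hdd] at hzd
  have hρ : Real.exp (-h) * (1 - x) ≤ ‖z‖ := by nlinarith
  have hρ0 : 0 < ‖z‖ := lt_of_lt_of_le (mul_pos (Real.exp_pos _) (by linarith)) hρ
  have hz0 : z ≠ 0 := norm_pos_iff.mp hρ0
  have hρup := norm_le_of_mem_unitBallIn hN hlow hz
  set ρ := ‖z‖
  have hexpH : Real.exp h ≤ 2 ^ (2 * H) :=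
    (Real.exp_le_exp.mpr hhH).trans (exp_natCast_le_two_pow H)
  set G := Nat.clog 2 (n * M) with hG
  have hnM : 1 < n * M := by nlinarith
  have hG1 : n * M ≤ 2 ^ G := Nat.le_pow_clog (by norm_num) _
  have hG0 : 0 < G := Nat.clog_pos (by norm_num) hnM
  have hG2 : 2 ^ (G - 1) < n * M := Nat.pow_pred_clog_lt_self (by norm_num) hnM
  have hG3 : 2 ^ G ≤ 2 * (n * M) := by
    have : 2 ^ G = 2 * 2 ^ (G - 1) := by rw [← pow_succ']; congr 1; omega
    omega
  have hG4 : G ≤ n * M := by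
    have := Nat.lt_two_pow_self (n := G - 1)
    omega
  set X := ρ * (1 - 4 * x) * 2 ^ c.P with hX
  -- The exponent of a usable scale is at least `B * M * G`; the summand `2 * n * M` in `P` makes
  -- room for this offset.
  have hbJ : base c ^ (c.B * (M * G)) ≤ 2 ^ (2 * (n * M)) := by
    have h1 : ((c.B * (M * G) : ℕ) : ℝ) / c.R = (G : ℕ) := by
      push_cast
      rw [mul_comm, mul_div_assoc, hc.B_div_R]
      field_simp
    refine (hc.base_pow_le_exp _).trans ?_
    rw [h1]
    exact (exp_natCast_le_two_pow G).trans (pow_le_pow_right₀ (by norm_num) (by omega))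
  have hXlow : 2 ^ (2 * (n * M)) ≤ X := by
    have h1 : 1 ≤ Real.exp (-h) * 2 ^ (2 * H) := by
      rw [Real.exp_neg, inv_mul_eq_div, le_div_iff₀ (Real.exp_pos _), one_mul]
      exact hexpH
    -- The summand 4 in `P` pays for this factor.
    have h2 : (1 : ℝ) / 16 ≤ (1 - x) * (1 - 4 * x) := by nlinarith
    calc (2 : ℝ) ^ (2 * (n * M)) = 1 * (1 / 16) * (2 ^ (2 * (n * M)) * 2 ^ 4) := by ring
      _ ≤ (Real.exp (-h) * 2 ^ (2 * H)) * ((1 - x) * (1 - 4 * x)) *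
          (2 ^ (2 * (n * M)) * 2 ^ 4) := by gcongr
      _ = Real.exp (-h) * (1 - x) * (1 - 4 * x) * 2 ^ c.P := by rw [hc.P_eq]; ring
      _ ≤ X := by
          rw [hX]
          have : 0 ≤ 1 - 4 * x := by linarith
          gcongr
  have hX1 : 1 ≤ X := (one_le_pow₀ (by norm_num)).trans hXlow
  -- The largest `T` whose scale is at most `ρ * (1 - 4 / M)`, as completeness demands.
  obtain ⟨T, hT1, hT2⟩ := exists_nat_pow_near hX1 hb
  have hTB : c.B * (M * G) ≤ T := by
    have := (pow_lt_pow_iff_right₀ hb).mp ((hbJ.trans hXlow).trans_lt hT2)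
    omega
  have hTm : T < c.Tm := by
    rw [← pow_lt_pow_iff_right₀ hb]
    have h1 : X ≤ n * 2 ^ (2 * H) * 2 ^ c.P := by
      refine mul_le_mul_of_nonneg_right ?_ (by positivity)
      calc ρ * (1 - 4 * x) ≤ ρ * 1 := by gcongr; linarith
        _ ≤ n * 2 ^ (2 * H) := by rw [mul_one]; refine hρup.trans ?_; gcongr
    have h2 : (n : ℝ) < 2 ^ n := by exact_mod_cast Nat.lt_two_pow_self
    calc base c ^ T ≤ n * 2 ^ (2 * H) * 2 ^ c.P := hT1.trans h1
      _ ≤ 2 ^ n * 2 ^ (2 * H) * 2 ^ c.P := by gcongr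
      _ < 2 ^ n * 2 ^ (2 * H) * 2 ^ c.P * 2 := by
          have : (0 : ℝ) < 2 ^ n * 2 ^ (2 * H) * 2 ^ c.P := by positivity
          linarith
      _ = 2 ^ (2 * H + 2 * (n * M) + 4 + n + 2 * H + 1) := by rw [hc.P_eq]; ring
      _ ≤ (base c ^ c.R) ^ (2 * H + 2 * (n * M) + 4 + n + 2 * H + 1) := by
          gcongr
          exact hc.two_le_base_pow
      _ = base c ^ c.Tm := by rw [← pow_mul, hc.Tm_eq, hc.R_eq]
  refine ⟨T, hTm, ?_, ?_⟩
  · refine exists_good hN hup hhH hc hO hans hz hz0 hG1 hG3 hG4 ?_ hTB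
    rw [div_le_iff₀ (by positivity), e4]
    exact hT1
  · have h1 : ρ * (1 - 4 * x) < base c * (base c ^ T / 2 ^ c.P) := by
      have e : base c * (base c ^ T / 2 ^ c.P) = base c ^ (T + 1) / 2 ^ c.P := by ring
      rw [e, lt_div_iff₀ (by positivity)]
      exact hT2
    have hbx : base c ≤ 1 + x := by
      rw [hc.base_eq, hx]
      gcongr
      rw [hc.R_eq]
      exact_mod_cast Nat.le_mul_of_pos_left M (by positivity)
    set t := base c ^ T / 2 ^ c.P
    have ht0 : 0 < t := by positivity
    have h2 : (1 - x) * (1 - 4 * x) * d ≤ (1 + x) * (2 * t) := by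
      have h3 : 0 ≤ 1 - 4 * x := by linarith
      have h4 : base c * t ≤ (1 + x) * t := by gcongr
      nlinarith
    rw [e6]
    -- The losses are `x` for the choice of `z`, `4 * x` in the search and `x` for the spacing of
    -- the scales.
    have h5 : (1 + x) * (1 - 6 * x) ≤ (1 - x) * (1 - 4 * x) := by nlinarith
    have h6 : (1 + x) * ((1 - 6 * x) * d) ≤ (1 + x) * (2 * t) := by
      refine le_trans ?_ h2
      rw [← mul_assoc]
      gcongr
    exact le_of_mul_le_mul_left h6 (by linarith)

/-- The best good scale approximates the diameter. -/
theorem search_accuracy (hN : IsSymmetricNorm N)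
    (hlow : ∀ i, 1 / Real.exp h ≤ N (Pi.single i 1)) (hup : ∀ i, N (Pi.single i 1) ≤ Real.exp h)
    (hhH : h ≤ H) (hc : Suits c n M H (p⁻¹).toReal)
    (hO : IsWeakMembershipOracle (unitBallIn 2 N) O)
    (hans : ∀ w, ans .body w = strVal (O w)) {δ : ℝ} (hδ : 12 ≤ M * δ) (hδ1 : δ ≤ 1 / 2) {T : ℕ}
    (hT1 : ∀ T' < c.Tm, Good ans c T' → T' ≤ T)
    (hT2 : (∃ T' < c.Tm, Good ans c T') → Good ans c T) :
    (1 - δ) * Metric.diam (unitBallIn p N) ≤ 2 * (base c ^ T / 2 ^ c.P) ∧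
      2 * (base c ^ T / 2 ^ c.P) ≤ (1 + δ) * Metric.diam (unitBallIn p N) := by
  have hM := hc.M_pos
  have hd0 : 0 ≤ Metric.diam (unitBallIn p N) := Metric.diam_nonneg
  obtain ⟨T', hT', hgood, hnear⟩ :=
    exists_good_near_diam (p := p) hN hlow hup hhH hc hO hans
  have hsound := (hT2 ⟨T', hT', hgood⟩).le_diam (p := p) hN hlow hc hO hans
  have h12 : 12 / (M : ℝ) ≤ δ := by rw [div_le_iff₀ hM]; linarith
  set x : ℝ := 1 / M with hx
  have hx0 : 0 < x := by positivity
  have e5 : 5 / (M : ℝ) = 5 * x := by rw [hx]; ring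
  have e6 : 6 / (M : ℝ) = 6 * x := by rw [hx]; ring
  have e12 : 12 / (M : ℝ) = 12 * x := by rw [hx]; ring
  rw [e12] at h12
  rw [e6] at hnear
  rw [e5] at hsound
  constructor
  · refine le_trans ?_ (hnear.trans ?_)
    · gcongr
      linarith
    · have := hc.one_lt_base.le
      gcongr
      exact hT1 T' hT' hgood
  · set t := 2 * (base c ^ T / 2 ^ c.P) with ht
    have hb := hc.one_lt_base
    have ht0 : 0 < t := by positivity
    have h1 : t * (1 - 5 * x) ≤ Metric.diam (unitBallIn p N) := by
      refine le_trans (le_of_eq ?_) hsound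
      rw [ht]; ring
    -- From `x ≤ δ / 12` and `δ ≤ 1 / 2` follows `5 * x * (1 + δ) ≤ 5 * δ / 8`.
    have h2 : 1 ≤ (1 + δ) * (1 - 5 * x) := by nlinarith
    calc t ≤ t * ((1 + δ) * (1 - 5 * x)) := le_mul_of_one_le_right ht0.le h2
      _ = (1 + δ) * (t * (1 - 5 * x)) := by ring
      _ ≤ _ := by gcongr; linarith

end Algo

/-! ### From the answers to the parameters -/

namespace Algo

variable {ans len : OraclePort → List TapeSymbol → ℕ}

/-- The approximation of `B * θ` errs by at most `B / 2 ^ B ≤ 1`, rounding down loses at most 1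
more, and then 1 is subtracted. This places `m` between `B * θ - 3` and `B * θ`. -/
theorem suits_params {n k : ℕ} {θ : ℝ} (hn : 2 ≤ n) (hk : 24 ≤ 2 ^ (k + 2)) (hθ : 0 ≤ θ)
    (h : |θ - ans .exponent (unaryCode (params ans n k).B) / 2 ^ (params ans n k).B| ≤
      1 / 2 ^ (params ans n k).B) :
    Suits (params ans n k) n (2 ^ (k + 2)) (heightBound ans n) θ := by
  have hm : (params ans n k).m = ans .exponent (unaryCode (params ans n k).B) *
    (params ans n k).B / 2 ^ (params ans n k).B - 1 := by simp only [params]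
  have key : ((params ans n k).m : ℝ) ≤ (params ans n k).B * θ ∧
      (params ans n k).B * θ - 3 ≤ (params ans n k).m := by
    rw [hm]
    generalize (params ans n k).B = B at *
    generalize ans .exponent (unaryCode B) = u at *
    have h2 : (0 : ℝ) < 2 ^ B := by positivity
    have hB : (B : ℝ) / 2 ^ B ≤ 1 := by
      rw [div_le_one h2]
      exact_mod_cast Nat.lt_two_pow_self.le
    obtain ⟨h3, h4⟩ := abs_le.mp h
    have h5 : (u : ℝ) * B / 2 ^ B = B * (u / 2 ^ B) := by ring
    have h6 : (B : ℝ) * (u / 2 ^ B) ≤ B * (θ + 1 / 2 ^ B) := by gcongr; linarith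
    have h7 : (B : ℝ) * (θ - 1 / 2 ^ B) ≤ B * (u / 2 ^ B) := by gcongr; linarith
    have e1 : (B : ℝ) * (θ + 1 / 2 ^ B) = B * θ + B / 2 ^ B := by ring
    have e2 : (B : ℝ) * (θ - 1 / 2 ^ B) = B * θ - B / 2 ^ B := by ring
    have h8 : ((u * B / 2 ^ B : ℕ) : ℝ) ≤ u * B / 2 ^ B := by
      have := Nat.cast_div_le (α := ℝ) (m := u * B) (n := 2 ^ B)
      push_cast at this
      exact this
    have h9 : (u : ℝ) * B / 2 ^ B ≤ ((u * B / 2 ^ B : ℕ) : ℝ) + 1 := by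
      rw [div_le_iff₀ h2]
      have := (Nat.lt_div_mul_add (a := u * B) (b := 2 ^ B) (by positivity)).le
      have h10 : ((u * B : ℕ) : ℝ) ≤ ((u * B / 2 ^ B * 2 ^ B + 2 ^ B : ℕ) : ℝ) := by
        exact_mod_cast this
      rw [Nat.cast_add, Nat.cast_mul (u * B / 2 ^ B)] at h10
      push_cast at h10 ⊢
      linarith
    generalize u * B / 2 ^ B = f at *
    have hB0 : 0 ≤ (B : ℝ) * θ := by positivity
    -- If the quotient is zero, the subtraction of 1 is void, but then `B * θ ≤ 2` and `m = 0` still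
    -- fits.
    rcases Nat.eq_zero_or_pos f with rfl | hf
    · simp only [Nat.zero_sub, Nat.cast_zero] at *
      exact ⟨hB0, by linarith⟩
    · rw [Nat.cast_sub hf, Nat.cast_one]
      exact ⟨by linarith, by linarith⟩
  refine ⟨?_, ?_, ?_, ?_, ?_, ?_, ?_, ?_, key.1, key.2, hn, hk⟩ <;> simp only [params]

/-- The output is the code of a rational number. -/
theorem ratCode_output {c : Params} (hR : Even c.R) (hR0 : c.R ≠ 0) (hP : 1 ≤ c.P) (T : ℕ) :
    ∃ r : ℚ, ratCode r = natCode ((c.R + 1) ^ T) ++ .slash :: natCode (2 ^ c.P / 2 * c.R ^ T) ∧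
      (r : ℝ) = 2 * (base c ^ T / 2 ^ c.P) := by
  obtain ⟨P, hP'⟩ : ∃ P, c.P = P + 1 := ⟨c.P - 1, by omega⟩
  have e : 2 ^ c.P / 2 = 2 ^ P := by rw [hP', pow_succ]; simp
  refine ⟨(((c.R + 1) ^ T : ℕ) : ℚ) / ((2 ^ P * c.R ^ T : ℕ) : ℚ), ?_, ?_⟩
  · rw [ratCode_natCast_div (by positivity) (coprime_succ_pow hR _ _), e]
  · have hR' : (c.R : ℝ) ≠ 0 := by exact_mod_cast hR0
    push_cast
    rw [base, hP', div_pow, pow_succ]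
    field_simp

theorem size_le_of_lt_two_pow {m k : ℕ} (h : m < 2 ^ k) : m.size ≤ k := Nat.size_le.mpr h

/-- The number of digits of the accuracy at which the search stops. -/
theorem exists_accuracy {δ : ℝ} (hδ : 0 < δ) (hδ1 : δ ≤ 1 / 2) {a : ℕ → ℕ}
    (ha : ∀ k, |δ - a k / 2 ^ k| ≤ 1 / 2 ^ k) :
    ∃ k, 1 ≤ k ∧ 3 < a k ∧ (∀ i, 1 ≤ i → i < k → a i ≤ 3) ∧ 3 ≤ 2 ^ k * δ ∧ 2 ^ k * δ ≤ 8 := by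
  have hmul : ∀ k, 2 ^ k * δ - 1 ≤ a k ∧ (a k : ℝ) ≤ 2 ^ k * δ + 1 := by
    intro k
    have h2 : (0 : ℝ) < 2 ^ k := by positivity
    obtain ⟨h3, h4⟩ := abs_le.mp (ha k)
    have h5 : (a k : ℝ) = 2 ^ k * (a k / 2 ^ k) := by field_simp
    have h6 : (2 : ℝ) ^ k * (1 / 2 ^ k) = 1 := by field_simp
    constructor <;> rw [h5] <;> nlinarith
  have hex : ∃ k, 1 ≤ k ∧ 3 < a k := by
    obtain ⟨k, hk⟩ := pow_unbounded_of_one_lt (5 / δ) (by norm_num : (1 : ℝ) < 2)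
    refine ⟨k + 1, by omega, ?_⟩
    have h1 := (hmul (k + 1)).1
    rw [div_lt_iff₀ hδ] at hk
    have h2 : (3 : ℝ) < a (k + 1) := by
      rw [pow_succ] at h1
      nlinarith
    exact_mod_cast h2
  classical
  refine ⟨Nat.find hex, (Nat.find_spec hex).1, (Nat.find_spec hex).2, fun i h1 h2 => ?_, ?_, ?_⟩
  · have := Nat.find_min hex h2
    simp only [not_and, not_lt] at this
    exact this h1
  · have h1 : ((4 : ℕ) : ℝ) ≤ a (Nat.find hex) := by exact_mod_cast (Nat.find_spec hex).2
    push_cast at h1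
    linarith [(hmul (Nat.find hex)).2]
  · obtain ⟨j, hj⟩ : ∃ j, Nat.find hex = j + 1 := ⟨Nat.find hex - 1, by
      have := (Nat.find_spec hex).1; omega⟩
    rw [hj, pow_succ]
    -- Precision 0 is never asked for. If the search stops at `k = 1`, the upper bound comes from `δ
    -- ≤ 1 / 2`.
    rcases Nat.eq_zero_or_pos j with rfl | hj0
    · norm_num; linarith
    · have h2 := Nat.find_min hex (by omega : j < Nat.find hex)
      simp only [not_and, not_lt] at h2
      have h3 : (a j : ℝ) ≤ (3 : ℕ) := by exact_mod_cast h2 hj0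
      push_cast at h3
      linarith [(hmul j).1]

/-! ### The running time -/

/-- The exponent of the running time. -/
noncomputable def timeExponent (D δ : ℝ) : ℕ := ⌊3100 * (D + Real.log (1 / δ) / δ)⌋₊

/-- With `Y = Tm ^ 4 * Z`, the two factors are at most `400 * 304 * Y` and `306 * Y`, and `400 * 304
* 306 < 2 ^ 26`. -/
theorem steps_le {n k : ℕ} (hn : 2 ≤ n) :
    400 * (k * (3 * k + 11) + 290 * (params ans n k).Tm ^ 4 * (params ans n k).Z) *
      (n + (k * (3 * k + 11) + 290 * (params ans n k).Tm ^ 4 * (params ans n k).Z) + 1) + 1 ≤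
    2 ^ 26 * ((params ans n k).Tm ^ 4 * (params ans n k).Z) ^ 2 := by
  obtain ⟨hU, -, hB, -⟩ := params_boundedBy (ans := ans) hn k
  have hZ : 1 ≤ (params ans n k).Z := by
    simp only [params]
    exact Nat.one_le_pow _ _ (Nat.mul_pos (by norm_num) (Nat.mul_pos (by omega) (by positivity)))
  have hk : k * (3 * k + 11) ≤ 14 * (params ans n k).B := by
    have e : (params ans n k).B = n * 2 ^ (k + 2) * 2 ^ (k + 2) := by simp only [params]
    have h1 : k ≤ 2 ^ (k + 2) := (by omega : k ≤ k + 2).trans Nat.lt_two_pow_self.le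
    have h2 : k ≤ n * 2 ^ (k + 2) := h1.trans (Nat.le_mul_of_pos_left _ (by omega))
    rw [e]
    have h3 := Nat.mul_le_mul h2 h1
    have h4 : k ≤ k * k := Nat.le_mul_self k
    nlinarith
  have hn1 : n ≤ (params ans n k).Tm := hU.n
  generalize (params ans n k).Tm = U at *
  generalize (params ans n k).Z = Z at *
  generalize (params ans n k).B = B at *
  have h1 : U ≤ U ^ 4 := Nat.le_self_pow (by norm_num) U
  have h2 : U ^ 4 ≤ U ^ 4 * Z := Nat.le_mul_of_pos_right _ hZ
  rw [Nat.mul_assoc 290]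
  generalize U ^ 4 * Z = Y at *
  have h3 : 400 * (k * (3 * k + 11) + 290 * Y) ≤ 400 * (304 * Y) := Nat.mul_le_mul_left _ (by omega)
  have h4 : n + (k * (3 * k + 11) + 290 * Y) + 1 ≤ 306 * Y := by omega
  have h5 := Nat.mul_le_mul h3 h4
  have h6 : 1 ≤ Y ^ 2 := Nat.one_le_pow _ _ (by omega)
  have e : 400 * (304 * Y) * (306 * Y) = 37209600 * Y ^ 2 := by ring
  omega

/-- Everything is converted to powers of `n`, where `n ≥ 2` absorbs constants: with `1 / δ = 2 ^ g`,
also `1 / δ ≤ n ^ g`. The decisive factor is `Z = (2 * n * M) ^ (4 * M)` with `M ≤ 32 / δ`, whose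
exponent is of order `g / δ`. -/
theorem steps_le_pow {n k : ℕ} {D δ : ℝ} (hn : 2 ≤ n) (hD : 1 ≤ D) (hδ : 0 < δ) (hδ1 : δ ≤ 1 / 2)
    (hk : 24 ≤ 2 ^ (k + 2)) (hkδ : 2 ^ k * δ ≤ 8) (hdeg : (ans .degree [] : ℝ) ≤ D + 1) :
    2 ^ 26 * ((params ans n k).Tm ^ 4 * (params ans n k).Z) ^ 2 ≤ n ^ timeExponent D δ := by
  have hn0 : (0 : ℝ) < n := by exact_mod_cast (by omega : 0 < n)
  have hn1 : (1 : ℝ) ≤ n := by exact_mod_cast (by omega : 1 ≤ n)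
  have hn2 : (2 : ℝ) ≤ n := by exact_mod_cast hn
  set g : ℝ := Real.log (1 / δ) / Real.log 2 with hg
  have hlog2 : 0 < Real.log 2 := Real.log_pos (by norm_num)
  have hδ2 : 2 ≤ 1 / δ := by rw [le_div_iff₀ hδ]; linarith
  have hgl : g * Real.log 2 = Real.log (1 / δ) := by rw [hg]; field_simp
  have hg1 : 1 ≤ g := by
    rw [hg, le_div_iff₀ hlog2, one_mul]
    exact Real.log_le_log (by norm_num) hδ2
  have hδg : 1 / δ = 2 ^ g := by
    rw [Real.rpow_def_of_pos (by norm_num), mul_comm, hgl, Real.exp_log (by positivity)]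
  set M : ℕ := 2 ^ (k + 2) with hM
  set H := heightBound ans n with hH
  have hMδ : (M : ℝ) ≤ 32 / δ := by
    rw [le_div_iff₀ hδ, hM]
    push_cast
    rw [pow_add]
    linarith
  have hMn : (M : ℝ) ≤ (n : ℝ) ^ (5 + g) := by
    calc (M : ℝ) ≤ 32 / δ := hMδ
      _ = 2 ^ (5 : ℝ) * 2 ^ g := by rw [← hδg]; norm_num; ring
      _ = 2 ^ (5 + g) := by rw [← Real.rpow_add (by norm_num)]
      _ ≤ (n : ℝ) ^ (5 + g) := by gcongr
  have hHn : (H : ℝ) ≤ (n : ℝ) ^ (D + 2) := by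
    rw [hH, heightBound]
    push_cast
    rw [← Real.rpow_natCast]
    refine Real.rpow_le_rpow_of_exponent_le hn1 ?_
    push_cast
    linarith
  have hnH : n ≤ H := by rw [hH, heightBound]; exact Nat.le_self_pow (by omega) n
  have hTm : (params ans n k).Tm ≤ 4 * (n * M * M * M * M * H) := by
    have e : (params ans n k).Tm = n * M * M * M * (2 * H + 2 * (n * M) + 4 + n + 2 * H + 1) := by
      simp only [params, hM, hH]
    have h1 : n * M ≤ H * M := Nat.mul_le_mul_right _ hnH
    have h2 : H * 24 ≤ H * M := Nat.mul_le_mul_left _ hk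
    have h3 : 2 * H + 2 * (n * M) + 4 + n + 2 * H + 1 ≤ 4 * (H * M) := by omega
    calc (params ans n k).Tm ≤ n * M * M * M * (4 * (H * M)) := by
          rw [e]; exact Nat.mul_le_mul_left _ h3
      _ = _ := by ring
  have hTmn : ((params ans n k).Tm : ℝ) ≤ (n : ℝ) ^ (25 + 4 * g + D) := by
    calc ((params ans n k).Tm : ℝ) ≤ 4 * (n * M * M * M * M * H) := by exact_mod_cast hTm
      _ ≤ (n ^ (2 : ℝ)) * (n ^ (1 : ℝ) * n ^ (5 + g) * n ^ (5 + g) * n ^ (5 + g) * n ^ (5 + g) *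
          n ^ (D + 2)) := by
          gcongr
          · rw [Real.rpow_two]; nlinarith
          · rw [Real.rpow_one]
      _ = (n : ℝ) ^ (25 + 4 * g + D) := by
          simp only [← Real.rpow_add hn0]
          congr 1
          ring
  have hZn : ((params ans n k).Z : ℝ) ≤ (n : ℝ) ^ ((7 + g) * (128 / δ)) := by
    have e : (params ans n k).Z = (2 * (n * M)) ^ (4 * M) := by simp only [params, hM]
    rw [e]
    push_cast
    calc (2 * ((n : ℝ) * M)) ^ (4 * M) ≤ (n ^ (1 : ℝ) * (n ^ (1 : ℝ) * n ^ (5 + g))) ^ (4 * M) := by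
          gcongr <;> rw [Real.rpow_one]
          exact hn2
      _ = (n ^ (7 + g)) ^ (4 * M) := by
          simp only [← Real.rpow_add hn0]
          congr 2
          ring
      _ = n ^ ((7 + g) * (4 * M : ℕ)) := by rw [← Real.rpow_natCast, ← Real.rpow_mul hn0.le]
      _ ≤ _ := by
          refine Real.rpow_le_rpow_of_exponent_le hn1 ?_
          gcongr
          push_cast
          have e2 : 128 / δ = 4 * (32 / δ) := by ring
          rw [e2]
          gcongr
  have htot : ((2 ^ 26 * ((params ans n k).Tm ^ 4 * (params ans n k).Z) ^ 2 : ℕ) : ℝ) ≤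
      (n : ℝ) ^ (26 + 8 * (25 + 4 * g + D) + 2 * ((7 + g) * (128 / δ))) := by
    have e : (n : ℝ) ^ (26 + 8 * (25 + 4 * g + D) + 2 * ((7 + g) * (128 / δ))) =
        n ^ 26 * ((n ^ (25 + 4 * g + D)) ^ 4 * n ^ ((7 + g) * (128 / δ))) ^ 2 := by
      simp only [← Real.rpow_natCast, ← Real.rpow_mul hn0.le, ← Real.rpow_add hn0]
      congr 1
      push_cast
      ring
    rw [e]
    simp only [Nat.cast_mul, Nat.cast_pow, Nat.cast_ofNat]
    gcongr
  -- With `u = 1 / δ`, the estimates `u ≤ g * u` and `2 * g ≤ g * u` bound the left side by `226 + 8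
  -- * D + 2064 * g * u`, and `3100 * log 2 ≥ 2139` leaves room for this and for the floor.
  have hexp : 26 + 8 * (25 + 4 * g + D) + 2 * ((7 + g) * (128 / δ)) ≤ timeExponent D δ := by
    have h1 := (Nat.lt_floor_add_one (3100 * (D + Real.log (1 / δ) / δ))).le
    change _ ≤ (timeExponent D δ : ℝ) + 1 at h1
    set u := 1 / δ with hu
    have e1 : Real.log u / δ = Real.log u * u := by rw [hu]; ring
    have e2 : 128 / δ = 128 * u := by rw [hu]; ring
    rw [e1, ← hgl] at h1
    rw [e2]
    have hl : 0.69 ≤ Real.log 2 := by linarith [Real.log_two_gt_d9]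
    have hgu : 0 ≤ g * u := by positivity
    have h3 : 2139 * (g * u) ≤ 3100 * (g * Real.log 2 * u) := by nlinarith
    have h4 : u ≤ g * u := le_mul_of_one_le_left (by linarith) hg1
    have h5 : 2 * g ≤ g * u := by nlinarith
    nlinarith
  have hfin : ((2 ^ 26 * ((params ans n k).Tm ^ 4 * (params ans n k).Z) ^ 2 : ℕ) : ℝ) ≤
      ((n ^ timeExponent D δ : ℕ) : ℝ) := by
    refine htot.trans ?_
    push_cast
    rw [← Real.rpow_natCast]
    exact Real.rpow_le_rpow_of_exponent_le hn1 hexp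
  exact_mod_cast hfin

end Algo

/-! ### The machine for each exponent -/

namespace Algo

/-- The algorithm is correct, whenever its questions are answered correctly. -/
theorem algorithm_correct {p : ENNReal} [hp : Fact (1 ≤ p)] {m : ℕ}
    {askC : OraclePort → StackCmd Stk (Mem m)} {ans len : OraclePort → List TapeSymbol → ℕ}
    {Ω : OraclePort → List TapeSymbol → List TapeSymbol} (hA : StackCmd.Answers Ω askC ans len)
    (hans : ∀ i w, i ≠ .exponent → ans i w = strVal (Ω i w) ∧ len i w = (Ω i w).length)
    (hexp : ∀ k, |(p⁻¹).toReal - ans .exponent (unaryCode k) / 2 ^ k| ≤ 1 / 2 ^ k ∧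
      len .exponent (unaryCode k) ≤ k + 2)
    {n : ℕ} {D δ : ℝ} (hn : 2 ≤ n) (hD : 1 ≤ D) (hδ : 0 < δ) (hδ1 : δ ≤ 1 / 2)
    {N : Seminorm ℝ (Fin n → ℝ)} (hN : IsSymmetricNorm N)
    (hbasis : ∀ i : Fin n, 1 / Real.exp ((n : ℝ) ^ D) ≤ N (Pi.single i 1) ∧
      N (Pi.single i 1) ≤ Real.exp ((n : ℝ) ^ D))
    (hbody : IsWeakMembershipOracle (unitBallIn 2 N) (Ω .body))
    (hdeg : IsRealOracle D (Ω .degree)) (hacc : IsRealOracle δ (Ω .accuracy)) :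
    ∃ r : ℚ, (algorithm askC).OutputsWithin Ω (natCode n) (n ^ timeExponent D δ) (ratCode r) ∧
      (1 - δ) * Metric.diam (unitBallIn p N) ≤ (r : ℝ) ∧
      (r : ℝ) ≤ (1 + δ) * Metric.diam (unitBallIn p N) := by
  -- the degree
  obtain ⟨hdeg1, hdeg2⟩ := hdeg.answer (by linarith) 0
  have hdeg0 := hans .degree [] (by decide)
  change |D - (strVal (Ω .degree []) : ℝ) / 2 ^ 0| ≤ 1 / 2 ^ 0 at hdeg1
  change (Ω .degree []).length = (strVal (Ω .degree [])).size at hdeg2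
  rw [← hdeg0.1, pow_zero, div_one, div_one] at hdeg1
  rw [← hdeg0.1, ← hdeg0.2] at hdeg2
  obtain ⟨hdeg3, hdeg4⟩ := abs_le.mp hdeg1
  have hlenD : len .degree [] ≤ ans .degree [] + 1 := by
    rw [hdeg2]
    exact (size_le_of_lt_two_pow Nat.lt_two_pow_self).trans (by omega)
  -- the accuracy
  have hacc' : ∀ k, |δ - (ans .accuracy (unaryCode k) : ℝ) / 2 ^ k| ≤ 1 / 2 ^ k := fun k => by
    rw [(hans .accuracy _ (by decide)).1]; exact (hacc.answer hδ k).1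
  obtain ⟨k, hk1, hk2, hk3, hk4, hk5⟩ :=
    exists_accuracy (a := fun k => ans .accuracy (unaryCode k)) hδ hδ1 hacc'
  have hM : 24 ≤ 2 ^ (k + 2) := by
    have h1 : (6 : ℝ) ≤ 2 ^ k := by nlinarith [pow_pos (by norm_num : (0 : ℝ) < 2) k]
    have h2 : 6 ≤ 2 ^ k := by exact_mod_cast h1
    rw [pow_add]
    omega
  have hC : ∀ i < k, 9 + 2 * (i + 1) + len .accuracy (unaryCode (i + 1)) ≤ 3 * k + 11 := by
    intro i hi
    have h1 : len .accuracy (unaryCode (i + 1)) ≤ i + 2 := by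
      have h3 := (hacc.answer hδ (i + 1)).2
      rw [← (hans .accuracy _ (by decide)).1, ← (hans .accuracy _ (by decide)).2] at h3
      rw [h3]
      refine size_le_of_lt_two_pow ?_
      have h4 := (abs_le.mp (hacc' (i + 1))).1
      have h2 : (0 : ℝ) < 2 ^ (i + 1) := by positivity
      have h5 : (ans .accuracy (unaryCode (i + 1)) : ℝ) / 2 ^ (i + 1) ≤ 1 := by
        have : (1 : ℝ) / 2 ^ (i + 1) ≤ 1 / 2 := by
          gcongr
          exact le_self_pow₀ (by norm_num) (by omega)
        linarith
      rw [div_le_one h2] at h5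
      have h6 : ans .accuracy (unaryCode (i + 1)) ≤ 2 ^ (i + 1) := by exact_mod_cast h5
      exact h6.trans_lt (Nat.pow_lt_pow_right (by norm_num) (by omega))
    omega
  -- the parameters
  have hc := suits_params (ans := ans) (n := n) (k := k) (θ := (p⁻¹).toReal) hn hM
    ENNReal.toReal_nonneg (hexp _).1
  set c := params ans n k with hcdef
  have hq := fun T code => answer_question hbody hc.n_eq (by omega) hc.even_R hc.R_ne_zero T code
    (cast_coords hc.n_eq T code)
  obtain ⟨best, hb1, hb2, hb3⟩ := algorithm_spec hA hn hk1 hC hk3 hk2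
    (fun T code => by rw [(hans .body _ (by decide)).1]; exact (hq T code).2.1)
    (fun T code => by rw [(hans .body _ (by decide)).2]; exact (hq T code).1.le)
    hlenD (hexp _).2
  obtain ⟨r, hr1, hr2⟩ := ratCode_output hc.even_R hc.R_ne_zero (by rw [hc.P_eq]; omega) best
  refine ⟨r, ?_, ?_⟩
  · rw [hr1]
    exact hb3 _ ((steps_le hn).trans (steps_le_pow hn hD hδ hδ1 hM hk5 (by linarith)))
  · rw [hr2]
    refine search_accuracy hN (fun i => (hbasis i).1) (fun i => (hbasis i).2) ?_ hc hbody
      (fun w => (hans .body w (by decide)).1) ?_ hδ1 hb1 hb2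
    · rw [heightBound]
      push_cast
      rw [← Real.rpow_natCast]
      refine Real.rpow_le_rpow_of_exponent_le (by exact_mod_cast (by omega : 1 ≤ n)) ?_
      push_cast
      linarith
    · push_cast
      rw [pow_add]
      linarith

theorem exists_eq_natCast_div {x : ℝ} (hx0 : 0 ≤ x) (hx1 : x ≤ 1) (hx : ¬ Irrational x) :
    ∃ m a : ℕ, a ≤ m + 1 ∧ x = a / (m + 1) := by
  rw [Irrational, not_not] at hx
  obtain ⟨q, rfl⟩ := hx
  have hq0 : 0 ≤ q := by exact_mod_cast hx0
  have hq1 : q ≤ 1 := by exact_mod_cast hx1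
  have hden : 0 < q.den := q.den_pos
  have e : ((q.den - 1 : ℕ) : ℝ) + 1 = q.den := by exact_mod_cast Nat.sub_add_cancel hden
  have hnum : ((q.num.toNat : ℕ) : ℤ) = q.num := Int.toNat_of_nonneg (Rat.num_nonneg.mpr hq0)
  refine ⟨q.den - 1, q.num.toNat, ?_, ?_⟩
  · rw [Nat.sub_add_cancel hden]
    have h1 : q.num ≤ q.den := by
      have := Rat.num_le_denom_iff.mpr hq1
      exact this
    omega
  · rw [e]
    have h1 : ((q.num.toNat : ℕ) : ℝ) = (q.num : ℝ) := by exact_mod_cast hnum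
    rw [h1]
    exact Rat.cast_def q

/-- The machine may depend on `p`. An irrational `1 / p` is positive and is read from its oracle; a
rational one, including `1 / ∞ = 0`, is built into the machine, and long division supplies its
digits. -/
theorem exists_algorithm (p : ENNReal) [hp : Fact (1 ≤ p)] : ∃ Alg : OracleTM,
    ∀ (n : ℕ) (D δ : ℝ), 2 ≤ n → 1 ≤ D → 0 < δ → δ ≤ 1 / 2 →
    ∀ N : Seminorm ℝ (Fin n → ℝ), IsSymmetricNorm N →
    (∀ i : Fin n, 1 / Real.exp ((n : ℝ) ^ D) ≤ N (Pi.single i 1) ∧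
      N (Pi.single i 1) ≤ Real.exp ((n : ℝ) ^ D)) →
    ∀ Ω : OraclePort → List TapeSymbol → List TapeSymbol,
    IsWeakMembershipOracle (unitBallIn 2 N) (Ω OraclePort.body) →
    IsRealOracle D (Ω OraclePort.degree) →
    IsRealOracle δ (Ω OraclePort.accuracy) →
    (Irrational (p⁻¹).toReal → IsRealOracle (p⁻¹).toReal (Ω OraclePort.exponent)) →
    ∃ r : ℚ, Alg.OutputsWithin Ω (natCode n) (n ^ timeExponent D δ) (ratCode r) ∧
      (1 - δ) * Metric.diam (unitBallIn p N) ≤ (r : ℝ) ∧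
      (r : ℝ) ≤ (1 + δ) * Metric.diam (unitBallIn p N) := by
  have hθ0 : 0 ≤ (p⁻¹).toReal := ENNReal.toReal_nonneg
  have hθ1 : (p⁻¹).toReal ≤ 1 := by
    have : p⁻¹ ≤ 1 := ENNReal.inv_le_one.mpr hp.out
    simpa using ENNReal.toReal_mono ENNReal.one_ne_top this
  by_cases hirr : Irrational (p⁻¹).toReal
  · refine ⟨algorithm (N := 0) fun i => .ask i, ?_⟩
    intro n D δ hn hD hδ hδ1 N hN hbasis Ω hbody hdeg hacc hexp
    refine algorithm_correct (StackCmd.answers_ask Ω) (fun i w _ => ⟨rfl, rfl⟩) (fun k => ?_) hn hD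
      hδ hδ1 hN hbasis hbody hdeg hacc
    have hθ : 0 < (p⁻¹).toReal := lt_of_le_of_ne hθ0 fun h => hirr.ne_zero h.symm
    obtain ⟨h1, h2⟩ := (hexp hirr).answer hθ k
    refine ⟨h1, ?_⟩
    rw [h2]
    refine size_le_of_lt_two_pow ?_
    have h3 : (0 : ℝ) < 2 ^ k := by positivity
    have h4 := (abs_le.mp h1).1
    have h5 : (strVal (Ω .exponent (unaryCode k)) : ℝ) / 2 ^ k ≤ 2 := by
      have : (1 : ℝ) / 2 ^ k ≤ 1 := by
        rw [div_le_one h3]; exact one_le_pow₀ (by norm_num)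
      linarith
    rw [div_le_iff₀ h3] at h5
    have h6 : strVal (Ω .exponent (unaryCode k)) ≤ 2 * 2 ^ k := by exact_mod_cast h5
    have h7 : 0 < 2 ^ k := by positivity
    rw [pow_add]
    omega
  · obtain ⟨m, a, ha, hθ⟩ := exists_eq_natCast_div hθ0 hθ1 hirr
    refine ⟨algorithm (StackCmd.askOrDivide m a), ?_⟩
    intro n D δ hn hD hδ hδ1 N hN hbasis Ω hbody hdeg hacc _
    refine algorithm_correct (StackCmd.answers_askOrDivide ha Ω)
      (fun i w hi => ⟨by simp [hi], by simp [hi]⟩) (fun k => ?_) hn hD hδ hδ1 hN hbasis hbody hdeg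
      hacc
    simp only [if_true, unaryCode, List.length_replicate]
    refine ⟨?_, by omega⟩
    have h3 : (0 : ℝ) < 2 ^ k := by positivity
    have hm : (0 : ℝ) < (m : ℝ) + 1 := by positivity
    have h8 : ((a * 2 ^ k / (m + 1) : ℕ) : ℝ) ≤ a * 2 ^ k / (m + 1) := by
      have := Nat.cast_div_le (α := ℝ) (m := a * 2 ^ k) (n := m + 1)
      push_cast at this
      exact this
    have h9 : (a : ℝ) * 2 ^ k / (m + 1) ≤ ((a * 2 ^ k / (m + 1) : ℕ) : ℝ) + 1 := by
      rw [div_le_iff₀ hm]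
      have := (Nat.lt_div_mul_add (a := a * 2 ^ k) (b := m + 1) (by positivity)).le
      have h10 : ((a * 2 ^ k : ℕ) : ℝ) ≤
          ((a * 2 ^ k / (m + 1) * (m + 1) + (m + 1) : ℕ) : ℝ) := by exact_mod_cast this
      rw [Nat.cast_add, Nat.cast_mul (a * 2 ^ k / (m + 1))] at h10
      push_cast at h10 ⊢
      linarith
    generalize a * 2 ^ k / (m + 1) = f at *
    have e : (a : ℝ) / (m + 1) - f / 2 ^ k = (a * 2 ^ k / (m + 1) - f) / 2 ^ k := by
      field_simp
    rw [hθ, e, abs_div, abs_of_pos h3]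
    gcongr
    rw [abs_le]
    constructor <;> linarith

end Algo

theorem mainTheorem5 :
    ∃ κ : ℝ, 0 < κ ∧ ∃ d : ℝ → ℝ → ℕ,
      (∀ D δ : ℝ, 1 ≤ D → 0 < δ → δ ≤ 1 / 2 →
        (d D δ : ℝ) ≤ κ * (D + Real.log (1 / δ) / δ)) ∧
      ∀ (p : ENNReal) [Fact (1 ≤ p)], ∃ Alg : OracleTM,
        ∀ (n : ℕ) (D δ : ℝ), 2 ≤ n → 1 ≤ D → 0 < δ → δ ≤ 1 / 2 →
        ∀ N : Seminorm ℝ (Fin n → ℝ), IsSymmetricNorm N →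
        (∀ i : Fin n, 1 / Real.exp ((n : ℝ) ^ D) ≤ N (Pi.single i 1) ∧
          N (Pi.single i 1) ≤ Real.exp ((n : ℝ) ^ D)) →
        ∀ Ω : OraclePort → List TapeSymbol → List TapeSymbol,
        IsWeakMembershipOracle (unitBallIn 2 N) (Ω OraclePort.body) →
        IsRealOracle D (Ω OraclePort.degree) →
        IsRealOracle δ (Ω OraclePort.accuracy) →
        (Irrational (p⁻¹).toReal → IsRealOracle (p⁻¹).toReal (Ω OraclePort.exponent)) →
        ∃ r : ℚ, Alg.OutputsWithin Ω (natCode n) (n ^ d D δ) (ratCode r) ∧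
          (1 - δ) * Metric.diam (unitBallIn p N) ≤ (r : ℝ) ∧
          (r : ℝ) ≤ (1 + δ) * Metric.diam (unitBallIn p N) := by
  refine ⟨3100, by norm_num, Algo.timeExponent, fun D δ hD hδ hδ1 => ?_,
    fun p _ => Algo.exists_algorithm p⟩
  refine Nat.floor_le ?_
  have : 0 ≤ Real.log (1 / δ) := Real.log_nonneg (by rw [le_div_iff₀ hδ]; linarith)
  positivity
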